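/- Let $n\ge 1$ and let $F\subset \mathrm{Sym}(\mathbb R^n)$ be a non-empty closed set of real symmetric $n\times n$ matrices such that $F+P\subset F$ for every positive semidefinite $P$, such that $tF\subset F$ for all $t\ge 0$, and such that $gFg^{T}\subset F$ for all $g$ in some subgroup $G\subset \mathrm O(n)$ acting transitively on the unit sphere $S^{n-1}$. For a unit vector $e$ let $P_e=ee^{T}$ and $P_{e^\perp}=I-P_e$, and assume that the Riesz characteristic $$p=p_F=\sup\{q\in\mathbb R : P_{e^\perp}-(q-1)P_e\in F\}$$ (which does not depend on $e$) is finite. Let $K(t)=t^{2-p}$ if $1\le p<2$, $K(t)=\log t$ if $p=2$, and $K(t)=-t^{-(p-2)}$ if $p>2$. Let $X\subset\mathbb R^n$ be open and let $u:X\to[-\infty,\infty)$ be $F$-subharmonic in the viscosity sense: $u$ is upper semi-continuous, and $D^2\varphi(x)\in F$ whenever $x\in X$, $\varphi$ is $C^2$ near $x$, $u\le\varphi$ near $x$ and $u(x)=\varphi(x)$. Assume that $u$ is not identically $-\infty$ on any connected component of $X$. With $S$ and $B$ the unit sphere and the closed unit ball of $\mathbb R^n$ (with surface measure, which is counting measure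 when $n=1$, and Lebesgue measure), put, for $x\in X$ and small $r>0$, $$M(u,x;r)=\sup_{\sigma\in S}u(x+r\sigma),\qquad S(u,x;r)=\frac1{|S|}\int_S u(x+r\sigma)\,d\sigma,\qquad V(u,x;r)=\frac1{|B|}\int_B u(x+ry)\,dy .$$ For $\Psi\in\{M,S,V\}$ define the density $$\Theta^{\Psi}(u,x)=\lim_{\substack{s,t\to0\\ 0<s<t}}\frac{\Psi(u,x;t)-\Psi(u,x;s)}{K(t)-K(s)} .$$ Then the following holds for $\Psi=M$, and, if $F$ is convex, also for $\Psi=S$ and $\Psi=V$. For each $x\in X$ the number $\Psi(u,x;r)$ is finite for all sufficiently small $r>0$ and the limit $\Theta^{\Psi}(u,x)$ exists in $\mathbb R$; the function $x\mapsto\Theta^{\Psi}(u,x)$ is upper semi-continuous on $X$; and for every $c\ge 0$ the set $$E_c=\{x\in X:\Theta^{\Psi}(u,x)\ge c\}$$ is closed in $X$. -/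

import Mathlib

open MeasureTheory Filter Topology

namespace RieszDensity

noncomputable section

/-- Euclidean space `ℝⁿ`. -/
abbrev E (n : ℕ) : Type := EuclideanSpace ℝ (Fin n)

/-- Orthogonal projection `P_e = e eᵀ` onto the line spanned by the unit vector `e`. -/
def lineProj {n : ℕ} (e : E n) : Matrix (Fin n) (Fin n) ℝ :=
  Matrix.vecMulVec e.ofLp e.ofLp

/-- An ST-invariant cone subequation: a non-empty closed set `F` of symmetric matrices with
`F + 𝒫 ⊆ F` (`𝒫` the positive semidefinite matrices), `t F ⊆ F` for `t ≥ 0`, which is invariant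
under a subgroup of `O(n)` that acts transitively on the unit sphere. -/
structure IsSTConeSubequation {n : ℕ} (F : Set (Matrix (Fin n) (Fin n) ℝ)) : Prop where
  nonempty : F.Nonempty
  symm : ∀ A ∈ F, A.IsSymm
  isClosed : IsClosed F
  positivity : ∀ A ∈ F, ∀ P : Matrix (Fin n) (Fin n) ℝ, P.PosSemidef → A + P ∈ F
  cone : ∀ A ∈ F, ∀ t : ℝ, 0 ≤ t → t • A ∈ F
  invariant : ∃ G : Subgroup (Matrix.orthogonalGroup (Fin n) ℝ),
    (∀ e e' : E n, ‖e‖ = 1 → ‖e'‖ = 1 →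
      ∃ g ∈ G, Matrix.mulVec (g : Matrix (Fin n) (Fin n) ℝ) e.ofLp = e'.ofLp) ∧
    ∀ g ∈ G, ∀ A ∈ F,
      (g : Matrix (Fin n) (Fin n) ℝ) * A * (g : Matrix (Fin n) (Fin n) ℝ).transpose ∈ F

/-- The (increasing) Riesz characteristic `p_F = sup {q : P_{e^⊥} - (q - 1) P_e ∈ F}`, an extended
real number. For ST-invariant `F` membership does not depend on the unit vector `e`. -/
def rieszChar {n : ℕ} (F : Set (Matrix (Fin n) (Fin n) ℝ)) : EReal :=
  sSup ((fun q : ℝ => (q : EReal)) ''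
    {q : ℝ | ∀ e : E n, ‖e‖ = 1 → (1 - lineProj e) - (q - 1) • lineProj e ∈ F})

/-- The Hessian matrix `D²φ(x)`. -/
def hessian {n : ℕ} (φ : E n → ℝ) (x : E n) : Matrix (Fin n) (Fin n) ℝ :=
  Matrix.of fun i j =>
    fderiv ℝ (fderiv ℝ φ) x (EuclideanSpace.single i 1) (EuclideanSpace.single j 1)

/-- `u` is (viscosity) `F`-subharmonic on `X`: it is upper semi-continuous on `X` with values in
`[-∞, ∞)`, and `D²φ(x) ∈ F` whenever `φ` is `C²` near a point `x ∈ X` and touches `u` from above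
at `x`. Only the values of `u` on `X` matter when `X` is open. -/
structure IsSubharmonicOn {n : ℕ} (F : Set (Matrix (Fin n) (Fin n) ℝ)) (X : Set (E n))
    (u : E n → EReal) : Prop where
  usc : UpperSemicontinuousOn u X
  ne_top : ∀ x ∈ X, u x ≠ ⊤
  viscosity : ∀ x ∈ X, ∀ φ : E n → ℝ, ContDiffAt ℝ 2 φ x → u x = (φ x : EReal) →
    (∀ᶠ y in 𝓝 x, u y ≤ (φ y : EReal)) → hessian φ x ∈ F

/-- The Riesz kernel `K_p(t)`, `t > 0`. -/
def rieszKernel (p t : ℝ) : ℝ :=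
  if p < 2 then t ^ (2 - p) else if p = 2 then Real.log t else -(1 / t ^ (p - 2))

/-- Spherical maximum `M(u, x; r)`. -/
def sphereMax {n : ℕ} (u : E n → EReal) (x : E n) (r : ℝ) : EReal :=
  ⨆ σ : Metric.sphere (0 : E n) 1, u (x + r • (σ : E n))

/-- Integral `∫ f⁺ - ∫ f⁻` of an extended real valued function. It is only used for measurable
functions that are bounded above and for finite measures, where the first term is finite. -/
def extIntegral {α : Type*} [MeasurableSpace α] (μ : Measure α) (f : α → EReal) : EReal :=
  ((∫⁻ a, (f a).toENNReal ∂μ : ENNReal) : EReal) - ((∫⁻ a, (-f a).toENNReal ∂μ : ENNReal) : EReal)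

/-- The probability measure on the unit sphere proportional to surface measure. -/
def sphereMeasure (n : ℕ) : Measure (Metric.sphere (0 : E n) 1) :=
  ((volume : Measure (E n)).toSphere Set.univ)⁻¹ • (volume : Measure (E n)).toSphere

/-- The probability measure proportional to Lebesgue measure on the closed unit ball. -/
def ballMeasure (n : ℕ) : Measure (E n) :=
  (volume (Metric.closedBall (0 : E n) 1))⁻¹ • volume.restrict (Metric.closedBall (0 : E n) 1)

/-- Spherical average `S(u, x; r)`. -/
def sphereAvg {n : ℕ} (u : E n → EReal) (x : E n) (r : ℝ) : EReal :=
  extIntegral (sphereMeasure n) fun σ => u (x + r • (σ : E n))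

/-- Volume average `V(u, x; r)`. -/
def ballAvg {n : ℕ} (u : E n → EReal) (x : E n) (r : ℝ) : EReal :=
  extIntegral (ballMeasure n) fun y => u (x + r • y)

/-- The quotient `(ψ(t) - ψ(s)) / (K_p(t) - K_p(s))` at the pair `(s, t)`. -/
def kernelQuotient (p : ℝ) (ψ : ℝ → EReal) (q : ℝ × ℝ) : ℝ :=
  ((ψ q.2).toReal - (ψ q.1).toReal) / (rieszKernel p q.2 - rieszKernel p q.1)

/-- The pairs `(s, t)` with `0 < s < t`, tending to `(0, 0)`. -/
def pairsToZero : Filter (ℝ × ℝ) :=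
  𝓝[{q : ℝ × ℝ | 0 < q.1 ∧ q.1 < q.2}] (0, 0)

/-- The density `Θ^ψ = lim_{0 < s < t → 0} (ψ(t) - ψ(s)) / (K_p(t) - K_p(s))`. -/
def density (p : ℝ) (ψ : ℝ → EReal) : ℝ :=
  limUnder pairsToZero (kernelQuotient p ψ)

/-- The density of `ψ` exists: `ψ(r)` is finite for all small `r > 0` and the limit defining
`Θ^ψ` exists as a real number. -/
def DensityExists (p : ℝ) (ψ : ℝ → EReal) : Prop :=
  (∀ᶠ r in 𝓝[>] (0 : ℝ), ψ r ≠ ⊥ ∧ ψ r ≠ ⊤) ∧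
    Tendsto (kernelQuotient p ψ) pairsToZero (𝓝 (density p ψ))

/-- The assertion that the density function `x ↦ Θ^Ψ(x)` of the family of averages
`Ψ(x; ·)` is defined at every point of `X`, is upper semi-continuous on `X`, and that all its
superlevel sets `E_c = {x ∈ X : Θ^Ψ(x) ≥ c}`, `c ≥ 0`, are closed in `X`. -/
def UpperSemicontinuousDensity {n : ℕ} (p : ℝ) (X : Set (E n)) (Ψ : E n → ℝ → EReal) : Prop :=
  (∀ x ∈ X, DensityExists p (Ψ x)) ∧
    UpperSemicontinuousOn (fun x => density p (Ψ x)) X ∧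
    ∀ c : ℝ, 0 ≤ c → IsClosed {x : X | c ≤ density p (Ψ x)}

end

end RieszDensity

/-!
The Hessian of the radial kernel `K_p(|x|)` is a positive multiple of `P_{e^⊥} - (p - 1) P_e`, which
lies on the boundary of `F`. Comparison with `a K_p(|y - x|) + b` on annuli therefore shows that
`M(u, x; r)` is a nondecreasing convex function of `K_p(r)`. Convexity gives the existence of the
density, as the limit of slopes, and presents it as an infimum of slopes; the latter is upper
semicontinuous in `x` because a continuous function of the centre fits between `M(u, y; s)` and
`M(u, y; t)` whenever `s < t`.

If `F` is convex, then it is an intersection of half-spaces `{ℓ ≥ 0}` with `ℓ` degenerate elliptic,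
by Hahn-Banach. Every such `ℓ` has a harmonic measure on the unit sphere, and being subharmonic for
`ℓ` in the viscosity sense amounts to an inequality of mean values over these measures. Mean value
inequalities can be integrated, so averages of `F`-subharmonic functions are `F`-subharmonic. In
particular averaging `u` over the rotations about `x` by Haar measure on the invariance group
produces radial `F`-subharmonic functions whose spherical maxima are `S(u, x; ·)` and `V(u, x; ·)`,
and the result for `M` applies to them. The continuous functions of the centre that fit between
averages of two radii are now the averages of `u` over balls and annuli.
-/

namespace RieszDensity

open Metric

section Calculus

variable {V : Type*} [NormedAddCommGroup V] [NormedSpace ℝ V] {φ : V → ℝ} {x : V}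

theorem differentiableAt_fderiv_of_contDiffAt (h : ContDiffAt ℝ 2 φ x) :
    DifferentiableAt ℝ (fderiv ℝ φ) x :=
  (h.fderiv_right (m := 1) (by norm_num)).differentiableAt (by norm_num)

theorem eventually_differentiableAt_of_contDiffAt (h : ContDiffAt ℝ 2 φ x) :
    ∀ᶠ y in 𝓝 x, DifferentiableAt ℝ φ y :=
  (h.eventually (by simp)).mono fun _ hy => hy.differentiableAt (by norm_num)

theorem isLittleO_taylor_two (h : ContDiffAt ℝ 2 φ x) :
    (fun y => φ y - φ x - fderiv ℝ φ x (y - x) -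
      1 / 2 * fderiv ℝ (fderiv ℝ φ) x (y - x) (y - x)) =o[𝓝 x] fun y => ‖y - x‖ ^ 2 := by
  set A := fderiv ℝ φ x
  set H := fderiv ℝ (fderiv ℝ φ) x
  have hsymm : ∀ v w, H v w = H w v := h.isSymmSndFDerivAt (by simp)
  let ψ : V → ℝ := fun y => φ y - A (y - x) - 1 / 2 * H (y - x) (y - x)
  have hψ (y : V) (hy : DifferentiableAt ℝ φ y) :
      HasFDerivAt ψ (fderiv ℝ φ y - A - H (y - x)) y := by
    have h1 : HasFDerivAt (fun y : V => y - x) (ContinuousLinearMap.id ℝ V) y :=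
      (hasFDerivAt_id y).sub_const x
    have h2 := (hy.hasFDerivAt.sub (A.hasFDerivAt.comp y h1)).sub
      (((H.hasFDerivAt.comp y h1).clm_apply h1).const_mul (1 / 2 : ℝ))
    refine h2.congr_fderiv ?_
    ext v
    have hs := hsymm v (y - x)
    simp only [map_sub, sub_apply] at hs
    simp
    linarith
  obtain ⟨δ, hδ, hdiff⟩ :=
    eventually_nhds_iff_ball.1 (eventually_differentiableAt_of_contDiffAt h)
  have hψ' : (fun y => fderiv ℝ φ y - A - H (y - x)) =o[𝓝[ball x δ] x] fun y => ‖y - x‖ ^ 1 := by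
    simpa only [pow_one] using
      ((differentiableAt_fderiv_of_contDiffAt h).hasFDerivAt.isLittleO.mono
        nhdsWithin_le_nhds).norm_right
  have hlit := (convex_ball x δ).isLittleO_pow_succ (mem_ball_self hδ)
    (fun y hy => (hψ y (hdiff y hy)).hasFDerivWithinAt) hψ'
  rw [nhdsWithin_eq_nhds.2 (ball_mem_nhds x hδ)] at hlit
  refine hlit.congr_left fun y => ?_
  simp only [ψ, sub_self, map_zero, mul_zero, sub_zero]
  ring

theorem tendsto_second_order_quotient (h : ContDiffAt ℝ 2 φ x) (v : V) :
    Tendsto (fun t : ℝ => (φ (x + t • v) - φ x - t * fderiv ℝ φ x v) / t ^ 2) (𝓝[≠] 0)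
      (𝓝 (1 / 2 * fderiv ℝ (fderiv ℝ φ) x v v)) := by
  have hline : Tendsto (fun t : ℝ => x + t • v) (𝓝 0) (𝓝 x) := by
    simpa using (continuous_const.add (continuous_id.smul continuous_const)).tendsto
      (f := fun t : ℝ => x + t • v) 0
  have hrest : (fun t : ℝ => φ (x + t • v) - φ x - t * fderiv ℝ φ x v -
      t ^ 2 * (1 / 2 * fderiv ℝ (fderiv ℝ φ) x v v)) =o[𝓝[≠] 0] fun t : ℝ => t ^ 2 := by
    have hcomp := ((isLittleO_taylor_two h).comp_tendsto hline).mono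
      (nhdsWithin_le_nhds (s := {0}ᶜ))
    refine (hcomp.congr (fun t => ?_) fun t => ?_).trans_isBigO
      (Asymptotics.isBigO_const_mul_self (‖v‖ ^ 2) _ _)
    · simp
      ring
    · simp [norm_smul, mul_pow, mul_comm]
  have hlim := hrest.tendsto_div_nhds_zero.add_const (1 / 2 * fderiv ℝ (fderiv ℝ φ) x v v)
  rw [zero_add] at hlim
  refine hlim.congr' ?_
  filter_upwards [self_mem_nhdsWithin] with t ht
  have ht' : t ≠ 0 := ht
  field_simp
  ring

theorem fderiv_fderiv_nonneg_of_isLocalMin (h : ContDiffAt ℝ 2 φ x) (hm : IsLocalMin φ x)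
    (v : V) : 0 ≤ fderiv ℝ (fderiv ℝ φ) x v v := by
  have hlim := tendsto_second_order_quotient h v
  have hline : Tendsto (fun t : ℝ => x + t • v) (𝓝[≠] 0) (𝓝 x) := by
    simpa using ((continuous_const.add (continuous_id.smul continuous_const)).tendsto
      (f := fun t : ℝ => x + t • v) 0).mono_left nhdsWithin_le_nhds
  have hnonneg := ge_of_tendsto hlim <| (hline.eventually hm).mono fun t ht => by
    rw [hm.fderiv_eq_zero]
    simp only [zero_apply, mul_zero, sub_zero]
    exact div_nonneg (sub_nonneg.2 ht) (sq_nonneg t)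
  linarith

end Calculus

section Hessian

variable {n : ℕ} {φ ψ : E n → ℝ} {x : E n}

theorem sum_single_smul (v : E n) : ∑ i, v i • EuclideanSpace.single i (1 : ℝ) = v := by
  ext j
  simp [Pi.single_apply]

theorem dotProduct_hessian_mulVec (φ : E n → ℝ) (x v w : E n) :
    v.ofLp ⬝ᵥ (hessian φ x).mulVec w.ofLp = fderiv ℝ (fderiv ℝ φ) x v w := by
  conv_rhs => rw [← sum_single_smul v, ← sum_single_smul w]
  simp only [map_sum, map_smul, sum_apply, smul_apply,
    dotProduct, Matrix.mulVec, hessian, Matrix.of_apply, smul_eq_mul, Finset.mul_sum]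
  rw [Finset.sum_comm]
  refine Finset.sum_congr rfl fun i _ => Finset.sum_congr rfl fun j _ => ?_
  ring

theorem isSymm_hessian (h : ContDiffAt ℝ 2 φ x) : (hessian φ x).IsSymm := by
  ext i j
  simpa [hessian] using (h.isSymmSndFDerivAt (by simp)) (EuclideanSpace.single j 1)
    (EuclideanSpace.single i 1)

theorem posSemidef_hessian_of_isLocalMin (h : ContDiffAt ℝ 2 φ x) (hm : IsLocalMin φ x) :
    (hessian φ x).PosSemidef := by
  refine Matrix.PosSemidef.of_dotProduct_mulVec_nonneg ?_ fun v => ?_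
  · rw [Matrix.IsHermitian, Matrix.conjTranspose_eq_transpose_of_trivial]
    exact isSymm_hessian h
  · have hv := fderiv_fderiv_nonneg_of_isLocalMin h hm (WithLp.toLp 2 v)
    rw [← dotProduct_hessian_mulVec] at hv
    simpa using hv

theorem hessian_eq_of_hasFDerivAt {φ' : E n → E n →L[ℝ] ℝ} {φ'' : E n →L[ℝ] E n →L[ℝ] ℝ}
    (h1 : ∀ᶠ y in 𝓝 x, HasFDerivAt φ (φ' y) y) (h2 : HasFDerivAt φ' φ'' x) :
    hessian φ x = Matrix.of fun i j =>
      φ'' (EuclideanSpace.single i 1) (EuclideanSpace.single j 1) := by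
  have : fderiv ℝ φ =ᶠ[𝓝 x] φ' := h1.mono fun y hy => hy.fderiv
  rw [hessian, this.fderiv_eq, h2.fderiv]

theorem hessian_add (hφ : ContDiffAt ℝ 2 φ x) (hψ : ContDiffAt ℝ 2 ψ x) :
    hessian (fun y => φ y + ψ y) x = hessian φ x + hessian ψ x := by
  rw [hessian_eq_of_hasFDerivAt (φ' := fun y => fderiv ℝ φ y + fderiv ℝ ψ y)
    (φ'' := fderiv ℝ (fderiv ℝ φ) x + fderiv ℝ (fderiv ℝ ψ) x)]
  · ext i j
    simp [hessian]
  · filter_upwards [eventually_differentiableAt_of_contDiffAt hφ,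
      eventually_differentiableAt_of_contDiffAt hψ] with y h1 h2
    exact h1.hasFDerivAt.add h2.hasFDerivAt
  · exact (differentiableAt_fderiv_of_contDiffAt hφ).hasFDerivAt.add
      (differentiableAt_fderiv_of_contDiffAt hψ).hasFDerivAt

theorem hessian_const_mul (hφ : ContDiffAt ℝ 2 φ x) (c : ℝ) :
    hessian (fun y => c * φ y) x = c • hessian φ x := by
  rw [hessian_eq_of_hasFDerivAt (φ' := fun y => c • fderiv ℝ φ y)
    (φ'' := c • fderiv ℝ (fderiv ℝ φ) x)]
  · ext i j
    simp [hessian]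
  · filter_upwards [eventually_differentiableAt_of_contDiffAt hφ] with y h1
    exact h1.hasFDerivAt.const_mul c
  · exact (differentiableAt_fderiv_of_contDiffAt hφ).hasFDerivAt.const_smul c

theorem hessian_add_const (φ : E n → ℝ) (c : ℝ) (x : E n) :
    hessian (fun y => φ y + c) x = hessian φ x := by
  have : fderiv ℝ (fun y => φ y + c) = fderiv ℝ φ := by
    ext y v
    simp
  simp only [hessian, this]

theorem hessian_const (c : ℝ) (x : E n) : hessian (fun _ => c) x = 0 := by
  ext i j
  simp [hessian]

theorem hessian_comp_sub (φ : E n → ℝ) (a x : E n) :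
    hessian (fun y => φ (y - a)) x = hessian φ (x - a) := by
  have : fderiv ℝ (fun y => φ (y - a)) = fun y => fderiv ℝ φ (y - a) :=
    funext fun _ => fderiv_comp_sub a
  simp only [hessian, this, fderiv_comp_sub]

/-- The linear map `v ↦ g v` of `ℝⁿ` given by a matrix `g`. -/
noncomputable abbrev matMap (g : Matrix (Fin n) (Fin n) ℝ) : E n →L[ℝ] E n :=
  Matrix.toEuclideanCLM (𝕜 := ℝ) g

theorem hessian_comp_affine (g : Matrix (Fin n) (Fin n) ℝ) (c x : E n)
    (h : ContDiffAt ℝ 2 φ (matMap g x + c)) :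
    hessian (fun y => φ (matMap g y + c)) x =
      g.transpose * hessian φ (matMap g x + c) * g := by
  set L := matMap g with hL
  have hA : ∀ y, HasFDerivAt (fun y => L y + c) L y := fun y => L.hasFDerivAt.add_const c
  rw [hessian_eq_of_hasFDerivAt (φ' := fun y => (fderiv ℝ φ (L y + c)).comp L)
    (φ'' := ((ContinuousLinearMap.compL ℝ (E n) (E n) ℝ).flip L).comp
      ((fderiv ℝ (fderiv ℝ φ) (L x + c)).comp L))]
  · ext i j
    simp only [Matrix.of_apply, ContinuousLinearMap.comp_apply, ContinuousLinearMap.flip_apply,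
      ContinuousLinearMap.compL_apply]
    rw [← dotProduct_hessian_mulVec, hL, matMap, Matrix.ofLp_toEuclideanCLM,
      Matrix.ofLp_toEuclideanCLM, PiLp.ofLp_single, PiLp.ofLp_single, Matrix.mulVec_single_one,
      Matrix.mulVec_single_one, Matrix.mul_assoc]
    simp [Matrix.mul_apply, dotProduct, Matrix.mulVec, Matrix.col]
  · have hc : Tendsto (fun y => L y + c) (𝓝 x) (𝓝 (L x + c)) :=
      (L.continuous.add continuous_const).tendsto x
    filter_upwards [hc.eventually (eventually_differentiableAt_of_contDiffAt h)] with y hy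
    exact hy.hasFDerivAt.comp y (hA y)
  · exact ((ContinuousLinearMap.compL ℝ (E n) (E n) ℝ).flip L).hasFDerivAt.comp x
      ((differentiableAt_fderiv_of_contDiffAt h).hasFDerivAt.comp x (hA x))

theorem hessian_comp_norm_sq {f f' : ℝ → ℝ} {f'' : ℝ}
    (h1 : ∀ᶠ s in 𝓝 (‖x‖ ^ 2), HasDerivAt f (f' s) s) (h2 : HasDerivAt f' f'' (‖x‖ ^ 2)) :
    hessian (fun y => f (‖y‖ ^ 2)) x =
      (2 * f' (‖x‖ ^ 2)) • (1 : Matrix (Fin n) (Fin n) ℝ) + (4 * f'') • lineProj x := by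
  have hsq : ∀ y : E n, HasFDerivAt (fun y : E n => ‖y‖ ^ 2) (2 • innerSL ℝ y) y :=
    fun y => (hasStrictFDerivAt_norm_sq y).hasFDerivAt
  have hc : Tendsto (fun y : E n => ‖y‖ ^ 2) (𝓝 x) (𝓝 (‖x‖ ^ 2)) :=
    (continuous_norm.pow 2).tendsto x
  rw [hessian_eq_of_hasFDerivAt (φ' := fun y => f' (‖y‖ ^ 2) • (2 • innerSL ℝ y))
    (φ'' := f' (‖x‖ ^ 2) • (2 • innerSL ℝ) +
      (f'' • (2 • innerSL ℝ x)).smulRight (2 • innerSL ℝ x))]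
  · ext i j
    have hij : innerSL ℝ (EuclideanSpace.single i (1 : ℝ)) (EuclideanSpace.single j (1 : ℝ)) =
        if i = j then 1 else 0 := by
      simp [innerSL_apply_apply, EuclideanSpace.inner_single_left]
    simp [lineProj, Matrix.vecMulVec_apply, Matrix.one_apply, hij,
      EuclideanSpace.inner_single_right]
    split_ifs <;> ring
  · filter_upwards [hc.eventually h1] with y hy
    exact hy.comp_hasFDerivAt y (hsq y)
  · have h3 : HasFDerivAt (fun y : E n => 2 • innerSL ℝ y)
        (2 • innerSL ℝ : E n →L[ℝ] E n →L[ℝ] ℝ) x :=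
      (2 • innerSL ℝ : E n →L[ℝ] E n →L[ℝ] ℝ).hasFDerivAt
    exact (h2.comp_hasFDerivAt x (hsq x)).smul h3

theorem hessian_norm_sq (x : E n) :
    hessian (fun y : E n => ‖y‖ ^ 2) x = (2 : ℝ) • (1 : Matrix (Fin n) (Fin n) ℝ) := by
  simpa using hessian_comp_norm_sq (x := x) (f := id) (f' := fun _ => 1)
    (Eventually.of_forall hasDerivAt_id) (hasDerivAt_const _ _)

theorem contDiffAt_norm_sq (x : E n) : ContDiffAt ℝ 2 (fun y : E n => ‖y‖ ^ 2) x :=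
  (contDiff_norm_sq ℝ).contDiffAt

end Hessian

section Subequation

variable {n : ℕ} {F : Set (Matrix (Fin n) (Fin n) ℝ)} {p : ℝ} {e e' : E n}

theorem lineProj_smul (t : ℝ) (e : E n) : lineProj (t • e) = t ^ 2 • lineProj e := by
  ext i j
  simp [lineProj, Matrix.vecMulVec_apply]
  ring

theorem posSemidef_lineProj (e : E n) : (lineProj e).PosSemidef := by
  simpa [lineProj] using Matrix.posSemidef_vecMulVec_self_star e.ofLp

theorem norm_sq_eq_dotProduct (v : E n) : ‖v‖ ^ 2 = v.ofLp ⬝ᵥ v.ofLp := by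
  rw [EuclideanSpace.real_norm_sq_eq]
  simp [dotProduct, sq]

theorem posSemidef_one_sub_lineProj (he : ‖e‖ = 1) : (1 - lineProj e).PosSemidef := by
  refine Matrix.PosSemidef.of_dotProduct_mulVec_nonneg
    (Matrix.isHermitian_one.sub (posSemidef_lineProj e).1) fun v => ?_
  have h := real_inner_mul_inner_self_le (WithLp.toLp 2 v) e
  rw [real_inner_self_eq_norm_sq, real_inner_self_eq_norm_sq, he,
    norm_sq_eq_dotProduct] at h
  simp only [EuclideanSpace.inner_eq_star_dotProduct, star_trivial] at h
  simp only [star_trivial, Matrix.sub_mulVec, Matrix.one_mulVec, dotProduct_sub, lineProj,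
    Matrix.vecMulVec_mulVec, dotProduct_smul, MulOpposite.smul_eq_mul_unop,
    MulOpposite.unop_op]
  rw [dotProduct_comm v e.ofLp]
  linarith

theorem conj_lineProj {g : Matrix (Fin n) (Fin n) ℝ} (h : g.mulVec e.ofLp = e'.ofLp) :
    g * lineProj e * g.transpose = lineProj e' := by
  rw [lineProj, Matrix.mul_vecMulVec, Matrix.vecMulVec_mul, Matrix.vecMul_transpose, h, lineProj]

theorem mul_transpose_of_mem_orthogonalGroup (g : Matrix.orthogonalGroup (Fin n) ℝ) :
    (g : Matrix (Fin n) (Fin n) ℝ) * (g : Matrix (Fin n) (Fin n) ℝ).transpose = 1 := by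
  simpa [Matrix.star_eq_conjTranspose] using (Matrix.mem_orthogonalGroup_iff (Fin n) ℝ).1 g.2

/-- The part of the hypothesis `p_F ≤ p` that comparison uses: `F` contains neither the Hessian of
the kernel `s K_p(|x|)`, which is a nonnegative multiple of `I - p P_e`, nor zero, once these are
lowered by a multiple of `I`. -/
structure ExcludesRieszKernel (F : Set (Matrix (Fin n) (Fin n) ℝ)) (p : ℝ) : Prop where
  notMem : ∀ e : E n, ‖e‖ = 1 → ∀ s ε : ℝ, 0 ≤ s → 0 < ε →
    s • (1 - p • lineProj e) - ε • (1 : Matrix (Fin n) (Fin n) ℝ) ∉ F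
  neg_smul_one_notMem : ∀ ε : ℝ, 0 < ε → -(ε • (1 : Matrix (Fin n) (Fin n) ℝ)) ∉ F

namespace IsSTConeSubequation

theorem zero_mem (hF : IsSTConeSubequation F) : (0 : Matrix (Fin n) (Fin n) ℝ) ∈ F := by
  obtain ⟨A, hA⟩ := hF.nonempty
  simpa using hF.cone A hA 0 le_rfl

theorem mem_of_posSemidef (hF : IsSTConeSubequation F) {P : Matrix (Fin n) (Fin n) ℝ}
    (hP : P.PosSemidef) : P ∈ F := by
  simpa using hF.positivity 0 hF.zero_mem P hP

theorem le_rieszChar (hF : IsSTConeSubequation F) {q : ℝ} (he : ‖e‖ = 1)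
    (h : (1 - lineProj e) - (q - 1) • lineProj e ∈ F) : (q : EReal) ≤ rieszChar F := by
  refine le_sSup ⟨q, fun e' he' => ?_, rfl⟩
  obtain ⟨G, htrans, hinv⟩ := hF.invariant
  obtain ⟨g, hg, hge⟩ := htrans e e' he he'
  have hconj := hinv g hg _ h
  rwa [Matrix.mul_sub, Matrix.sub_mul, Matrix.mul_sub, Matrix.sub_mul, Matrix.mul_one,
    mul_transpose_of_mem_orthogonalGroup, Matrix.mul_smul, Matrix.smul_mul,
    conj_lineProj hge] at hconj

theorem one_le_rieszChar (hF : IsSTConeSubequation F) (he : ‖e‖ = 1) : 1 ≤ rieszChar F :=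
  hF.le_rieszChar (q := 1) he
    (by simpa using hF.mem_of_posSemidef (posSemidef_one_sub_lineProj he))

/- Adding a multiple of `P_{e^⊥}` to the lowered kernel Hessian produces a positive multiple of
`P_{e^⊥} - (q - 1) P_e` with `q > p`. -/
theorem kernel_notMem (hF : IsSTConeSubequation F) (hp : rieszChar F = (p : EReal))
    (he : ‖e‖ = 1) {s ε : ℝ} (hs : 0 ≤ s) (hε : 0 < ε) :
    s • (1 - p • lineProj e) - ε • (1 : Matrix (Fin n) (Fin n) ℝ) ∉ F := by
  intro hmem
  have hp1 : 1 ≤ p := by exact_mod_cast hp ▸ hF.one_le_rieszChar he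
  obtain ⟨δ, hδ0, hδp⟩ : ∃ δ : ℝ, 0 < δ ∧ δ * p < ε :=
    ⟨ε / (2 * p), by positivity, by field_simp; linarith⟩
  set q := (s * p + ε + δ) / (s + δ) with hq
  have hscaled : (s + δ)⁻¹ • (s • (1 - p • lineProj e) - ε • (1 : Matrix (Fin n) (Fin n) ℝ) +
      (ε + δ) • (1 - lineProj e)) = (1 - lineProj e) - (q - 1) • lineProj e := by
    rw [inv_smul_eq_iff₀ (by positivity)]
    have : (s + δ) * (q - 1) = s * p + ε - s := by
      rw [hq]
      field_simp
      ring
    rw [smul_sub (s + δ), smul_smul, this]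
    module
  have hqF := hF.cone _ (hF.positivity _ hmem _
    ((posSemidef_one_sub_lineProj he).smul (by positivity : (0 : ℝ) ≤ ε + δ))) (s + δ)⁻¹
    (by positivity)
  rw [hscaled] at hqF
  have hqp : q ≤ p := by exact_mod_cast hp ▸ hF.le_rieszChar he hqF
  rw [hq, div_le_iff₀ (by positivity)] at hqp
  nlinarith

theorem excludesRieszKernel (hF : IsSTConeSubequation F) (hp : rieszChar F = (p : EReal))
    (hn : 1 ≤ n) : ExcludesRieszKernel F p where
  notMem _ he _ _ hs hε := hF.kernel_notMem hp he hs hε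
  neg_smul_one_notMem ε hε := by
    have he : ‖(EuclideanSpace.single ⟨0, hn⟩ 1 : E n)‖ = 1 := by simp
    simpa using hF.kernel_notMem hp he (s := 0) le_rfl hε

end IsSTConeSubequation

end Subequation

section RieszKernel

variable (p : ℝ)

theorem exists_hasDerivAt_rieszKernel :
    ∃ c : ℝ, 0 < c ∧ ∀ t : ℝ, 0 < t → HasDerivAt (rieszKernel p) (c * t ^ (1 - p)) t := by
  rcases lt_trichotomy p 2 with h | h | h
  · refine ⟨2 - p, by linarith, fun t ht => ?_⟩
    have : rieszKernel p = fun t => t ^ (2 - p) := by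
      ext t
      simp [rieszKernel, h]
    rw [this]
    convert Real.hasDerivAt_rpow_const (p := 2 - p) (Or.inl ht.ne') using 3
    ring
  · refine ⟨1, one_pos, fun t ht => ?_⟩
    have : rieszKernel p = Real.log := by
      ext t
      simp [rieszKernel, h]
    rw [this]
    convert Real.hasDerivAt_log ht.ne' using 1
    rw [h, one_mul, ← Real.rpow_neg_one]
    norm_num
  · refine ⟨p - 2, by linarith, fun t ht => ?_⟩
    have : rieszKernel p =ᶠ[𝓝 t] fun t => -(t ^ (2 - p)) := by
      filter_upwards [lt_mem_nhds ht] with s hs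
      rw [rieszKernel, if_neg (by linarith), if_neg (by linarith), ← neg_sub p 2,
        Real.rpow_neg hs.le, one_div]
    refine HasDerivAt.congr_of_eventuallyEq ?_ this
    convert (Real.hasDerivAt_rpow_const (p := 2 - p) (Or.inl ht.ne')).fun_neg using 1
    rw [show 2 - p - 1 = 1 - p by ring]
    ring

theorem continuousOn_rieszKernel : ContinuousOn (rieszKernel p) (Set.Ioi 0) := by
  obtain ⟨c, -, h⟩ := exists_hasDerivAt_rieszKernel p
  exact fun t ht => (h t ht).continuousAt.continuousWithinAt

theorem strictMonoOn_rieszKernel : StrictMonoOn (rieszKernel p) (Set.Ioi 0) := by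
  obtain ⟨c, hc, h⟩ := exists_hasDerivAt_rieszKernel p
  refine strictMonoOn_of_deriv_pos (convex_Ioi 0) (continuousOn_rieszKernel p) fun t ht => ?_
  rw [interior_Ioi] at ht
  rw [(h t ht).deriv]
  exact mul_pos hc (Real.rpow_pos_of_pos ht _)

theorem contDiffAt_rieszKernel {t : ℝ} (ht : 0 < t) : ContDiffAt ℝ 2 (rieszKernel p) t := by
  rcases lt_trichotomy p 2 with h | h | h
  · have : rieszKernel p = fun t => t ^ (2 - p) := by
      ext t
      simp [rieszKernel, h]
    rw [this]
    exact Real.contDiffAt_rpow_const_of_ne ht.ne'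
  · have : rieszKernel p = Real.log := by
      ext t
      simp [rieszKernel, h]
    rw [this]
    exact Real.contDiffAt_log.2 ht.ne'
  · have : rieszKernel p = fun t => -(1 / t ^ (p - 2)) := by
      ext t
      rw [rieszKernel, if_neg (by linarith), if_neg (by linarith)]
    rw [this]
    exact (contDiffAt_const.div (Real.contDiffAt_rpow_const_of_ne ht.ne')
      (Real.rpow_pos_of_pos ht _).ne').neg

variable {n : ℕ} {z : E n}

theorem contDiffAt_rieszKernel_norm (hz : z ≠ 0) :
    ContDiffAt ℝ 2 (fun y : E n => rieszKernel p ‖y‖) z :=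
  (contDiffAt_rieszKernel p (norm_pos_iff.2 hz)).comp z (contDiffAt_norm ℝ hz)

theorem exists_hessian_rieszKernel_norm (hz : z ≠ 0) :
    ∃ s : ℝ, 0 ≤ s ∧
      hessian (fun y => rieszKernel p ‖y‖) z = s • (1 - p • lineProj (‖z‖⁻¹ • z)) := by
  obtain ⟨c, hc, hK⟩ := exists_hasDerivAt_rieszKernel p
  have hz0 : 0 < ‖z‖ := norm_pos_iff.2 hz
  have hsq : (0 : ℝ) < ‖z‖ ^ 2 := pow_pos hz0 2
  have hderiv (s : ℝ) (hs : 0 < s) :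
      HasDerivAt (fun s => rieszKernel p √s) (c / 2 * s ^ (-p / 2)) s := by
    refine ((hK _ (Real.sqrt_pos.2 hs)).comp s (Real.hasDerivAt_sqrt hs.ne')).congr_deriv ?_
    have : s ^ (-p / 2) = √s ^ (1 - p) / √s := by
      rw [Real.sqrt_eq_rpow, ← Real.rpow_mul hs.le, ← Real.rpow_sub hs]
      ring_nf
    rw [this]
    ring
  have hderiv₂ : HasDerivAt (fun s : ℝ => c / 2 * s ^ (-p / 2))
      (c / 2 * ((-p / 2) * (‖z‖ ^ 2) ^ (-p / 2 - 1))) (‖z‖ ^ 2) :=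
    (Real.hasDerivAt_rpow_const (Or.inl hsq.ne')).const_mul (c / 2)
  have hhess := hessian_comp_norm_sq (f := fun s => rieszKernel p √s)
    ((lt_mem_nhds hsq).mono hderiv) hderiv₂
  simp only [Real.sqrt_sq (norm_nonneg _)] at hhess
  refine ⟨c * (‖z‖ ^ 2) ^ (-p / 2), by positivity, ?_⟩
  rw [hhess, lineProj_smul, Real.rpow_sub_one hsq.ne', smul_sub, smul_smul, smul_smul,
    sub_eq_add_neg, ← neg_smul]
  congr 2
  · ring
  · field_simp
    ring

end RieszKernel

section Comparison

theorem exists_touching {α : Type*} [TopologicalSpace α] {K : Set α} (hK : IsCompact K)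
    {u : α → EReal} (hu : UpperSemicontinuousOn u K) (htop : ∀ y ∈ K, u y ≠ ⊤) {h : α → ℝ}
    (hc : ContinuousOn h K) (hlt : ∃ y ∈ K, (h y : EReal) < u y) :
    ∃ y₀ ∈ K, ∃ δ : ℝ, 0 < δ ∧ u y₀ = ((h y₀ + δ : ℝ) : EReal) ∧
      ∀ y ∈ K, u y ≤ ((h y + δ : ℝ) : EReal) := by
  obtain ⟨y₁, hy₁, hlt⟩ := hlt
  have husc : UpperSemicontinuousOn (fun y => u y + ((-h y : ℝ) : EReal)) K :=
    hu.add' (continuous_coe_real_ereal.comp_continuousOn hc.neg).upperSemicontinuousOn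
      fun y _ => EReal.continuousAt_add (Or.inr (EReal.coe_ne_bot _)) (Or.inr (EReal.coe_ne_top _))
  obtain ⟨y₀, hy₀, hmax⟩ := husc.exists_isMaxOn ⟨y₁, hy₁⟩ hK
  have hmax' : ∀ y ∈ K, u y - h y ≤ u y₀ - h y₀ := fun y hy => by
    simpa only [EReal.coe_neg, ← sub_eq_add_neg, Set.mem_ofPred_eq] using hmax hy
  have hpos : 0 < u y₀ - h y₀ := (EReal.sub_pos.2 hlt).trans_le (hmax' y₁ hy₁)
  have hu₀ : u y₀ = u y₀ - h y₀ + h y₀ := EReal.sub_add_cancel.symm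
  have hne_top : u y₀ - h y₀ ≠ ⊤ := fun h => htop y₀ hy₀ (by rw [hu₀, h]; simp)
  lift u y₀ - h y₀ to ℝ using ⟨hne_top, hpos.ne_bot⟩ with δ
  refine ⟨y₀, hy₀, δ, by exact_mod_cast hpos, by rw [hu₀, add_comm]; norm_cast, fun y hy => ?_⟩
  rw [add_comm, EReal.coe_add]
  exact (EReal.sub_le_iff_le_add (Or.inl (EReal.coe_ne_bot _)) (Or.inl (EReal.coe_ne_top _))).1
    (hmax' y hy)

theorem le_coe_of_forall_pos_le_add_mul {a : EReal} {b : ℝ} (C : ℝ)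
    (h : ∀ ε : ℝ, 0 < ε → a ≤ ((b + ε * C : ℝ) : EReal)) : a ≤ b := by
  have hlim : Tendsto (fun ε : ℝ => b + ε * C) (𝓝[>] 0) (𝓝 b) := by
    simpa using ((continuous_const.add (continuous_id.mul continuous_const)).tendsto
      (f := fun ε : ℝ => b + ε * C) 0).mono_left nhdsWithin_le_nhds
  exact ge_of_tendsto ((continuous_coe_real_ereal.tendsto b).comp hlim)
    (eventually_mem_nhdsWithin.mono fun ε hε => h ε hε)

variable {n : ℕ} {F : Set (Matrix (Fin n) (Fin n) ℝ)} {X K O : Set (E n)} {u : E n → EReal}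

namespace IsSubharmonicOn

theorem le_of_hessian_notMem (hu : IsSubharmonicOn F X u) (hK : IsCompact K) (hKX : K ⊆ X)
    (hO : IsOpen O) (hOK : O ⊆ K) {h : E n → ℝ} (hc : ContinuousOn h K)
    (hd : ∀ y ∈ O, ContDiffAt ℝ 2 h y) (hh : ∀ y ∈ O, hessian h y ∉ F)
    (hb : ∀ y ∈ K \ O, u y ≤ h y) : ∀ y ∈ K, u y ≤ h y := by
  by_contra! hlt
  obtain ⟨y₀, hy₀, δ, hδ, htouch, hle⟩ :=
    exists_touching hK (hu.usc.mono hKX) (fun y hy => hu.ne_top y (hKX hy)) hc hlt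
  by_cases hmem : y₀ ∈ O
  · refine hh y₀ hmem ?_
    rw [← hessian_add_const h δ]
    refine hu.viscosity y₀ (hKX hy₀) _ ((hd y₀ hmem).add contDiffAt_const) htouch ?_
    filter_upwards [hO.mem_nhds hmem] with y hy using hle y (hOK hy)
  · have hle₀ := htouch ▸ hb y₀ ⟨hy₀, hmem⟩
    rw [EReal.coe_le_coe_iff] at hle₀
    linarith

theorem le_of_hessian_sub_smul_one_notMem (hu : IsSubharmonicOn F X u) (hK : IsCompact K)
    (hKX : K ⊆ X) (hO : IsOpen O) (hOK : O ⊆ K) {h : E n → ℝ} (hc : ContinuousOn h K)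
    (hd : ∀ y ∈ O, ContDiffAt ℝ 2 h y)
    (hh : ∀ y ∈ O, ∀ ε : ℝ, 0 < ε → hessian h y - ε • (1 : Matrix (Fin n) (Fin n) ℝ) ∉ F)
    (hb : ∀ y ∈ K \ O, u y ≤ h y) : ∀ y ∈ K, u y ≤ h y := by
  intro y hy
  obtain ⟨ρ, hρ⟩ := hK.isBounded.subset_closedBall 0
  refine le_coe_of_forall_pos_le_add_mul (ρ ^ 2 - ‖y‖ ^ 2) fun ε hε => ?_
  have hd' (z : E n) (hz : z ∈ O) : ContDiffAt ℝ 2 (fun z => h z + -ε * ‖z‖ ^ 2) z :=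
    (hd z hz).add (contDiffAt_const.mul (contDiffAt_norm_sq z))
  have hpert := hu.le_of_hessian_notMem (h := fun z => h z + -ε * ‖z‖ ^ 2 + ε * ρ ^ 2)
    hK hKX hO hOK ((hc.add (by fun_prop)).add continuousOn_const)
    (fun z hz => (hd' z hz).add contDiffAt_const)
    (fun z hz => by
      rw [hessian_add_const, hessian_add (hd z hz) (contDiffAt_const.mul (contDiffAt_norm_sq z)),
        hessian_const_mul (contDiffAt_norm_sq z), hessian_norm_sq, smul_smul, neg_mul, neg_smul,
        ← sub_eq_add_neg]
      exact hh z hz _ (by positivity))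
    (fun z hz => (hb z hz).trans (EReal.coe_le_coe_iff.2 (by
      have : ‖z‖ ^ 2 ≤ ρ ^ 2 := by
        gcongr
        simpa using hρ hz.1
      nlinarith))) y hy
  exact hpert.trans_eq (by ring_nf)

theorem le_on_annulus {p : ℝ} (hF : ExcludesRieszKernel F p) (hu : IsSubharmonicOn F X u)
    {x : E n} {r₁ r₂ : ℝ} (hr₁ : 0 < r₁) (hX : closedBall x r₂ ⊆ X) {a b : ℝ} (ha : 0 ≤ a)
    (h₁ : ∀ y ∈ sphere x r₁, u y ≤ ((a * rieszKernel p r₁ + b : ℝ) : EReal))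
    (h₂ : ∀ y ∈ sphere x r₂, u y ≤ ((a * rieszKernel p r₂ + b : ℝ) : EReal)) :
    ∀ y ∈ closedBall x r₂ \ ball x r₁, u y ≤ ((a * rieszKernel p ‖y - x‖ + b : ℝ) : EReal) := by
  have hne (y : E n) (hy : y ∈ closedBall x r₂ \ ball x r₁) : y - x ≠ 0 := fun h =>
    hy.2 (by rwa [mem_ball_iff_norm, h, norm_zero])
  have hOK : ball x r₂ \ closedBall x r₁ ⊆ closedBall x r₂ \ ball x r₁ :=
    Set.sdiff_subset_sdiff ball_subset_closedBall ball_subset_closedBall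
  have hd (y : E n) (hy : y ∈ closedBall x r₂ \ ball x r₁) :
      ContDiffAt ℝ 2 (fun y => rieszKernel p ‖y - x‖) y :=
    (contDiffAt_rieszKernel_norm p (hne y hy)).comp y (contDiffAt_id.sub contDiffAt_const)
  have hd' (y : E n) (hy : y ∈ closedBall x r₂ \ ball x r₁) :
      ContDiffAt ℝ 2 (fun y => a * rieszKernel p ‖y - x‖ + b) y :=
    (contDiffAt_const.mul (hd y hy)).add contDiffAt_const
  refine hu.le_of_hessian_sub_smul_one_notMem ((isCompact_closedBall x r₂).diff isOpen_ball)
    (Set.sdiff_subset.trans hX) (isOpen_ball.sdiff isClosed_closedBall) hOK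
    (fun y hy => (hd' y hy).continuousAt.continuousWithinAt) (fun y hy => hd' y (hOK hy))
    (fun y hy ε hε => ?_) fun y hy => ?_
  · obtain ⟨s, hs, hhess⟩ := exists_hessian_rieszKernel_norm p (hne y (hOK hy))
    rw [hessian_add_const, hessian_const_mul (hd y (hOK hy)),
      hessian_comp_sub (fun z => rieszKernel p ‖z‖), hhess, smul_smul]
    exact hF.notMem _ (norm_smul_inv_norm (𝕜 := ℝ) (hne y (hOK hy))) _ _ (by positivity) hε
  · obtain ⟨⟨hy₂, hy₁⟩, hyO⟩ := hy
    rcases (mem_closedBall.1 hy₂).eq_or_lt with hy | hy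
    · rw [← dist_eq_norm, hy]
      exact h₂ y hy
    · have hy : dist y x = r₁ :=
        le_antisymm (not_lt.1 fun h => hyO ⟨hy, fun h' => h.not_ge h'⟩) (not_lt.1 hy₁)
      rw [← dist_eq_norm, hy]
      exact h₁ y hy

theorem le_on_closedBall {p : ℝ} (hF : ExcludesRieszKernel F p) (hu : IsSubharmonicOn F X u)
    {x : E n} {r : ℝ} (hX : closedBall x r ⊆ X) {b : ℝ} (h : ∀ y ∈ sphere x r, u y ≤ (b : EReal)) :
    ∀ y ∈ closedBall x r, u y ≤ (b : EReal) :=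
  hu.le_of_hessian_sub_smul_one_notMem (h := fun _ => b) (isCompact_closedBall x r) hX isOpen_ball
    ball_subset_closedBall continuousOn_const (fun _ _ => contDiffAt_const)
    (fun y _ ε hε => by
      rw [hessian_const, zero_sub]
      exact hF.neg_smul_one_notMem ε hε)
    fun y hy => h y (by rwa [closedBall_sdiff_ball] at hy)

end IsSubharmonicOn

end Comparison

section KernelConvex

variable {k m : ℝ → ℝ} {R r s t : ℝ}

/-- The slope of the graph of `m` as a function of `k`, between the points of the pair `q`. -/
noncomputable def kernelSlope (k m : ℝ → ℝ) (q : ℝ × ℝ) : ℝ :=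
  (m q.2 - m q.1) / (k q.2 - k q.1)

/-- The pairs `(s, t)` with `0 < s < t < R`. -/
def smallPairs (R : ℝ) : Set (ℝ × ℝ) := {q | 0 < q.1 ∧ q.1 < q.2 ∧ q.2 < R}

/-- `m` is, on `(0, R)`, nondecreasing and a convex function of the increasing function `k`. The
convexity inequality is multiplied out, so as to avoid division by zero. -/
structure IsKernelConvex (k : ℝ → ℝ) (R : ℝ) (m : ℝ → ℝ) : Prop where
  monotoneOn : MonotoneOn m (Set.Ioo 0 R)
  convex : ∀ ⦃r₁ r r₂⦄, 0 < r₁ → r₁ < r → r < r₂ → r₂ < R →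
    (m r - m r₁) * (k r₂ - k r₁) ≤ (m r₂ - m r₁) * (k r - k r₁)

namespace IsKernelConvex

theorem congr {m' : ℝ → ℝ} (h : IsKernelConvex k R m) (heq : Set.EqOn m m' (Set.Ioo 0 R)) :
    IsKernelConvex k R m' where
  monotoneOn := h.monotoneOn.congr heq
  convex r₁ r r₂ h₁ h₁r hr₂ h₂ := by
    rw [← heq ⟨h₁, by linarith⟩, ← heq ⟨h₁.trans h₁r, by linarith⟩,
      ← heq ⟨(h₁.trans h₁r).trans hr₂, h₂⟩]
    exact h.convex h₁ h₁r hr₂ h₂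

theorem kernelSlope_nonneg (h : IsKernelConvex k R m) (hk : StrictMonoOn k (Set.Ioi 0))
    {q : ℝ × ℝ} (hq : q ∈ smallPairs R) : 0 ≤ kernelSlope k m q := by
  obtain ⟨hs, hst, ht⟩ := hq
  have hs' : q.1 ∈ Set.Ioo 0 R := ⟨hs, hst.trans ht⟩
  have ht' : q.2 ∈ Set.Ioo 0 R := ⟨hs.trans hst, ht⟩
  exact div_nonneg (sub_nonneg.2 (h.monotoneOn hs' ht' hst.le))
    (sub_nonneg.2 (hk hs ht'.1 hst).le)

theorem kernelSlope_le_kernelSlope_right (h : IsKernelConvex k R m)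
    (hk : StrictMonoOn k (Set.Ioi 0)) {t' : ℝ} (hs : 0 < s) (hst : s < t) (htt' : t ≤ t')
    (ht' : t' < R) : kernelSlope k m (s, t) ≤ kernelSlope k m (s, t') := by
  rcases htt'.eq_or_lt with rfl | htt'
  · rfl
  have ht := hs.trans hst
  rw [kernelSlope, kernelSlope, div_le_div_iff₀ (sub_pos.2 (hk hs ht hst))
    (sub_pos.2 (hk hs (ht.trans htt') (hst.trans htt')))]
  exact h.convex hs hst htt' ht'

theorem kernelSlope_le_kernelSlope_left (h : IsKernelConvex k R m)
    (hk : StrictMonoOn k (Set.Ioi 0)) {s' : ℝ} (hs : 0 < s) (hss' : s ≤ s') (hs't : s' < t)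
    (ht : t < R) : kernelSlope k m (s, t) ≤ kernelSlope k m (s', t) := by
  rcases hss'.eq_or_lt with rfl | hss'
  · rfl
  have hs' := hs.trans hss'
  have ht' := hs'.trans hs't
  rw [kernelSlope, kernelSlope, div_le_div_iff₀ (sub_pos.2 (hk hs ht' (hss'.trans hs't)))
    (sub_pos.2 (hk hs' ht' hs't))]
  linarith [h.convex hs hss' hs't ht]

theorem monotoneOn_kernelSlope (h : IsKernelConvex k R m) (hk : StrictMonoOn k (Set.Ioi 0)) :
    MonotoneOn (kernelSlope k m) (smallPairs R) := fun _ ⟨hs, hst, _⟩ _ ⟨_, hst', ht'⟩ hle =>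
  (h.kernelSlope_le_kernelSlope_right hk hs hst hle.2 ht').trans
    (h.kernelSlope_le_kernelSlope_left hk hs hle.1 hst' ht')

theorem sub_le_kernelSlope_mul (h : IsKernelConvex k R m) (hk : StrictMonoOn k (Set.Ioi 0))
    {q q' : ℝ × ℝ} (hq : q ∈ smallPairs R) (hq' : q' ∈ smallPairs R) (hle : q ≤ q') :
    m q.2 - m q.1 ≤ kernelSlope k m q' * (k q.2 - k q.1) := by
  have hpos : 0 < k q.2 - k q.1 := sub_pos.2 (hk hq.1 (hq.1.trans hq.2.1) hq.2.1)
  exact (div_le_iff₀ hpos).1 (h.monotoneOn_kernelSlope hk hq hq' hle)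

theorem abs_sub_le_kernelSlope_mul (h : IsKernelConvex k R m) (hk : StrictMonoOn k (Set.Ioi 0))
    {q : ℝ × ℝ} (hq : q ∈ smallPairs R) (hr : 0 < r) (hrq : r ≤ q.1) (hs : 0 < s)
    (hsq : s ≤ q.1) : |m s - m r| ≤ kernelSlope k m q * |k s - k r| := by
  wlog hrs : r < s generalizing r s
  · rcases (not_lt.1 hrs).eq_or_lt with rfl | hsr
    · simp
    · rw [abs_sub_comm, abs_sub_comm (k s)]
      exact this hs hsq hr hrq hsr
  have hsR : s < R := hsq.trans_lt (hq.2.1.trans hq.2.2)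
  rw [abs_of_nonneg (sub_nonneg.2 (h.monotoneOn ⟨hr, hrs.trans hsR⟩ ⟨hs, hsR⟩ hrs.le)),
    abs_of_pos (sub_pos.2 (hk hr hs hrs))]
  exact h.sub_le_kernelSlope_mul hk (q := (r, s)) ⟨hr, hrs, hsR⟩ hq ⟨hrq, hsq.trans hq.2.1.le⟩

theorem continuousAt (h : IsKernelConvex k R m) (hk : StrictMonoOn k (Set.Ioi 0))
    (hkc : ContinuousAt k r) (hr : r ∈ Set.Ioo 0 R) : ContinuousAt m r := by
  obtain ⟨t, hrt, htR⟩ := exists_between hr.2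
  obtain ⟨s, hrs, hst⟩ := exists_between hrt
  have hlim : Tendsto (fun y => kernelSlope k m (s, t) * |k y - k r|) (𝓝 r) (𝓝 0) := by
    simpa [ContinuousAt] using
      (hkc.sub_const (k r)).abs.const_mul (kernelSlope k m (s, t))
  refine tendsto_iff_norm_sub_tendsto_zero.2
    (squeeze_zero' (Eventually.of_forall fun _ => norm_nonneg _) ?_ hlim)
  filter_upwards [Ioo_mem_nhds hr.1 hrs] with y hy
  exact h.abs_sub_le_kernelSlope_mul hk ⟨hr.1.trans hrs, hst, htR⟩ hr.1 hrs.le hy.1 hy.2.le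

end IsKernelConvex

theorem smallPairs_mem_pairsToZero (hR : 0 < R) : smallPairs R ∈ pairsToZero := by
  have hlt : {q : ℝ × ℝ | q.2 < R} ∈ 𝓝 ((0 : ℝ), (0 : ℝ)) :=
    (isOpen_lt continuous_snd continuous_const).mem_nhds hR
  filter_upwards [self_mem_nhdsWithin, mem_nhdsWithin_of_mem_nhds hlt] with q hq hqR
  exact ⟨hq.1, hq.2, hqR⟩

instance pairsToZero_neBot : pairsToZero.NeBot := by
  have hdouble : Tendsto (fun t : ℝ => (t, 2 * t)) (𝓝[>] 0) pairsToZero := by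
    refine tendsto_nhdsWithin_iff.2 ⟨?_, ?_⟩
    · have hc : Continuous fun t : ℝ => (t, 2 * t) := by fun_prop
      simpa using (hc.tendsto 0).mono_left (nhdsWithin_le_nhds (s := Set.Ioi 0))
    · filter_upwards [self_mem_nhdsWithin] with t (ht : 0 < t)
      exact ⟨ht, show t < 2 * t by linarith⟩
  exact hdouble.neBot

theorem IsKernelConvex.tendsto_kernelSlope (h : IsKernelConvex k R m)
    (hk : StrictMonoOn k (Set.Ioi 0)) (hR : 0 < R) :
    Tendsto (kernelSlope k m) pairsToZero (𝓝 (sInf (kernelSlope k m '' smallPairs R))) := by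
  have hne : (kernelSlope k m '' smallPairs R).Nonempty :=
    .image _ ⟨(R / 3, R / 2), show 0 < R / 3 ∧ R / 3 < R / 2 ∧ R / 2 < R by
      refine ⟨?_, ?_, ?_⟩ <;> linarith⟩
  have hbdd : BddBelow (kernelSlope k m '' smallPairs R) :=
    ⟨0, Set.forall_mem_image.2 fun q hq => h.kernelSlope_nonneg hk hq⟩
  refine tendsto_order.2 ⟨fun a ha => ?_, fun c hc => ?_⟩
  · filter_upwards [smallPairs_mem_pairsToZero hR] with q hq
    exact ha.trans_le (csInf_le hbdd ⟨q, hq, rfl⟩)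
  · obtain ⟨_, ⟨q, hq, rfl⟩, hqc⟩ := exists_lt_of_csInf_lt hne hc
    filter_upwards [smallPairs_mem_pairsToZero hq.1] with q' hq'
    have hle : q' ≤ q := ⟨(hq'.2.1.trans hq'.2.2).le, (hq'.2.2.trans hq.2.1).le⟩
    have hq'R : q' ∈ smallPairs R := ⟨hq'.1, hq'.2.1, hle.2.trans_lt hq.2.2⟩
    exact (h.monotoneOn_kernelSlope hk hq'R hq hle).trans_lt hqc

end KernelConvex

section Density

variable {p R r : ℝ} {ψ : ℝ → EReal}

/-- `ψ` is finite on `(0, R)`, and there a nondecreasing and convex function of the Riesz kernel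
`K_p`. -/
structure IsFiniteKernelConvex (p R : ℝ) (ψ : ℝ → EReal) : Prop where
  ne_bot : ∀ r ∈ Set.Ioo 0 R, ψ r ≠ ⊥
  ne_top : ∀ r ∈ Set.Ioo 0 R, ψ r ≠ ⊤
  isKernelConvex : IsKernelConvex (rieszKernel p) R fun r => (ψ r).toReal

namespace IsFiniteKernelConvex

theorem congr {ψ' : ℝ → EReal} (h : IsFiniteKernelConvex p R ψ)
    (heq : Set.EqOn ψ ψ' (Set.Ioo 0 R)) : IsFiniteKernelConvex p R ψ' where
  ne_bot r hr := heq hr ▸ h.ne_bot r hr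
  ne_top r hr := heq hr ▸ h.ne_top r hr
  isKernelConvex := h.isKernelConvex.congr fun _ hr => congrArg EReal.toReal (heq hr)

theorem of_forall_lt {R₀ : ℝ} (hR₀ : R₀ < R)
    (h : ∀ R', R₀ < R' → R' < R → IsFiniteKernelConvex p R' ψ) : IsFiniteKernelConvex p R ψ := by
  have key : ∀ t < R, ∃ R', t < R' ∧ IsFiniteKernelConvex p R' ψ := fun t ht => by
    obtain ⟨R', h₁, h₂⟩ := exists_between (max_lt hR₀ ht)
    exact ⟨R', (le_max_right _ _).trans_lt h₁, h R' ((le_max_left _ _).trans_lt h₁) h₂⟩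
  refine ⟨fun r hr => ?_, fun r hr => ?_, fun s hs t ht hst => ?_, fun r₁ r r₂ h₁ h₁r hr₂ h₂ => ?_⟩
  · obtain ⟨R', hr', hR'⟩ := key r hr.2
    exact hR'.ne_bot r ⟨hr.1, hr'⟩
  · obtain ⟨R', hr', hR'⟩ := key r hr.2
    exact hR'.ne_top r ⟨hr.1, hr'⟩
  · obtain ⟨R', ht', hR'⟩ := key t ht.2
    exact hR'.isKernelConvex.monotoneOn ⟨hs.1, hst.trans_lt ht'⟩ ⟨ht.1, ht'⟩ hst
  · obtain ⟨R', hr', hR'⟩ := key r₂ h₂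
    exact hR'.isKernelConvex.convex h₁ h₁r hr₂ hr'

theorem coe_toReal (h : IsFiniteKernelConvex p R ψ) (hr : r ∈ Set.Ioo 0 R) :
    ((ψ r).toReal : EReal) = ψ r :=
  EReal.coe_toReal (h.ne_top r hr) (h.ne_bot r hr)

theorem monotoneOn (h : IsFiniteKernelConvex p R ψ) : MonotoneOn ψ (Set.Ioo 0 R) := by
  intro r hr s hs hrs
  rw [← h.coe_toReal hr, ← h.coe_toReal hs, EReal.coe_le_coe_iff]
  exact h.isKernelConvex.monotoneOn hr hs hrs

theorem continuousAt (h : IsFiniteKernelConvex p R ψ) (hr : r ∈ Set.Ioo 0 R) :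
    ContinuousAt ψ r := by
  have hK := (continuousOn_rieszKernel p).continuousAt (Ioi_mem_nhds hr.1)
  have hm := h.isKernelConvex.continuousAt (strictMonoOn_rieszKernel p) hK hr
  refine (continuous_coe_real_ereal.continuousAt.comp hm).congr ?_
  filter_upwards [Ioo_mem_nhds hr.1 hr.2] with s hs using h.coe_toReal hs

theorem tendsto_kernelQuotient (h : IsFiniteKernelConvex p R ψ) (hR : 0 < R) :
    Tendsto (kernelQuotient p ψ) pairsToZero
      (𝓝 (sInf (kernelQuotient p ψ '' smallPairs R))) :=
  h.isKernelConvex.tendsto_kernelSlope (strictMonoOn_rieszKernel p) hR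

theorem density_eq_sInf (h : IsFiniteKernelConvex p R ψ) (hR : 0 < R) :
    density p ψ = sInf (kernelQuotient p ψ '' smallPairs R) :=
  (h.tendsto_kernelQuotient hR).limUnder_eq

theorem densityExists (h : IsFiniteKernelConvex p R ψ) (hR : 0 < R) : DensityExists p ψ := by
  refine ⟨?_, h.density_eq_sInf hR ▸ h.tendsto_kernelQuotient hR⟩
  filter_upwards [Ioo_mem_nhdsGT hR] with r hr using ⟨h.ne_bot r hr, h.ne_top r hr⟩

theorem density_le (h : IsFiniteKernelConvex p R ψ) {q : ℝ × ℝ} (hq : q ∈ smallPairs R) :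
    density p ψ ≤ kernelQuotient p ψ q := by
  rw [h.density_eq_sInf ((hq.1.trans hq.2.1).trans hq.2.2)]
  exact csInf_le ⟨0, Set.forall_mem_image.2 fun q hq =>
    h.isKernelConvex.kernelSlope_nonneg (strictMonoOn_rieszKernel p) hq⟩ ⟨q, hq, rfl⟩

theorem exists_kernelQuotient_lt (h : IsFiniteKernelConvex p R ψ) (hR : 0 < R) {c : ℝ}
    (hc : density p ψ < c) : ∃ q ∈ smallPairs R, kernelQuotient p ψ q < c :=
  (((h.densityExists hR).2.eventually_lt_const hc).and (smallPairs_mem_pairsToZero hR)).exists.imp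
    fun _ hq => ⟨hq.2, hq.1⟩

end IsFiniteKernelConvex

theorem continuousAt_of_forall_sandwich {α β : Type*} [TopologicalSpace α] [LinearOrder β]
    [TopologicalSpace β] [OrderTopology β] {Ψ : α → ℝ → β} {x : α} {R r : ℝ}
    (hr : r ∈ Set.Ioo 0 R) (hΨ : ContinuousAt (Ψ x) r)
    (hT : ∀ s t, 0 < s → s < t → t < R →
      ∃ T : α → β, ContinuousAt T x ∧ ∀ᶠ y in 𝓝 x, Ψ y s ≤ T y ∧ T y ≤ Ψ y t) :
    ContinuousAt (fun y => Ψ y r) x := by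
  refine tendsto_order.2 ⟨fun a ha => ?_, fun a ha => ?_⟩
  · obtain ⟨s, hsa, hs⟩ := (((hΨ.eventually_const_lt ha).filter_mono nhdsWithin_le_nhds).and
      (Ioo_mem_nhdsLT hr.1)).exists
    obtain ⟨T, hTc, hTle⟩ := hT s r hs.1 hs.2 hr.2
    filter_upwards [hTle, hTc.eventually_const_lt (hsa.trans_le hTle.self_of_nhds.1)] with y hy hya
    exact hya.trans_le hy.2
  · obtain ⟨t, hta, ht⟩ := (((hΨ.eventually_lt_const ha).filter_mono nhdsWithin_le_nhds).and
      (Ioo_mem_nhdsGT hr.2)).exists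
    obtain ⟨T, hTc, hTle⟩ := hT r t hr.1 ht.1 ht.2
    filter_upwards [hTle, hTc.eventually_lt_const (hTle.self_of_nhds.2.trans_lt hta)] with y hy hya
    exact hy.1.trans_lt hya

theorem upperSemicontinuousAt_density {α : Type*} [TopologicalSpace α] {Ψ : α → ℝ → EReal}
    {x : α} (hR : 0 < R) (hconv : ∀ᶠ y in 𝓝 x, IsFiniteKernelConvex p R (Ψ y))
    (hcont : ∀ r ∈ Set.Ioo 0 R, ContinuousAt (fun y => Ψ y r) x) :
    UpperSemicontinuousAt (fun y => density p (Ψ y)) x := by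
  intro c hc
  have hx := hconv.self_of_nhds
  obtain ⟨q, hq, hqc⟩ := hx.exists_kernelQuotient_lt hR hc
  have hreal : ∀ r ∈ Set.Ioo 0 R, ContinuousAt (fun y => (Ψ y r).toReal) x := fun r hr =>
    (EReal.tendsto_toReal (hx.ne_top r hr) (hx.ne_bot r hr)).comp (hcont r hr)
  have hquot : ContinuousAt (fun y => kernelQuotient p (Ψ y) q) x :=
    ((hreal q.2 ⟨hq.1.trans hq.2.1, hq.2.2⟩).sub
      (hreal q.1 ⟨hq.1, hq.2.1.trans hq.2.2⟩)).div_const _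
  filter_upwards [hconv, hquot.eventually_lt_const hqc] with y hy hyc
  exact (hy.density_le hq).trans_lt hyc

theorem upperSemicontinuousDensity_of_forall_sandwich {n : ℕ} {X : Set (E n)}
    {Ψ : E n → ℝ → EReal} (hX : IsOpen X)
    (hconv : ∀ x R, 0 < R → closedBall x R ⊆ X → IsFiniteKernelConvex p R (Ψ x))
    (hT : ∀ x R, closedBall x R ⊆ X → ∀ s t, 0 < s → s < t → t < R →
      ∃ T : E n → EReal, ContinuousAt T x ∧ ∀ᶠ y in 𝓝 x, Ψ y s ≤ T y ∧ T y ≤ Ψ y t) :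
    UpperSemicontinuousDensity p X Ψ := by
  have husc : UpperSemicontinuousOn (fun x => density p (Ψ x)) X := by
    intro x hx
    obtain ⟨R, hR, hball⟩ := nhds_basis_closedBall.mem_iff.1 (hX.mem_nhds hx)
    have hnear : ∀ᶠ y in 𝓝 x, IsFiniteKernelConvex p (R / 2) (Ψ y) := by
      filter_upwards [ball_mem_nhds x (half_pos hR)] with y hy
      refine hconv y _ (half_pos hR) ((closedBall_subset_closedBall' ?_).trans hball)
      linarith [mem_ball.1 hy]
    refine UpperSemicontinuousAt.upperSemicontinuousWithinAt X
      (upperSemicontinuousAt_density (half_pos hR) hnear fun r hr => ?_)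
    have hrR : r ∈ Set.Ioo 0 R := ⟨hr.1, hr.2.trans (half_lt_self hR)⟩
    exact continuousAt_of_forall_sandwich hrR ((hconv x R hR hball).continuousAt hrR)
      (hT x R hball)
  refine ⟨fun x hx => ?_, husc, fun c _ =>
    (upperSemicontinuousOn_iff_restrict.2 husc).isClosed_preimage c⟩
  obtain ⟨R, hR, hball⟩ := nhds_basis_closedBall.mem_iff.1 (hX.mem_nhds hx)
  exact (hconv x R hR hball).densityExists hR

end Density

section SphereMax

variable {n : ℕ} {F : Set (Matrix (Fin n) (Fin n) ℝ)} {X : Set (E n)} {u : E n → EReal}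
  {x : E n} {p r R : ℝ}

theorem le_sphereMax (u : E n → EReal) (hr : 0 < r) {y : E n} (hy : y ∈ sphere x r) :
    u y ≤ sphereMax u x r := by
  have hσ : r⁻¹ • (y - x) ∈ sphere (0 : E n) 1 := by
    rw [mem_sphere_zero_iff_norm, norm_smul, mem_sphere_iff_norm.1 hy, norm_inv,
      Real.norm_of_nonneg hr.le, inv_mul_cancel₀ hr.ne']
  simpa [sphereMax, smul_smul, mul_inv_cancel₀ hr.ne'] using
    le_iSup (fun σ : sphere (0 : E n) 1 => u (x + r • (σ : E n))) ⟨_, hσ⟩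

theorem sphereMax_le (hr : 0 ≤ r) {c : EReal} (h : ∀ y ∈ sphere x r, u y ≤ c) :
    sphereMax u x r ≤ c :=
  iSup_le fun σ => h _ <| by
    rw [mem_sphere_iff_norm, add_sub_cancel_left, norm_smul, mem_sphere_zero_iff_norm.1 σ.2,
      mul_one, Real.norm_of_nonneg hr]

namespace IsSubharmonicOn

theorem exists_le_coe (hu : IsSubharmonicOn F X u) {K : Set (E n)} (hK : IsCompact K)
    (hKX : K ⊆ X) : ∃ C : ℝ, 0 ≤ C ∧ ∀ y ∈ K, u y ≤ C := by
  rcases K.eq_empty_or_nonempty with rfl | hne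
  · exact ⟨0, le_rfl, by simp⟩
  obtain ⟨y₀, hy₀, hmax⟩ := (hu.usc.mono hKX).exists_isMaxOn hne hK
  refine ⟨max 0 (u y₀).toReal, le_max_left _ _, fun y hy => (hmax hy).trans ?_⟩
  exact (EReal.le_coe_toReal (hu.ne_top y₀ (hKX hy₀))).trans
    (EReal.coe_le_coe_iff.2 (le_max_right _ _))

theorem sphereMax_ne_top (hu : IsSubharmonicOn F X u) (hX : closedBall x r ⊆ X) (hr : 0 ≤ r) :
    sphereMax u x r ≠ ⊤ := by
  obtain ⟨C, -, hC⟩ := hu.exists_le_coe (isCompact_closedBall x r) hX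
  exact ne_top_of_le_ne_top (EReal.coe_ne_top C)
    (sphereMax_le hr fun y hy => hC y (sphere_subset_closedBall hy))

theorem le_sphereMax_of_mem_closedBall (hF : ExcludesRieszKernel F p)
    (hu : IsSubharmonicOn F X u) (hX : closedBall x r ⊆ X) (hr : 0 < r) {y : E n}
    (hy : y ∈ closedBall x r) : u y ≤ sphereMax u x r :=
  EReal.le_of_forall_lt_iff_le.1 fun _ hb =>
    hu.le_on_closedBall hF hX (fun _ hz => (le_sphereMax u hr hz).trans hb.le) y hy

theorem sphereMax_le_sphereMax (hF : ExcludesRieszKernel F p) (hu : IsSubharmonicOn F X u)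
    {x' : E n} {r' : ℝ} (hX : closedBall x' r' ⊆ X) (hr : 0 < r) (hr' : r + dist x x' ≤ r') :
    sphereMax u x r ≤ sphereMax u x' r' :=
  sphereMax_le hr.le fun _ hy => hu.le_sphereMax_of_mem_closedBall hF hX
    (by linarith [dist_nonneg (x := x) (y := x')])
    (closedBall_subset_closedBall' hr' (sphere_subset_closedBall hy))

theorem sphereMax_le_of_mem_Icc (hF : ExcludesRieszKernel F p) (hu : IsSubharmonicOn F X u)
    {r₁ r₂ a b : ℝ} (hr₁ : 0 < r₁) (hX : closedBall x r₂ ⊆ X) (ha : 0 ≤ a)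
    (h₁ : sphereMax u x r₁ ≤ (a * rieszKernel p r₁ + b : ℝ))
    (h₂ : sphereMax u x r₂ ≤ (a * rieszKernel p r₂ + b : ℝ)) (hr : r ∈ Set.Icc r₁ r₂) :
    sphereMax u x r ≤ (a * rieszKernel p r + b : ℝ) := by
  have hr₀ : 0 < r := hr₁.trans_le hr.1
  refine sphereMax_le hr₀.le fun y hy => ?_
  have hle := hu.le_on_annulus hF hr₁ hX ha (fun z hz => (le_sphereMax u hr₁ hz).trans h₁)
    (fun z hz => (le_sphereMax u (hr₀.trans_le hr.2) hz).trans h₂) y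
    ⟨(mem_sphere.1 hy).trans_le hr.2, fun h => (mem_ball.1 h).not_ge (hr.1.trans_eq hy.symm)⟩
  rwa [mem_sphere_iff_norm.1 hy] at hle

theorem eq_bot_of_sphereMax_eq_bot (hF : ExcludesRieszKernel F p) (hu : IsSubharmonicOn F X u)
    (hX : closedBall x R ⊆ X) (hr : 0 < r) (hrR : r < R) (hbot : sphereMax u x r = ⊥) {y : E n}
    (hy : y ∈ ball x R) : u y = ⊥ := by
  rcases le_or_gt (dist y x) r with hyr | hyr
  · have hle := hu.le_sphereMax_of_mem_closedBall hF
      ((closedBall_subset_closedBall hrR.le).trans hX) hr hyr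
    rwa [hbot, le_bot_iff] at hle
  have hy₀ : 0 < dist y x := hr.trans hyr
  obtain ⟨C, -, hC⟩ := hu.exists_le_coe (isCompact_closedBall x R) hX
  have hCR : sphereMax u x R ≤ C :=
    sphereMax_le (hr.trans hrR).le fun z hz => hC z (sphere_subset_closedBall hz)
  set δ := rieszKernel p R - rieszKernel p (dist y x)
  have hδ : 0 < δ := sub_pos.2 (strictMonoOn_rieszKernel p hy₀ (hr.trans hrR) hy)
  -- Since `M(r) = -∞`, the comparison function `C + a (K_p - K_p(R))` may be arbitrarily steep.
  have hbound : ∀ a : ℝ, 0 ≤ a → u y ≤ (C - a * δ : ℝ) := fun a ha => by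
    have hle := hu.sphereMax_le_of_mem_Icc hF hr hX ha (b := C - a * rieszKernel p R)
      (hbot.trans_le bot_le) (hCR.trans_eq (by congr 1; ring)) ⟨hyr.le, (mem_ball.1 hy).le⟩
    exact (le_sphereMax u hy₀ rfl).trans (hle.trans_eq (by congr 1; ring))
  refine (EReal.eq_bot_iff_forall_lt _).2 fun b =>
    (hbound ((max (C - b) 0 + 1) / δ) (by positivity)).trans_lt (EReal.coe_lt_coe_iff.2 ?_)
  rw [div_mul_cancel₀ _ hδ.ne']
  linarith [le_max_left (C - b) 0]

theorem isFiniteKernelConvex_sphereMax (hF : ExcludesRieszKernel F p)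
    (hu : IsSubharmonicOn F X u) (hX : closedBall x R ⊆ X) (hne : ∃ y ∈ ball x R, u y ≠ ⊥) :
    IsFiniteKernelConvex p R (sphereMax u x) := by
  have hsub : ∀ r < R, closedBall x r ⊆ X := fun r hr =>
    (closedBall_subset_closedBall hr.le).trans hX
  have hbot : ∀ r ∈ Set.Ioo 0 R, sphereMax u x r ≠ ⊥ := fun r hr h =>
    hne.elim fun y hy => hy.2 (hu.eq_bot_of_sphereMax_eq_bot hF hX hr.1 hr.2 h hy.1)
  have htop : ∀ r ∈ Set.Ioo 0 R, sphereMax u x r ≠ ⊤ := fun r hr =>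
    hu.sphereMax_ne_top (hsub r hr.2) hr.1.le
  have hcoe : ∀ r ∈ Set.Ioo 0 R, sphereMax u x r = ((sphereMax u x r).toReal : EReal) :=
    fun r hr => (EReal.coe_toReal (htop r hr) (hbot r hr)).symm
  have hmono : MonotoneOn (fun r => (sphereMax u x r).toReal) (Set.Ioo 0 R) :=
    fun s hs t ht hst => EReal.toReal_le_toReal
      (hu.sphereMax_le_sphereMax hF (hsub t ht.2) hs.1 (by simpa using hst)) (hbot s hs) (htop t ht)
  refine ⟨hbot, htop, hmono, fun r₁ r r₂ h₁ h₁r hr₂ h₂ => ?_⟩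
  have hm₁ : r₁ ∈ Set.Ioo 0 R := ⟨h₁, by linarith⟩
  have hm : r ∈ Set.Ioo 0 R := ⟨by linarith, by linarith⟩
  have hm₂ : r₂ ∈ Set.Ioo 0 R := ⟨by linarith, h₂⟩
  have hδ : 0 < rieszKernel p r₂ - rieszKernel p r₁ :=
    sub_pos.2 (strictMonoOn_rieszKernel p h₁ hm₂.1 (h₁r.trans hr₂))
  set M := fun r => (sphereMax u x r).toReal
  set a := (M r₂ - M r₁) / (rieszKernel p r₂ - rieszKernel p r₁)
  have haδ : a * (rieszKernel p r₂ - rieszKernel p r₁) = M r₂ - M r₁ := div_mul_cancel₀ _ hδ.ne'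
  have ha₀ : 0 ≤ a := div_nonneg (sub_nonneg.2 (hmono hm₁ hm₂ (h₁r.trans hr₂).le)) hδ.le
  have hle : sphereMax u x r ≤ (a * rieszKernel p r + (M r₁ - a * rieszKernel p r₁) : ℝ) :=
    hu.sphereMax_le_of_mem_Icc hF h₁ (hsub r₂ h₂) ha₀
      ((hcoe r₁ hm₁).trans_le (EReal.coe_le_coe_iff.2 (by linarith)))
      ((hcoe r₂ hm₂).trans_le (EReal.coe_le_coe_iff.2 (by linarith))) ⟨h₁r.le, hr₂.le⟩
  rw [hcoe r hm, EReal.coe_le_coe_iff] at hle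
  rw [← haδ, mul_right_comm]
  exact mul_le_mul_of_nonneg_right (by linarith) hδ.le

theorem eventually_eq_bot_of_mem_closure (hF : ExcludesRieszKernel F p)
    (hu : IsSubharmonicOn F X u) (hX : X ∈ 𝓝 x) (hx : x ∈ closure {z | ∀ᶠ y in 𝓝 z, u y = ⊥}) :
    ∀ᶠ y in 𝓝 x, u y = ⊥ := by
  obtain ⟨ρ, hρ, hball⟩ := nhds_basis_closedBall.mem_iff.1 hX
  obtain ⟨z, hz, hxz⟩ := mem_closure_iff.1 hx (ρ / 2) (half_pos hρ)
  have hzball : closedBall z (ρ / 2) ⊆ X := by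
    refine (closedBall_subset_closedBall' ?_).trans hball
    rw [dist_comm]
    linarith
  obtain ⟨δ, hδ, hδz⟩ := eventually_nhds_iff_ball.1 hz
  obtain ⟨r, hr, hrδ⟩ := exists_between (lt_min hδ (half_pos hρ))
  have hbot : sphereMax u z r = ⊥ := le_bot_iff.1 <| sphereMax_le hr.le fun w hw =>
    (hδz w ((mem_sphere.1 hw).trans_lt (hrδ.trans_le (min_le_left _ _)))).le
  filter_upwards [isOpen_ball.mem_nhds (mem_ball.2 hxz)] with w hw
  exact hu.eq_bot_of_sphereMax_eq_bot hF hzball hr (hrδ.trans_le (min_le_right _ _)) hbot hw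

theorem exists_ne_bot (hF : ExcludesRieszKernel F p) (hu : IsSubharmonicOn F X u)
    (hXo : IsOpen X) (hfin : ∀ x ∈ X, ∃ y ∈ connectedComponentIn X x, u y ≠ ⊥)
    (hx : x ∈ X) (hR : 0 < R) : ∃ y ∈ ball x R, u y ≠ ⊥ := by
  by_contra! hbot
  obtain ⟨y₀, hy₀, hy₀bot⟩ := hfin x hx
  have hsub : connectedComponentIn X x ⊆ {z | ∀ᶠ y in 𝓝 z, u y = ⊥} := by
    refine isPreconnected_connectedComponentIn.subset_of_closure_inter_subset
      isOpen_setOfPred_eventually_nhds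
      ⟨x, mem_connectedComponentIn hx, Filter.mem_of_superset (ball_mem_nhds x hR) hbot⟩ ?_
    rintro y ⟨hyc, hyX⟩
    exact hu.eventually_eq_bot_of_mem_closure hF
      (hXo.mem_nhds (connectedComponentIn_subset X x hyX)) hyc
  exact hy₀bot (hsub hy₀).self_of_nhds

theorem upperSemicontinuousDensity_sphereMax (hF : ExcludesRieszKernel F p)
    (hu : IsSubharmonicOn F X u) (hXo : IsOpen X)
    (hfin : ∀ x ∈ X, ∃ y ∈ connectedComponentIn X x, u y ≠ ⊥) :
    UpperSemicontinuousDensity p X (sphereMax u) := by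
  refine upperSemicontinuousDensity_of_forall_sandwich hXo (fun x R hR hX =>
    hu.isFiniteKernelConvex_sphereMax hF hX
      (hu.exists_ne_bot hF hXo hfin (hX (mem_closedBall_self hR.le)) hR))
    fun x R hX s t hs hst ht => ?_
  -- A constant separates `M(y, s)` from `M(y, t)` for `y` near `x`: the value `M(x, ρ)`.
  obtain ⟨ρ, hsρ, hρt⟩ := exists_between hst
  refine ⟨fun _ => sphereMax u x ρ, continuousAt_const, ?_⟩
  filter_upwards [ball_mem_nhds x (sub_pos.2 hsρ), ball_mem_nhds x (sub_pos.2 hρt),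
    ball_mem_nhds x (sub_pos.2 ht)] with y hys hyt hyR
  rw [mem_ball] at hys hyt hyR
  refine ⟨hu.sphereMax_le_sphereMax hF
    ((closedBall_subset_closedBall (hρt.trans ht).le).trans hX) hs (by linarith),
    hu.sphereMax_le_sphereMax hF
    ((closedBall_subset_closedBall' (by linarith)).trans hX) (hs.trans hsρ) ?_⟩
  rw [dist_comm]
  linarith

end IsSubharmonicOn

end SphereMax

section Polynomial

open MvPolynomial

variable {n : ℕ} {q : MvPolynomial (Fin n) ℝ} {ℓ : Matrix (Fin n) (Fin n) ℝ →ₗ[ℝ] ℝ}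

/-- A polynomial as a function on Euclidean space. -/
noncomputable def polyEval (q : MvPolynomial (Fin n) ℝ) (y : E n) : ℝ := eval y.ofLp q

theorem contDiff_polyEval (q : MvPolynomial (Fin n) ℝ) : ContDiff ℝ 2 (polyEval q) :=
  (AnalyticOnNhd.eval_continuousLinearMap (𝕜 := ℝ)
    (EuclideanSpace.equiv (Fin n) ℝ).toContinuousLinearMap q).contDiff

theorem hasFDerivAt_polyEval (q : MvPolynomial (Fin n) ℝ) (y : E n) :
    HasFDerivAt (polyEval q)
      (∑ i, polyEval (pderiv i q) y • (EuclideanSpace.proj i : E n →L[ℝ] ℝ)) y := by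
  induction q using MvPolynomial.induction_on with
  | C a =>
    have hC : polyEval (C a : MvPolynomial (Fin n) ℝ) = fun _ => a := by ext; simp [polyEval]
    rw [hC]
    exact (hasFDerivAt_const a y).congr_fderiv (by simp [polyEval])
  | add f g hf hg =>
    have hadd : polyEval (f + g) = fun y => polyEval f y + polyEval g y := by
      ext; simp [polyEval]
    rw [hadd]
    refine (hf.add hg).congr_fderiv ?_
    rw [← Finset.sum_add_distrib]
    exact Finset.sum_congr rfl fun i _ => by simp [polyEval, add_smul]
  | mul_X f j hf =>
    have hmul : polyEval (f * X j) = fun y => polyEval f y * y j := by ext; simp [polyEval]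
    rw [hmul]
    have hpderiv : ∀ i, polyEval (pderiv i (f * X j)) y =
        (Pi.single j (polyEval f y) : Fin n → ℝ) i + y j * polyEval (pderiv i f) y := fun i => by
      simp [polyEval, pderiv_X, Pi.single_apply, apply_ite (eval y.ofLp), eq_comm (a := i)]
    refine (hf.mul (EuclideanSpace.proj j : E n →L[ℝ] ℝ).hasFDerivAt).congr_fderiv ?_
    simp only [hpderiv, add_smul, Finset.sum_add_distrib, mul_smul, ← Finset.smul_sum]
    simp [Pi.single_apply]

theorem hessian_polyEval (q : MvPolynomial (Fin n) ℝ) (y : E n) :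
    hessian (polyEval q) y = Matrix.of fun i j => polyEval (pderiv i (pderiv j q)) y := by
  rw [hessian_eq_of_hasFDerivAt (Eventually.of_forall (hasFDerivAt_polyEval q))
    (HasFDerivAt.fun_sum fun j _ => (hasFDerivAt_polyEval (pderiv j q) y).smul_const
      (EuclideanSpace.proj j : E n →L[ℝ] ℝ))]
  ext i j
  simp

theorem eq_zero_of_polyEval_eq_zero_on_ball (h : ∀ y ∈ ball (0 : E n) 1, polyEval q y = 0) :
    q = 0 := by
  have hnhds : WithLp.toLp 2 ⁻¹' ball (0 : E n) 1 ∈ 𝓝 (0 : Fin n → ℝ) :=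
    (isOpen_ball.preimage (PiLp.continuous_toLp 2 _)).mem_nhds (by simp)
  obtain ⟨δ, hδ, hsub⟩ := nhds_basis_closedBall.mem_iff.1 hnhds
  refine funext_set (fun _ => Set.Icc (-δ) δ) (fun _ => Set.Icc_infinite (by linarith))
    fun f hf => ?_
  have hfδ : f ∈ closedBall (0 : Fin n → ℝ) δ := by
    rw [mem_closedBall_zero_iff, pi_norm_le_iff_of_nonneg hδ.le]
    exact fun i => abs_le.2 (hf i trivial)
  simpa [polyEval] using h (WithLp.toLp 2 f) (hsub hfδ)

theorem totalDegree_pderiv_le (i : Fin n) (q : MvPolynomial (Fin n) ℝ) :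
    (pderiv i q).totalDegree ≤ q.totalDegree - 1 := by
  conv_lhs => rw [q.as_sum, map_sum]
  refine totalDegree_finsetSum_le fun s hs => ?_
  rw [pderiv_monomial]
  rcases Nat.eq_zero_or_pos (s i) with hi | hi
  · simp [hi]
  refine (totalDegree_monomial_le _ _).trans ?_
  have hcancel : (s - Finsupp.single i 1) + Finsupp.single i 1 = s :=
    tsub_add_cancel_of_le (Finsupp.single_le_iff.2 hi)
  have hdeg : (s - Finsupp.single i 1).degree + 1 = s.degree := by
    conv_rhs => rw [← hcancel]
    simp
  have hs_le : s.degree ≤ q.totalDegree := le_totalDegree hs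
  change (s - Finsupp.single i 1).degree ≤ _
  omega

/-- The constant coefficient operator `q ↦ ℓ(D² q)` on polynomials. -/
noncomputable def polyOp (ℓ : Matrix (Fin n) (Fin n) ℝ →ₗ[ℝ] ℝ) :
    MvPolynomial (Fin n) ℝ →ₗ[ℝ] MvPolynomial (Fin n) ℝ :=
  ∑ i, ∑ j, ℓ (Matrix.single i j 1) • (pderiv i).toLinearMap ∘ₗ (pderiv j).toLinearMap

theorem polyOp_apply (ℓ : Matrix (Fin n) (Fin n) ℝ →ₗ[ℝ] ℝ) (q : MvPolynomial (Fin n) ℝ) :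
    polyOp ℓ q = ∑ i, ∑ j, ℓ (Matrix.single i j 1) • pderiv i (pderiv j q) := by
  simp [polyOp]

@[simp]
theorem polyOp_one : polyOp ℓ (1 : MvPolynomial (Fin n) ℝ) = 0 := by
  simp [polyOp_apply]

theorem sum_map_single_mul (ℓ : Matrix (Fin n) (Fin n) ℝ →ₗ[ℝ] ℝ) (A : Matrix (Fin n) (Fin n) ℝ) :
    ∑ i, ∑ j, ℓ (Matrix.single i j 1) * A i j = ℓ A := by
  conv_rhs => rw [Matrix.matrix_eq_sum_single A]
  simp only [map_sum]
  refine Finset.sum_congr rfl fun i _ => Finset.sum_congr rfl fun j _ => ?_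
  rw [← mul_one (A i j), ← smul_eq_mul (A i j), ← Matrix.smul_single, map_smul, smul_eq_mul,
    smul_eq_mul, mul_one, mul_comm]

theorem polyEval_polyOp (ℓ : Matrix (Fin n) (Fin n) ℝ →ₗ[ℝ] ℝ) (q : MvPolynomial (Fin n) ℝ)
    (y : E n) : polyEval (polyOp ℓ q) y = ℓ (hessian (polyEval q) y) := by
  rw [hessian_polyEval, ← sum_map_single_mul]
  simp [polyOp_apply, polyEval]

theorem map_hessian_polyEval_of_polyOp_eq_zero (hq : polyOp ℓ q = 0) (y : E n) :
    ℓ (hessian (polyEval q) y) = 0 := by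
  rw [← polyEval_polyOp, hq, polyEval, map_zero]

theorem totalDegree_polyOp_le (ℓ : Matrix (Fin n) (Fin n) ℝ →ₗ[ℝ] ℝ)
    (q : MvPolynomial (Fin n) ℝ) : (polyOp ℓ q).totalDegree ≤ q.totalDegree - 2 := by
  rw [polyOp_apply]
  refine totalDegree_finsetSum_le fun i _ => totalDegree_finsetSum_le fun j _ => ?_
  calc (ℓ (Matrix.single i j 1) • pderiv i (pderiv j q)).totalDegree
      ≤ (pderiv i (pderiv j q)).totalDegree := totalDegree_smul_le _ _
    _ ≤ (pderiv j q).totalDegree - 1 := totalDegree_pderiv_le _ _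
    _ ≤ q.totalDegree - 1 - 1 := Nat.sub_le_sub_right (totalDegree_pderiv_le _ _) 1
    _ = q.totalDegree - 2 := Nat.sub_sub _ _ _

/-- The polynomial `y ↦ b y + yᵀ A y / 2`. -/
noncomputable def quadPoly (b : E n →L[ℝ] ℝ) (A : Matrix (Fin n) (Fin n) ℝ) :
    MvPolynomial (Fin n) ℝ :=
  ∑ i, C (b (EuclideanSpace.single i 1)) * X i + C (1 / 2) * ∑ i, X i * ∑ j, C (A i j) * X j

theorem polyEval_quadPoly (b : E n →L[ℝ] ℝ) (A : Matrix (Fin n) (Fin n) ℝ) (y : E n) :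
    polyEval (quadPoly b A) y = b y + 1 / 2 * (y.ofLp ⬝ᵥ A.mulVec y.ofLp) := by
  have hb : b y = ∑ i, b (EuclideanSpace.single i 1) * y i := by
    conv_lhs => rw [← sum_single_smul y]
    simp [map_sum, mul_comm]
  simp [polyEval, quadPoly, hb, dotProduct, Matrix.mulVec]

theorem pderiv_pderiv_quadPoly (b : E n →L[ℝ] ℝ) {A : Matrix (Fin n) (Fin n) ℝ} (hA : A.IsSymm)
    (i j : Fin n) : pderiv i (pderiv j (quadPoly b A)) = C (A i j) := by
  have hC : (C (1 / 2) : MvPolynomial (Fin n) ℝ) * (C (A i j) + C (A i j)) = C (A i j) := by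
    rw [← C_add, ← C_mul]; congr 1; ring
  simpa [quadPoly, pderiv_X, Pi.single_apply, Finset.sum_add_distrib, hA.apply i j] using hC

theorem polyOp_quadPoly (ℓ : Matrix (Fin n) (Fin n) ℝ →ₗ[ℝ] ℝ) (b : E n →L[ℝ] ℝ)
    {A : Matrix (Fin n) (Fin n) ℝ} (hA : A.IsSymm) : polyOp ℓ (quadPoly b A) = C (ℓ A) := by
  rw [polyOp_apply, ← sum_map_single_mul]
  simp [pderiv_pderiv_quadPoly b hA, smul_eq_C_mul]

end Polynomial

section Elliptic

open MvPolynomial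

variable {n : ℕ} {q : MvPolynomial (Fin n) ℝ} {ℓ : Matrix (Fin n) (Fin n) ℝ →ₗ[ℝ] ℝ}

/-- The linear functional `ℓ` on matrices defines a degenerate elliptic operator `φ ↦ ℓ(D² φ)`
which is nonzero in the sense that `|y|²` is a strict subsolution. -/
structure IsElliptic (ℓ : Matrix (Fin n) (Fin n) ℝ →ₗ[ℝ] ℝ) : Prop where
  nonneg : ∀ P : Matrix (Fin n) (Fin n) ℝ, P.PosSemidef → 0 ≤ ℓ P
  one_pos : 0 < ℓ 1

/-- The polynomial `1 - |y|²`, which vanishes on the unit sphere. -/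
noncomputable def ballPoly (n : ℕ) : MvPolynomial (Fin n) ℝ := 1 - ∑ i, X i ^ 2

theorem polyEval_ballPoly (y : E n) : polyEval (ballPoly n) y = 1 - ‖y‖ ^ 2 := by
  simp [polyEval, ballPoly, EuclideanSpace.real_norm_sq_eq]

theorem ballPoly_ne_zero (n : ℕ) : ballPoly n ≠ 0 := fun h => by
  simpa [h, polyEval] using polyEval_ballPoly (0 : E n)

theorem totalDegree_ballPoly_le : (ballPoly n).totalDegree ≤ 2 :=
  (totalDegree_sub _ _).trans
    (max_le (by simp) (totalDegree_finsetSum_le fun i _ => by simp))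

theorem polyEval_ballPoly_mul {y : E n} (hy : y ∈ sphere 0 1) :
    polyEval (ballPoly n * q) y = 0 := by
  have h : polyEval (ballPoly n) y = 0 := by
    rw [polyEval_ballPoly, mem_sphere_zero_iff_norm.1 hy]; norm_num
  rw [polyEval, map_mul, ← polyEval, h, zero_mul]

namespace IsElliptic

theorem nonneg_of_nonneg_on_sphere (hℓ : IsElliptic ℓ) {h : E n → ℝ} (hh : ContDiff ℝ 2 h)
    (hL : ∀ y ∈ ball 0 1, ℓ (hessian h y) ≤ 0) (h0 : ∀ y ∈ sphere 0 1, 0 ≤ h y) {y : E n}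
    (hy : y ∈ closedBall 0 1) : 0 ≤ h y := by
  refine le_of_forall_pos_le_add fun ε hε => ?_
  set g : E n → ℝ := fun y => h y + -ε * ‖y‖ ^ 2 with hg
  have hsq (z : E n) : ContDiffAt ℝ 2 (fun y : E n => -ε * ‖y‖ ^ 2) z :=
    contDiffAt_const.mul (contDiffAt_norm_sq z)
  have hgc (z : E n) : ContDiffAt ℝ 2 g z := hh.contDiffAt.add (hsq z)
  obtain ⟨y₀, hy₀, hmin⟩ := (isCompact_closedBall (0 : E n) 1).exists_isMinOn ⟨y, hy⟩
    fun z _ => (hgc z).continuousAt.continuousWithinAt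
  have hy₀_sphere : y₀ ∈ sphere (0 : E n) 1 := by
    by_contra hne
    have hy₀_ball : y₀ ∈ ball (0 : E n) 1 := lt_of_le_of_ne hy₀ hne
    have hpos := hℓ.nonneg _ (posSemidef_hessian_of_isLocalMin (hgc y₀)
      (hmin.isLocalMin (closedBall_mem_nhds_of_mem hy₀_ball)))
    rw [hg, hessian_add hh.contDiffAt (hsq y₀), hessian_const_mul (contDiffAt_norm_sq y₀),
      hessian_norm_sq, smul_smul, map_add, map_smul, smul_eq_mul] at hpos
    nlinarith [hL y₀ hy₀_ball, mul_pos hε hℓ.one_pos]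
  have hgy : h y₀ + -ε * ‖y₀‖ ^ 2 ≤ h y + -ε * ‖y‖ ^ 2 := hmin hy
  rw [mem_sphere_zero_iff_norm.1 hy₀_sphere] at hgy
  nlinarith [h0 y₀ hy₀_sphere, mul_nonneg hε.le (sq_nonneg ‖y‖)]

theorem polyEval_nonneg_of_nonneg_on_sphere (hℓ : IsElliptic ℓ) (hq : polyOp ℓ q = 0)
    (h0 : ∀ y ∈ sphere 0 1, 0 ≤ polyEval q y) {y : E n} (hy : y ∈ closedBall 0 1) :
    0 ≤ polyEval q y :=
  hℓ.nonneg_of_nonneg_on_sphere (contDiff_polyEval q)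
    (fun z _ => (map_hessian_polyEval_of_polyOp_eq_zero hq z).le) h0 hy

theorem eq_zero_of_eq_zero_on_sphere (hℓ : IsElliptic ℓ) (hq : polyOp ℓ q = 0)
    (h0 : ∀ y ∈ sphere (0 : E n) 1, polyEval q y = 0) : q = 0 := by
  refine eq_zero_of_polyEval_eq_zero_on_ball fun y hy => ?_
  have hneg (z : E n) : polyEval (-q) z = -polyEval q z := by simp [polyEval]
  have hle := hℓ.polyEval_nonneg_of_nonneg_on_sphere (q := -q) (by rw [map_neg, hq, neg_zero])
    (fun z hz => by rw [hneg, h0 z hz, neg_zero]) (ball_subset_closedBall hy)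
  rw [hneg] at hle
  exact le_antisymm (by linarith) (hℓ.polyEval_nonneg_of_nonneg_on_sphere hq
    (fun z hz => (h0 z hz).ge) (ball_subset_closedBall hy))

/-- `q ↦ ℓ(D²((1 - |y|²) q))` preserves the degree bound and is injective by the maximum
principle, hence surjective on polynomials of bounded degree. -/
theorem exists_dirichlet (hℓ : IsElliptic ℓ) (f : MvPolynomial (Fin n) ℝ) :
    ∃ h, polyOp ℓ h = 0 ∧ ∀ y ∈ sphere (0 : E n) 1, polyEval h y = polyEval f y := by
  set V := restrictTotalDegree (Fin n) ℝ f.totalDegree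
  have hdeg : ∀ q ∈ V, polyOp ℓ (ballPoly n * q) ∈ V := by
    intro q hq
    rw [mem_restrictTotalDegree] at hq ⊢
    have hop := totalDegree_polyOp_le ℓ (ballPoly n * q)
    have hmul := totalDegree_mul (ballPoly n) q
    have hball := totalDegree_ballPoly_le (n := n)
    omega
  set T : V →ₗ[ℝ] V := (polyOp ℓ ∘ₗ LinearMap.mulLeft ℝ (ballPoly n)).restrict hdeg
  have hinj : Function.Injective T := by
    rw [← LinearMap.ker_eq_bot, LinearMap.ker_eq_bot']
    rintro ⟨q, hq⟩ hTq
    have hprod : ballPoly n * q = 0 := hℓ.eq_zero_of_eq_zero_on_sphere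
      (congrArg Subtype.val hTq) fun y hy => polyEval_ballPoly_mul hy
    exact Subtype.ext ((mul_eq_zero.1 hprod).resolve_left (ballPoly_ne_zero n))
  have hf : polyOp ℓ f ∈ V := by
    rw [mem_restrictTotalDegree]
    exact (totalDegree_polyOp_le ℓ f).trans (Nat.sub_le _ _)
  obtain ⟨⟨q, hq⟩, hTq⟩ := LinearMap.injective_iff_surjective.1 hinj ⟨_, hf⟩
  have hop : polyOp ℓ (ballPoly n * q) = polyOp ℓ f := congrArg Subtype.val hTq
  refine ⟨f - ballPoly n * q, by rw [map_sub, hop, sub_self], fun y hy => ?_⟩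
  rw [polyEval, map_sub, ← polyEval, ← polyEval, polyEval_ballPoly_mul hy, sub_zero]

end IsElliptic

end Elliptic

section HarmonicMeasure

open MvPolynomial

variable {n : ℕ} {ℓ : Matrix (Fin n) (Fin n) ℝ →ₗ[ℝ] ℝ} {ν : Measure (sphere (0 : E n) 1)}

/-- Restriction of polynomials to the unit sphere. -/
noncomputable def sphereRestrict (n : ℕ) :
    MvPolynomial (Fin n) ℝ →ₐ[ℝ] C(sphere (0 : E n) 1, ℝ) :=
  aeval fun i => ⟨fun σ => (σ : E n) i, by fun_prop⟩

theorem sphereRestrict_apply (q : MvPolynomial (Fin n) ℝ) (σ : sphere (0 : E n) 1) :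
    sphereRestrict n q σ = polyEval q σ := by
  induction q using MvPolynomial.induction_on with
  | C a => simp [sphereRestrict, polyEval, Algebra.algebraMap_eq_smul_one]
  | add f g hf hg => rw [map_add, ContinuousMap.add_apply, hf, hg]; simp [polyEval]
  | mul_X f i hf =>
    rw [map_mul, ContinuousMap.mul_apply, hf]
    simp [polyEval, sphereRestrict]

theorem exists_polyEval_near (g : C(sphere (0 : E n) 1, ℝ)) {ε : ℝ} (hε : 0 < ε) :
    ∃ q : MvPolynomial (Fin n) ℝ, ∀ σ : sphere (0 : E n) 1, |polyEval q σ - g σ| < ε := by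
  have hsep : (sphereRestrict n).range.SeparatesPoints := by
    intro σ τ hne
    obtain ⟨i, hi⟩ : ∃ i, (σ : E n) i ≠ (τ : E n) i := by
      by_contra! h
      exact hne (Subtype.ext (PiLp.ext h))
    refine ⟨sphereRestrict n (X i), ⟨sphereRestrict n (X i), ⟨X i, rfl⟩, rfl⟩, ?_⟩
    simpa [sphereRestrict_apply, polyEval] using hi
  obtain ⟨⟨_, q, rfl⟩, hq⟩ :=
    ContinuousMap.exists_mem_subalgebra_near_continuousMap_of_separatesPoints _ hsep g ε hε
  exact ⟨q, fun σ => by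
    simpa [← sphereRestrict_apply] using (ContinuousMap.norm_lt_iff _ hε).1 hq σ⟩

/-- `ν` represents the value at the centre of the unit ball of every polynomial solution of
`ℓ(D² h) = 0`. -/
def IsHarmonicMeasure (ℓ : Matrix (Fin n) (Fin n) ℝ →ₗ[ℝ] ℝ)
    (ν : Measure (sphere (0 : E n) 1)) : Prop :=
  ∀ h, polyOp ℓ h = 0 → ∫ σ, polyEval h (σ : E n) ∂ν = polyEval h 0

theorem IsHarmonicMeasure.isProbabilityMeasure (hν : IsHarmonicMeasure ℓ ν) :
    IsProbabilityMeasure ν := by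
  have h1 := hν 1 polyOp_one
  simp only [polyEval, map_one, integral_const, smul_eq_mul, mul_one, Measure.real] at h1
  exact ⟨(ENNReal.toReal_eq_one_iff _).1 h1⟩

theorem IsElliptic.injective_sphereRestrict (hℓ : IsElliptic ℓ) :
    Function.Injective ((sphereRestrict n).toLinearMap ∘ₗ (LinearMap.ker (polyOp ℓ)).subtype) := by
  rw [← LinearMap.ker_eq_bot, LinearMap.ker_eq_bot']
  intro h h0
  refine Subtype.ext (hℓ.eq_zero_of_eq_zero_on_sphere h.2 fun y hy => ?_)
  rw [← sphereRestrict_apply h.1 ⟨y, hy⟩]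
  exact DFunLike.congr_fun h0 _

theorem IsElliptic.exists_positive_functional (hℓ : IsElliptic ℓ) :
    ∃ Λ : C(sphere (0 : E n) 1, ℝ) →ₗ[ℝ] ℝ, (∀ g, 0 ≤ g → 0 ≤ Λ g) ∧
      ∀ h, polyOp ℓ h = 0 → Λ (sphereRestrict n h) = polyEval h 0 := by
  set ρ := (sphereRestrict n).toLinearMap ∘ₗ (LinearMap.ker (polyOp ℓ)).subtype
  set e := LinearEquiv.ofInjective ρ hℓ.injective_sphereRestrict
  let ev : LinearMap.ker (polyOp ℓ) →ₗ[ℝ] ℝ :=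
    (aeval (0 : Fin n → ℝ)).toLinearMap ∘ₗ (LinearMap.ker (polyOp ℓ)).subtype
  have hev (h : LinearMap.ker (polyOp ℓ)) : ev h = polyEval h.1 0 := by
    simp [ev, polyEval, aeval_eq_eval]
  have hnonneg (x : LinearMap.range ρ) (hx : 0 ≤ (x : C(sphere (0 : E n) 1, ℝ))) :
      0 ≤ ev (e.symm x) := by
    rw [hev]
    refine hℓ.polyEval_nonneg_of_nonneg_on_sphere (e.symm x).2 (fun y hy => ?_) (by simp)
    have hρ : sphereRestrict n (e.symm x).1 = x := congrArg Subtype.val (e.apply_symm_apply x)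
    rw [← sphereRestrict_apply _ ⟨y, hy⟩, hρ]
    exact hx ⟨y, hy⟩
  have hcofinal (g : C(sphere (0 : E n) 1, ℝ)) :
      ∃ x : LinearMap.range ρ, 0 ≤ (x : C(sphere (0 : E n) 1, ℝ)) + g := by
    refine ⟨⟨‖g‖ • 1, ⟨⟨‖g‖ • 1, by simp⟩, by simp [ρ]⟩⟩, fun σ => ?_⟩
    change 0 ≤ ‖g‖ * 1 + g σ
    linarith [neg_le_of_abs_le (g.norm_coe_le_norm σ)]
  obtain ⟨Λ, hΛ, hpos⟩ := riesz_extension (PointedCone.positive ℝ C(sphere (0 : E n) 1, ℝ))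
    ⟨LinearMap.range ρ, ev ∘ₗ e.symm.toLinearMap⟩ hnonneg hcofinal
  refine ⟨Λ, hpos, fun h hh => ?_⟩
  rw [← hev ⟨h, hh⟩, ← e.symm_apply_apply ⟨h, hh⟩]
  exact hΛ (e ⟨h, hh⟩)

theorem IsElliptic.exists_isHarmonicMeasure (hℓ : IsElliptic ℓ) :
    ∃ ν : Measure (sphere (0 : E n) 1), IsHarmonicMeasure ℓ ν := by
  obtain ⟨Λ, hpos, hΛ⟩ := hℓ.exists_positive_functional
  let Λ' : CompactlySupportedContinuousMap (sphere (0 : E n) 1) ℝ →ₚ[ℝ] ℝ :=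
    PositiveLinearMap.mk₀
      { toFun := fun f => Λ f.toContinuousMap
        map_add' := fun f g => map_add Λ f.toContinuousMap g.toContinuousMap
        map_smul' := fun c f => map_smul Λ c f.toContinuousMap }
      (fun f hf => hpos _ fun σ => hf σ)
  have hint (g : C(sphere (0 : E n) 1, ℝ)) : ∫ σ, g σ ∂(RealRMK.rieszMeasure Λ') = Λ g :=
    RealRMK.integral_rieszMeasure Λ' (CompactlySupportedContinuousMap.continuousMapEquiv g)
  refine ⟨RealRMK.rieszMeasure Λ', fun h hh => ?_⟩
  rw [← hΛ h hh, ← hint]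
  exact integral_congr_ae (Eventually.of_forall fun σ => (sphereRestrict_apply h σ).symm)

theorem IsHarmonicMeasure.integral_quadratic (hν : IsHarmonicMeasure ℓ ν) (hℓ : ℓ 1 ≠ 0)
    (b : E n →L[ℝ] ℝ) {A : Matrix (Fin n) (Fin n) ℝ} (hA : A.IsSymm) :
    ∫ σ, (b (σ : E n) + 1 / 2 * ((σ : E n).ofLp ⬝ᵥ A.mulVec (σ : E n).ofLp)) ∂ν =
      ℓ A / (2 * ℓ 1) := by
  have := hν.isProbabilityMeasure
  set c := ℓ A / ℓ 1 with hc
  set h := quadPoly b (A - c • 1) + C (c / 2) with hh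
  have hop : polyOp ℓ h = 0 := by
    have hC : polyOp ℓ (C (c / 2)) = 0 := by simp [polyOp_apply]
    rw [hh, map_add, hC, polyOp_quadPoly _ _ (hA.sub (Matrix.isSymm_one.smul c)), map_sub,
      map_smul, smul_eq_mul, hc, div_mul_cancel₀ _ hℓ, sub_self, map_zero, add_zero]
  have heval (y : E n) : polyEval h y =
      b y + 1 / 2 * (y.ofLp ⬝ᵥ A.mulVec y.ofLp) + c / 2 * (1 - ‖y‖ ^ 2) := by
    have hadd : polyEval h y = polyEval (quadPoly b (A - c • 1)) y + c / 2 := by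
      simp [hh, polyEval]
    rw [hadd, polyEval_quadPoly, Matrix.sub_mulVec, dotProduct_sub, Matrix.smul_mulVec,
      Matrix.one_mulVec, dotProduct_smul, ← norm_sq_eq_dotProduct, smul_eq_mul]
    ring
  have hmean := hν h hop
  simp only [heval, mem_sphere_zero_iff_norm.1 (Subtype.prop _)] at hmean
  simpa [hc, div_div, mul_comm] using hmean

end HarmonicMeasure

section Gap

variable {C : ℝ} {a : EReal}

/-- The gap `C - a ∈ [0, ∞]` between a real upper bound `C` and an extended real number `a`. It
turns functions bounded above into nonnegative ones, so that their integrals become Lebesgue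
integrals. Junk value: the gap is `0` if `C < a`. -/
noncomputable def gap (C : ℝ) (a : EReal) : ENNReal := ((C : EReal) - a).toENNReal

theorem gap_antitone (C : ℝ) : Antitone (gap C) := fun _ _ h =>
  EReal.toENNReal_le_toENNReal (EReal.sub_le_sub le_rfl h)

@[simp] theorem gap_coe (C b : ℝ) : gap C b = ENNReal.ofReal (C - b) := by
  rw [gap, ← EReal.coe_sub, EReal.real_coe_toENNReal]

@[simp] theorem gap_bot (C : ℝ) : gap C ⊥ = ⊤ := by simp [gap]

theorem coe_sub_gap (h : a ≤ C) : (C : EReal) - (gap C a : EReal) = a := by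
  induction a with
  | bot => simp
  | top => simp at h
  | coe b =>
    have hb : b ≤ C := by exact_mod_cast h
    rw [gap_coe, EReal.coe_ennreal_ofReal, max_eq_left (by linarith), ← EReal.coe_sub,
      sub_sub_cancel]

theorem gap_coe_sub (C : ℝ) (w : ENNReal) : gap C ((C : EReal) - (w : EReal)) = w := by
  induction w with
  | top => simp
  | coe w => rw [EReal.coe_nnreal_eq_coe_real, ← EReal.coe_sub, gap_coe]; simp

theorem coe_sub_le (C : ℝ) (w : ENNReal) : (C : EReal) - (w : EReal) ≤ C := by
  simpa using EReal.sub_le_sub (le_refl (C : EReal)) (EReal.coe_ennreal_nonneg w)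

theorem coe_sub_antitone (C : ℝ) : Antitone fun w : ENNReal => (C : EReal) - (w : EReal) :=
  fun _ _ h => EReal.sub_le_sub le_rfl (EReal.coe_ennreal_le_coe_ennreal_iff.2 h)

theorem le_coe_sub_of_le_gap (h : a ≤ C) {t : NNReal} (ht : t ≤ gap C a) :
    a ≤ ((C - t : ℝ) : EReal) := by
  simpa only [coe_sub_gap h, EReal.coe_nnreal_eq_coe_real, ← EReal.coe_sub]
    using coe_sub_antitone C ht

theorem continuous_const_sub (C : ℝ) : Continuous fun a : EReal => (C : EReal) - a :=
  continuous_iff_continuousAt.2 fun _ =>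
    (EReal.continuousAt_add (Or.inl (EReal.coe_ne_top C)) (Or.inl (EReal.coe_ne_bot C))).comp
      (f := fun a : EReal => ((C : EReal), -a))
      (continuous_const.prodMk continuous_neg).continuousAt

theorem continuous_gap (C : ℝ) : Continuous (gap C) :=
  EReal.continuous_toENNReal.comp (continuous_const_sub C)

theorem continuous_coe_sub (C : ℝ) : Continuous fun w : ENNReal => (C : EReal) - (w : EReal) :=
  (continuous_const_sub C).comp continuous_coe_ennreal_ereal

theorem measurable_gap (C : ℝ) : Measurable (gap C) := (continuous_gap C).measurable

end Gap

section LowerSemicontinuous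

variable {S : Type*} [TopologicalSpace S]

theorem isLUB_continuous_le [CompletelyRegularSpace S] {W : S → ENNReal}
    (hW : LowerSemicontinuous W) :
    IsLUB ((fun (f : C(S, NNReal)) σ => (f σ : ENNReal)) ''
      {f | ∀ σ, (f σ : ENNReal) ≤ W σ}) W := by
  refine ⟨by rintro _ ⟨f, hf, rfl⟩; exact hf, fun B hB σ => le_of_forall_lt fun a ha => ?_⟩
  obtain ⟨b, hab, hbW⟩ := exists_between ha
  lift b to NNReal using hbW.ne_top
  obtain ⟨f, hfc, hfσ, hf⟩ := CompletelyRegularSpace.completely_regular_isOpen σ _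
    (hW.isOpen_preimage b) hbW
  let g : C(S, NNReal) :=
    ⟨fun τ => b * unitInterval.toNNReal (unitInterval.symm (f τ)), by fun_prop⟩
  have hgW (τ : S) : (g τ : ENNReal) ≤ W τ := by
    by_cases hτ : τ ∈ W ⁻¹' Set.Ioi ↑b
    · refine le_trans (ENNReal.coe_le_coe.2 ?_) (le_of_lt hτ)
      exact mul_le_of_le_one_right' (unitInterval.symm (f τ)).2.2
    · simp [g, hf hτ]
  have hle : (g σ : ENNReal) ≤ B σ := hB ⟨g, hgW, rfl⟩ σ
  exact hab.trans_le (by simpa [g, hfσ] using hle)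

theorem exists_monotone_continuous_iSup_eq [CompletelyRegularSpace S]
    [HereditarilyLindelofSpace S] {W : S → ENNReal} (hW : LowerSemicontinuous W) :
    ∃ f : ℕ → C(S, NNReal), Monotone f ∧ ∀ σ, ⨆ k, (f k σ : ENNReal) = W σ := by
  obtain ⟨T, hT, hTc, hTW⟩ := exists_countable_lowerSemicontinuous_isLUB
    (by
      rintro _ ⟨f, -, rfl⟩
      exact (ENNReal.continuous_coe.comp f.continuous).lowerSemicontinuous)
    (isLUB_continuous_le hW)
  obtain ⟨g, hg⟩ := (hTc.insert fun _ => 0).exists_eq_range (Set.insert_nonempty _ _)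
  have hgf (k : ℕ) : ∃ f : C(S, NNReal), (∀ σ, (f σ : ENNReal) ≤ W σ) ∧ g k = fun σ => ↑(f σ) := by
    rcases hg ▸ Set.mem_range_self k with h | h
    · exact ⟨0, by simp [h]⟩
    · obtain ⟨f, hfW, hf⟩ := hT h
      exact ⟨f, hfW, hf.symm⟩
  choose f hfW hf using hgf
  have hsup (k : ℕ) (σ : S) : (partialSups f k σ : ENNReal) ≤ W σ :=
    (partialSups_iff_forall (fun q : C(S, NNReal) => (q σ : ENNReal) ≤ W σ)
      (by simp [ENNReal.coe_max])).2 fun j _ => hfW j σ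
  have hle : W ≤ fun σ => ⨆ k, (partialSups f k σ : ENNReal) := hTW.2 fun B hB σ => by
    obtain ⟨k, rfl⟩ : B ∈ Set.range g := hg ▸ Set.mem_insert_of_mem _ hB
    rw [hf k]
    exact le_iSup_of_le k (ENNReal.coe_le_coe.2 (le_partialSups f k σ))
  exact ⟨partialSups f, (partialSups f).monotone, fun σ =>
    le_antisymm (iSup_le fun k => hsup k σ) (hle σ)⟩

theorem lintegral_le_of_forall_continuous [CompletelyRegularSpace S]
    [HereditarilyLindelofSpace S] [MeasurableSpace S] [OpensMeasurableSpace S] (ν : Measure S)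
    {W : S → ENNReal} (hW : LowerSemicontinuous W) {c : ENNReal}
    (h : ∀ f : C(S, NNReal), (∀ σ, (f σ : ENNReal) ≤ W σ) → ∫⁻ σ, f σ ∂ν ≤ c) :
    ∫⁻ σ, W σ ∂ν ≤ c := by
  obtain ⟨f, hmono, hf⟩ := exists_monotone_continuous_iSup_eq hW
  simp only [← hf]
  rw [lintegral_iSup (f := fun k σ => (f k σ : ENNReal)) (fun k => by fun_prop) fun j k hjk σ =>
    ENNReal.coe_le_coe.2 (hmono hjk σ)]
  exact iSup_le fun k => h (f k) fun σ => hf σ ▸ le_iSup (fun k => (f k σ : ENNReal)) k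

end LowerSemicontinuous

section AffineChange

variable {n : ℕ} {F : Set (Matrix (Fin n) (Fin n) ℝ)} {X : Set (E n)} {u : E n → EReal}
  {g : Matrix (Fin n) (Fin n) ℝ}

theorem matMap_mul_apply (g h : Matrix (Fin n) (Fin n) ℝ) (y : E n) :
    matMap (g * h) y = matMap g (matMap h y) := by
  rw [matMap, map_mul]; rfl

theorem matMap_matMap_of_mul_eq_one {h : Matrix (Fin n) (Fin n) ℝ} (hgh : g * h = 1) (y : E n) :
    matMap g (matMap h y) = y := by
  rw [← matMap_mul_apply, hgh, matMap, map_one, one_apply_eq_self]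

theorem norm_matMap (hg : g.transpose * g = 1) (y : E n) : ‖matMap g y‖ = ‖y‖ := by
  rw [← sq_eq_sq₀ (norm_nonneg _) (norm_nonneg _), norm_sq_eq_dotProduct, norm_sq_eq_dotProduct,
    Matrix.ofLp_toEuclideanCLM, Matrix.dotProduct_mulVec, Matrix.vecMul_mulVec, hg,
    Matrix.vecMul_one]

theorem IsSubharmonicOn.comp_affine (hu : IsSubharmonicOn F X u) (hg : IsUnit g)
    (hinv : ∀ A ∈ F, g.transpose * A * g ∈ F) (x : E n) :
    IsSubharmonicOn F {y | x + matMap g y ∈ X} fun y => u (x + matMap g y) where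
  usc := hu.usc.comp (by fun_prop : Continuous fun y => x + matMap g y).continuousOn fun _ hy => hy
  ne_top y hy := hu.ne_top _ hy
  viscosity y hy φ hφ hφy hle := by
    obtain ⟨h, hgh, hhg⟩ := isUnit_iff_exists.1 hg
    have hinverse (z : E n) : matMap h (x + matMap g z) + matMap h (-x) = z := by
      rw [← map_add, add_neg_cancel_comm, matMap_matMap_of_mul_eq_one hhg]
    have hinverse' (w : E n) : x + matMap g (matMap h w + matMap h (-x)) = w := by
      rw [← map_add, matMap_matMap_of_mul_eq_one hgh]; abel
    have hcont : Tendsto (fun w => matMap h w + matMap h (-x)) (𝓝 (x + matMap g y)) (𝓝 y) := by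
      simpa only [hinverse] using (by fun_prop : Continuous fun w =>
        matMap h w + matMap h (-x)).tendsto (x + matMap g y)
    have hφ' : ContDiffAt ℝ 2 φ (matMap h (x + matMap g y) + matMap h (-x)) := by
      rwa [hinverse]
    have hmem := hu.viscosity (x + matMap g y) hy (fun w => φ (matMap h w + matMap h (-x)))
      (hφ'.comp (x + matMap g y) (by fun_prop)) (by rwa [hinverse])
      ((hcont.eventually hle).mono fun w hw => by rwa [hinverse'] at hw)
    rw [hessian_comp_affine h _ _ hφ', hinverse] at hmem
    have hconj : g.transpose * (h.transpose * hessian φ y * h) * g = hessian φ y := by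
      calc g.transpose * (h.transpose * hessian φ y * h) * g
          = (h * g).transpose * hessian φ y * (h * g) := by
            simp only [Matrix.transpose_mul, Matrix.mul_assoc]
        _ = hessian φ y := by rw [hhg, Matrix.transpose_one, one_mul, mul_one]
    exact hconj ▸ hinv _ hmem

theorem IsSubharmonicOn.comp_similarity (hF : IsSTConeSubequation F) (hu : IsSubharmonicOn F X u)
    (hg : g * g.transpose = 1) (hinv : ∀ A ∈ F, g.transpose * A * g ∈ F) {a : ℝ} (ha : 0 < a)
    (x : E n) :
    IsSubharmonicOn F {y | x + a • matMap g y ∈ X} fun y => u (x + a • matMap g y) := by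
  have hunit : IsUnit (a • g) :=
    (isUnit_iff_exists.2 ⟨_, hg, mul_eq_one_comm.1 hg⟩).smul (Units.mk0 a ha.ne')
  have h := hu.comp_affine hunit (fun A hA => by
    have := hF.cone _ (hinv A hA) (a * a) (by positivity)
    simpa only [Matrix.transpose_smul, Matrix.smul_mul, Matrix.mul_smul, smul_smul] using this) x
  simpa only [matMap, map_smul, smul_apply] using h

theorem isSubharmonicOn_const (hF : IsSTConeSubequation F) {c : EReal} (hc : c ≠ ⊤) :
    IsSubharmonicOn F X fun _ => c where
  usc := upperSemicontinuousOn_const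
  ne_top _ _ := hc
  viscosity _ _ _ hφ hφx hle :=
    hF.mem_of_posSemidef <| posSemidef_hessian_of_isLocalMin hφ <|
      hle.mono fun _ hy => EReal.coe_le_coe_iff.1 (hφx ▸ hy)

end AffineChange

section Separation

variable {n : ℕ} {F : Set (Matrix (Fin n) (Fin n) ℝ)} {A : Matrix (Fin n) (Fin n) ℝ}

theorem exists_posSemidef_add_smul_one (hA : A.IsSymm) :
    ∃ t : ℝ, (A + t • (1 : Matrix (Fin n) (Fin n) ℝ)).PosSemidef := by
  refine ⟨‖matMap A‖, Matrix.PosSemidef.of_dotProduct_mulVec_nonneg ?_ fun v => ?_⟩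
  · simp [Matrix.IsHermitian, hA.eq]
  · have hbound : -(‖matMap A‖ * ‖WithLp.toLp 2 v‖ ^ 2) ≤ v ⬝ᵥ A.mulVec v := by
      have hinner := abs_real_inner_le_norm (WithLp.toLp 2 v) (matMap A (WithLp.toLp 2 v))
      have hop := (matMap A).le_opNorm (WithLp.toLp 2 v)
      rw [EuclideanSpace.inner_eq_star_dotProduct, Matrix.ofLp_toEuclideanCLM, star_trivial,
        dotProduct_comm] at hinner
      nlinarith [neg_le_of_abs_le hinner, norm_nonneg (WithLp.toLp 2 v)]
    rw [norm_sq_eq_dotProduct] at hbound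
    simp only [star_trivial, Matrix.add_mulVec, Matrix.smul_mulVec, Matrix.one_mulVec,
      dotProduct_add, dotProduct_smul, smul_eq_mul]
    linarith

theorem IsSTConeSubequation.exists_isElliptic (hF : IsSTConeSubequation F) (hconv : Convex ℝ F)
    (hA : A.IsSymm) (hAF : A ∉ F) :
    ∃ ℓ : Matrix (Fin n) (Fin n) ℝ →ₗ[ℝ] ℝ, IsElliptic ℓ ∧ (∀ B ∈ F, 0 ≤ ℓ B) ∧ ℓ A < 0 := by
  have : LocallyConvexSpace ℝ (Matrix (Fin n) (Fin n) ℝ) :=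
    inferInstanceAs (LocallyConvexSpace ℝ (Fin n → Fin n → ℝ))
  obtain ⟨f, s, hfA, hfF⟩ := geometric_hahn_banach_point_closed hconv hF.isClosed hAF
  have hs : s < 0 := by simpa using hfF 0 hF.zero_mem
  have hnonneg : ∀ B ∈ F, 0 ≤ f B := by
    intro B hB
    by_contra! hneg
    have h := hfF _ (hF.cone B hB (s / f B) (div_nonneg_of_nonpos hs.le hneg.le))
    rw [map_smul, smul_eq_mul, div_mul_cancel₀ _ hneg.ne] at h
    exact lt_irrefl _ h
  have hpos (P : Matrix (Fin n) (Fin n) ℝ) (hP : P.PosSemidef) : 0 ≤ f P :=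
    hnonneg P (hF.mem_of_posSemidef hP)
  refine ⟨f, ⟨hpos, (hpos 1 .one).lt_of_ne' fun h₁ => ?_⟩, hnonneg, hfA.trans hs⟩
  obtain ⟨t, ht⟩ := exists_posSemidef_add_smul_one hA
  have ht := hpos _ ht
  rw [map_add, map_smul, h₁, smul_zero, add_zero] at ht
  exact ht.not_gt (hfA.trans hs)

end Separation

section MeanValue

variable {n : ℕ} {F : Set (Matrix (Fin n) (Fin n) ℝ)} {X : Set (E n)} {u : E n → EReal}
  {ℓ : Matrix (Fin n) (Fin n) ℝ →ₗ[ℝ] ℝ} {ν : Measure (sphere (0 : E n) 1)}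

theorem integrable_of_continuous {S : Type*} [TopologicalSpace S] [CompactSpace S]
    [MeasurableSpace S] [OpensMeasurableSpace S] {μ : Measure S} [IsFiniteMeasureOnCompacts μ]
    {f : S → ℝ} (hf : Continuous f) : Integrable f μ :=
  hf.integrable_of_hasCompactSupport (.of_compactSpace f)

theorem ofReal_integral_le_lintegral {α : Type*} [MeasurableSpace α] {μ : Measure α} {f : α → ℝ}
    (hf : Integrable f μ) : ENNReal.ofReal (∫ a, f a ∂μ) ≤ ∫⁻ a, ENNReal.ofReal (f a) ∂μ := by
  refine ENNReal.ofReal_le_of_le_toReal ?_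
  rw [integral_eq_lintegral_pos_part_sub_lintegral_neg_part hf]
  exact sub_le_self _ ENNReal.toReal_nonneg

namespace IsSubharmonicOn

theorem le_polyEval (hu : IsSubharmonicOn F X u) (hℓ : IsElliptic ℓ) (hℓF : ∀ B ∈ F, 0 ≤ ℓ B)
    {x : E n} {r : ℝ} (hX : closedBall x r ⊆ X) {h : MvPolynomial (Fin n) ℝ}
    (hh : polyOp ℓ h = 0) (hb : ∀ y ∈ sphere x r, u y ≤ polyEval h y) :
    ∀ y ∈ closedBall x r, u y ≤ polyEval h y := by
  refine hu.le_of_hessian_sub_smul_one_notMem (isCompact_closedBall x r) hX isOpen_ball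
    ball_subset_closedBall (contDiff_polyEval h).continuous.continuousOn
    (fun y _ => (contDiff_polyEval h).contDiffAt) (fun y _ ε hε hmem => ?_)
    fun y hy => hb y (by rwa [closedBall_sdiff_ball] at hy)
  have hneg := hℓF _ hmem
  rw [map_sub, map_hessian_polyEval_of_polyOp_eq_zero hh, map_smul, smul_eq_mul] at hneg
  linarith [mul_pos hε hℓ.one_pos]

theorem le_integral_of_le (hu : IsSubharmonicOn F X u) (hX : closedBall (0 : E n) 1 ⊆ X)
    (hℓ : IsElliptic ℓ) (hℓF : ∀ B ∈ F, 0 ≤ ℓ B) (hν : IsHarmonicMeasure ℓ ν)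
    (g : C(sphere (0 : E n) 1, ℝ)) (hg : ∀ σ : sphere (0 : E n) 1, u (σ : E n) ≤ g σ) :
    u 0 ≤ ((∫ σ, g σ ∂ν : ℝ) : EReal) := by
  have := hν.isProbabilityMeasure
  refine le_coe_of_forall_pos_le_add_mul 2 fun ε hε => ?_
  obtain ⟨q, hq⟩ := exists_polyEval_near g hε
  obtain ⟨h, hh, hhq⟩ := hℓ.exists_dirichlet (q + MvPolynomial.C ε)
  have hhσ (σ : sphere (0 : E n) 1) : polyEval h (σ : E n) = polyEval q (σ : E n) + ε := by
    rw [hhq σ σ.2]; simp [polyEval]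
  have hle := hu.le_polyEval hℓ hℓF hX hh
    (fun y hy => (hg ⟨y, hy⟩).trans (EReal.coe_le_coe_iff.2 (by
      linarith [hhσ ⟨y, hy⟩, (abs_lt.1 (hq ⟨y, hy⟩)).1])))
    0 (mem_closedBall_self zero_le_one)
  refine hle.trans (EReal.coe_le_coe_iff.2 ?_)
  have hgi : Integrable g ν := integrable_of_continuous g.continuous
  calc polyEval h 0 = ∫ σ : sphere (0 : E n) 1, polyEval h (σ : E n) ∂ν := (hν h hh).symm
    _ ≤ ∫ σ, (g σ + ε * 2) ∂ν := by
      refine integral_mono (integrable_of_continuous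
        ((contDiff_polyEval h).continuous.comp continuous_subtype_val))
        (hgi.add (integrable_const _)) fun σ => ?_
      linarith [hhσ σ, (abs_lt.1 (hq σ)).2]
    _ = ∫ σ, g σ ∂ν + ε * 2 := by
      rw [integral_add hgi (integrable_const _), integral_const, probReal_univ, one_smul]

theorem lintegral_gap_le_of_unit (hu : IsSubharmonicOn F X u) (hX : closedBall (0 : E n) 1 ⊆ X)
    (hℓ : IsElliptic ℓ) (hℓF : ∀ B ∈ F, 0 ≤ ℓ B) (hν : IsHarmonicMeasure ℓ ν) {C : ℝ}
    (hC : ∀ σ : sphere (0 : E n) 1, u (σ : E n) ≤ C) :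
    ∫⁻ σ : sphere (0 : E n) 1, gap C (u (σ : E n)) ∂ν ≤ gap C (u 0) := by
  have := hν.isProbabilityMeasure
  have husc : UpperSemicontinuous fun σ : sphere (0 : E n) 1 => u (σ : E n) :=
    upperSemicontinuousOn_univ_iff.1 <| hu.usc.comp continuous_subtype_val.continuousOn
      fun σ _ => hX (sphere_subset_closedBall σ.2)
  refine lintegral_le_of_forall_continuous ν
    ((continuous_gap C).comp_upperSemicontinuous_antitone husc (gap_antitone C)) fun f hf => ?_
  have hfi : Integrable (fun σ => (f σ : ℝ)) ν := integrable_of_continuous (by fun_prop)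
  have hle := hu.le_integral_of_le hX hℓ hℓF hν ⟨fun σ => C - f σ, by fun_prop⟩ fun σ =>
    le_coe_sub_of_le_gap (hC σ) (hf σ)
  have hint : ∫ σ, (C - (f σ : ℝ)) ∂ν = C - ∫ σ, (f σ : ℝ) ∂ν := by
    rw [integral_sub (integrable_const C) hfi, integral_const, probReal_univ, one_smul]
  calc ∫⁻ σ, f σ ∂ν = ENNReal.ofReal (∫ σ, (f σ : ℝ) ∂ν) :=
        lintegral_coe_eq_integral _ hfi
    _ = gap C ((∫ σ, (C - (f σ : ℝ)) ∂ν : ℝ) : EReal) := by rw [hint, gap_coe, sub_sub_cancel]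
    _ ≤ gap C (u 0) := gap_antitone C hle

theorem lintegral_gap_le (hF : IsSTConeSubequation F) (hu : IsSubharmonicOn F X u)
    (hℓ : IsElliptic ℓ) (hℓF : ∀ B ∈ F, 0 ≤ ℓ B) (hν : IsHarmonicMeasure ℓ ν)
    {y : E n} {r : ℝ} (hr : 0 < r) (hX : closedBall y r ⊆ X) {C : ℝ}
    (hC : ∀ z ∈ closedBall y r, u z ≤ C) :
    ∫⁻ σ : sphere (0 : E n) 1, gap C (u (y + r • (σ : E n))) ∂ν ≤ gap C (u y) := by
  have hball (z : E n) (hz : z ∈ closedBall (0 : E n) 1) : y + r • z ∈ closedBall y r := by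
    rw [mem_closedBall_zero_iff] at hz
    rw [mem_closedBall_iff_norm, add_sub_cancel_left, norm_smul, Real.norm_of_nonneg hr.le]
    exact mul_le_of_le_one_right hr.le hz
  have hu' := hu.comp_similarity hF (g := 1) (by simp) (by simp) hr y
  simp only [map_one, one_apply_eq_self] at hu'
  simpa using hu'.lintegral_gap_le_of_unit (fun z hz => hX (hball z hz)) hℓ hℓF hν fun σ =>
    hC _ (hball _ (sphere_subset_closedBall σ.2))

end IsSubharmonicOn

section Converse

variable {v : E n → EReal} {x : E n} {φ : E n → ℝ}

theorem eventually_le_taylor_two (hφ : ContDiffAt ℝ 2 φ x) (hle : ∀ᶠ y in 𝓝 x, v y ≤ φ y)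
    {ε : ℝ} (hε : 0 < ε) :
    ∀ᶠ r in 𝓝[>] (0 : ℝ), ∀ σ : sphere (0 : E n) 1, v (x + r • (σ : E n)) ≤
      ((φ x + ((r • fderiv ℝ φ x) σ +
        1 / 2 * ((σ : E n).ofLp ⬝ᵥ (r ^ 2 • hessian φ x).mulVec (σ : E n).ofLp)) +
        ε * r ^ 2 : ℝ) : EReal) := by
  obtain ⟨δ, hδ, hball⟩ := Metric.eventually_nhds_iff_ball.1
    (((isLittleO_taylor_two hφ).def hε).and hle)
  filter_upwards [Ioo_mem_nhdsGT hδ] with r ⟨hr₀, hrδ⟩ σ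
  have hrσ : ‖r • (σ : E n)‖ = r := by
    rw [norm_smul, norm_eq_of_mem_sphere, mul_one, Real.norm_of_nonneg hr₀.le]
  obtain ⟨herr, hvφ⟩ := hball (x + r • (σ : E n)) (by
    rwa [mem_ball_iff_norm, add_sub_cancel_left, hrσ])
  refine hvφ.trans (EReal.coe_le_coe_iff.2 ?_)
  have herr := (abs_le.1 herr).2
  rw [add_sub_cancel_left, hrσ] at herr
  simp only [map_smul, smul_apply, smul_eq_mul, Matrix.smul_mulVec, dotProduct_smul,
    dotProduct_hessian_mulVec, norm_pow, Real.norm_of_nonneg hr₀.le] at herr ⊢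
  linarith

theorem IsElliptic.nonneg_hessian_of_lintegral_gap_le (hℓ : IsElliptic ℓ)
    (hν : IsHarmonicMeasure ℓ ν) {C : ℝ} (hφ : ContDiffAt ℝ 2 φ x) (hx : v x = φ x)
    (hC : φ x ≤ C) (hle : ∀ᶠ y in 𝓝 x, v y ≤ φ y)
    (hmean : ∀ᶠ r in 𝓝[>] (0 : ℝ),
      ∫⁻ σ : sphere (0 : E n) 1, gap C (v (x + r • (σ : E n))) ∂ν ≤ gap C (v x)) :
    0 ≤ ℓ (hessian φ x) := by
  have := hν.isProbabilityMeasure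
  have hℓ₂ : 0 < 2 * ℓ 1 := mul_pos two_pos hℓ.one_pos
  suffices h : ∀ ε : ℝ, 0 < ε → 0 ≤ ℓ (hessian φ x) / (2 * ℓ 1) + ε from
    nonneg_of_mul_nonneg_left (le_of_forall_pos_le_add h) (inv_pos.2 hℓ₂)
  intro ε hε
  obtain ⟨r, ⟨hmr, htaylor⟩, hr₀⟩ :=
    ((hmean.and (eventually_le_taylor_two hφ hle hε)).and self_mem_nhdsWithin).exists
  set Q : sphere (0 : E n) 1 → ℝ := fun σ =>
    (r • fderiv ℝ φ x) σ + 1 / 2 * ((σ : E n).ofLp ⬝ᵥ (r ^ 2 • hessian φ x).mulVec (σ : E n).ofLp)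
  have hQi : Integrable Q ν := integrable_of_continuous (by fun_prop)
  have hQ : ∫ σ, Q σ ∂ν = r ^ 2 * (ℓ (hessian φ x) / (2 * ℓ 1)) := by
    rw [hν.integral_quadratic hℓ.one_pos.ne' _ ((isSymm_hessian hφ).smul _), map_smul, smul_eq_mul,
      mul_div_assoc]
  have hint : ENNReal.ofReal (∫ σ, (C - (φ x + Q σ + ε * r ^ 2)) ∂ν) ≤ ENNReal.ofReal (C - φ x) :=
    calc ENNReal.ofReal (∫ σ, (C - (φ x + Q σ + ε * r ^ 2)) ∂ν)
        ≤ ∫⁻ σ, ENNReal.ofReal (C - (φ x + Q σ + ε * r ^ 2)) ∂ν :=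
          ofReal_integral_le_lintegral (by fun_prop)
      _ ≤ ∫⁻ σ : sphere (0 : E n) 1, gap C (v (x + r • (σ : E n))) ∂ν :=
          lintegral_mono fun σ => gap_coe C _ ▸ gap_antitone C (htaylor σ)
      _ ≤ ENNReal.ofReal (C - φ x) := by rwa [← gap_coe, ← hx]
  rw [ENNReal.ofReal_le_ofReal_iff (by linarith), integral_sub (by fun_prop) (by fun_prop),
    integral_add (by fun_prop) (by fun_prop), integral_add (by fun_prop) hQi, hQ] at hint
  simp only [integral_const, probReal_univ, one_smul] at hint
  have hscaled : 0 ≤ r ^ 2 * (ℓ (hessian φ x) / (2 * ℓ 1) + ε) := by linarith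
  exact nonneg_of_mul_nonneg_right hscaled (sq_pos_of_pos hr₀)

end Converse

end MeanValue

section Average

variable {n : ℕ} {F : Set (Matrix (Fin n) (Fin n) ℝ)} {X : Set (E n)}

theorem lowerSemicontinuousOn_lintegral {Y Ω : Type*} [TopologicalSpace Y]
    [FirstCountableTopology Y] [MeasurableSpace Ω] (μ : Measure Ω) {s : Set Y}
    {w : Ω → Y → ENNReal} (hw : ∀ ω, LowerSemicontinuousOn (w ω) s)
    (hm : ∀ y, Measurable fun ω => w ω y) :
    LowerSemicontinuousOn (fun y => ∫⁻ ω, w ω y ∂μ) s := by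
  intro y hy
  refine lowerSemicontinuousWithinAt_iff_le_liminf.2 ?_
  calc ∫⁻ ω, w ω y ∂μ ≤ ∫⁻ ω, liminf (w ω) (𝓝[s] y) ∂μ :=
        lintegral_mono fun ω => lowerSemicontinuousWithinAt_iff_le_liminf.1 (hw ω y hy)
    _ ≤ liminf (fun z => ∫⁻ ω, w ω z ∂μ) (𝓝[s] y) := lintegral_liminf_le hm

theorem isSubharmonicOn_average (hF : IsSTConeSubequation F) (hconv : Convex ℝ F)
    (hX : IsOpen X) {Ω : Type*} [MeasurableSpace Ω] (μ : Measure Ω) [SFinite μ]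
    {U : Ω → E n → EReal} (hU : ∀ ω, IsSubharmonicOn F X (U ω)) {C : ℝ}
    (hC : ∀ ω, ∀ y ∈ X, U ω y ≤ C) (hm : Measurable fun q : Ω × E n => U q.1 q.2) :
    IsSubharmonicOn F X fun y => (C : EReal) - ((∫⁻ ω, gap C (U ω y) ∂μ : ENNReal) : EReal) where
  usc := by
    refine (continuous_coe_sub C).comp_lowerSemicontinuousOn_antitone ?_ (coe_sub_antitone C)
    refine lowerSemicontinuousOn_lintegral μ (fun ω => ?_) fun y => ?_
    · exact (continuous_gap C).comp_upperSemicontinuousOn_antitone (hU ω).usc (gap_antitone C)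
    · exact (measurable_gap C).comp (hm.comp measurable_prodMk_right)
  ne_top y _ := ne_top_of_le_ne_top (EReal.coe_ne_top C) (coe_sub_le C _)
  viscosity x hx φ hφ hφx hle := by
    by_contra hnot
    obtain ⟨ℓ, hℓ, hℓF, hneg⟩ := hF.exists_isElliptic hconv (isSymm_hessian hφ) hnot
    obtain ⟨ν, hν⟩ := hℓ.exists_isHarmonicMeasure
    have := hν.isProbabilityMeasure
    have hφC : φ x ≤ C := EReal.coe_le_coe_iff.1 (hφx ▸ coe_sub_le C _)
    refine hneg.not_ge (hℓ.nonneg_hessian_of_lintegral_gap_le hν hφ hφx hφC hle ?_)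
    obtain ⟨R, hR, hball⟩ := Metric.nhds_basis_closedBall.mem_iff.1 (hX.mem_nhds hx)
    filter_upwards [Ioo_mem_nhdsGT hR] with r hr
    have hsub : closedBall x r ⊆ X := (closedBall_subset_closedBall hr.2.le).trans hball
    have hshift : Measurable fun q : sphere (0 : E n) 1 × Ω => x + r • (q.1 : E n) := by fun_prop
    simp only [gap_coe_sub]
    rw [lintegral_lintegral_swap (f := fun (σ : sphere (0 : E n) 1) ω => gap C (U ω (x + r • σ)))
      ((measurable_gap C).comp (hm.comp (measurable_snd.prodMk hshift))).aemeasurable]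
    exact lintegral_mono fun ω =>
      (hU ω).lintegral_gap_le hF hℓ hℓF hν hr.1 hsub fun z hz => hC ω z (hsub hz)

end Average

section RotationAverage

variable {n : ℕ} {F : Set (Matrix (Fin n) (Fin n) ℝ)}

instance compactSpace_orthogonalGroup : CompactSpace (Matrix.orthogonalGroup (Fin n) ℝ) := by
  have hK : IsCompact (Set.univ.pi fun _ : Fin n => Set.univ.pi fun _ : Fin n =>
      Set.Icc (-1 : ℝ) 1) :=
    isCompact_univ_pi fun _ => isCompact_univ_pi fun _ => isCompact_Icc
  have hc : IsClosed ((Matrix.orthogonalGroup (Fin n) ℝ : Submonoid _) :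
      Set (Matrix (Fin n) (Fin n) ℝ)) := isClosed_unitary
  refine isCompact_iff_compactSpace.1 (hK.of_isClosed_subset hc ?_)
  intro g hg i _ j _
  exact abs_le.1 (entry_norm_bound_of_unitary hg i j)

theorem continuous_matMap_apply : Continuous fun q : Matrix (Fin n) (Fin n) ℝ × E n =>
    matMap q.1 q.2 := by
  have : Continuous fun q : Matrix (Fin n) (Fin n) ℝ × E n => q.1.mulVec q.2.ofLp :=
    continuous_fst.matrix_mulVec ((PiLp.continuous_ofLp 2 _).comp continuous_snd)
  exact (PiLp.continuous_toLp 2 _).comp this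

theorem exists_invariant_probability (H : Type*) [Group H] [TopologicalSpace H]
    [IsTopologicalGroup H] [CompactSpace H] [MeasurableSpace H] [BorelSpace H] :
    ∃ μ : Measure H, IsProbabilityMeasure μ ∧
      ∀ (f : H → ENNReal) (h : H), ∫⁻ ω, f (h * ω) ∂μ = ∫⁻ ω, f ω ∂μ := by
  have : NeZero (Measure.haar : Measure H) := inferInstance
  exact ⟨(Measure.haar (G := H) Set.univ)⁻¹ • Measure.haar, inferInstance, fun f h =>
    lintegral_mul_left_eq_self f h⟩

theorem exists_matMap_eq {G : Subgroup (Matrix.orthogonalGroup (Fin n) ℝ)}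
    (hG : ∀ e e' : E n, ‖e‖ = 1 → ‖e'‖ = 1 →
      ∃ g ∈ G, Matrix.mulVec (g : Matrix (Fin n) (Fin n) ℝ) e.ofLp = e'.ofLp)
    {y y' : E n} (hyy' : ‖y‖ = ‖y'‖) :
    ∃ g ∈ G, matMap (g : Matrix (Fin n) (Fin n) ℝ) y = y' := by
  rcases eq_or_ne ‖y‖ 0 with h0 | h0
  · rw [norm_eq_zero.1 h0, norm_eq_zero.1 (hyy' ▸ h0 : ‖y'‖ = 0)]
    exact ⟨1, G.one_mem, by simp⟩
  · have hunit : ∀ z : E n, ‖z‖ = ‖y‖ → ‖‖y‖⁻¹ • z‖ = 1 := fun z hz => by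
      rw [norm_smul, norm_inv, norm_norm, hz, inv_mul_cancel₀ h0]
    obtain ⟨g, hg, hge⟩ := hG _ _ (hunit y rfl) (hunit y' hyy'.symm)
    have h1 : matMap (g : Matrix (Fin n) (Fin n) ℝ) (‖y‖⁻¹ • y) = ‖y‖⁻¹ • y' :=
      WithLp.ofLp_injective 2 (by rw [Matrix.ofLp_toEuclideanCLM]; exact hge)
    rw [map_smul] at h1
    exact ⟨g, hg, smul_right_injective _ (inv_ne_zero h0) h1⟩

theorem IsSTConeSubequation.exists_isClosed_subgroup (hF : IsSTConeSubequation F) :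
    ∃ H : Subgroup (Matrix.orthogonalGroup (Fin n) ℝ),
      IsClosed (H : Set (Matrix.orthogonalGroup (Fin n) ℝ)) ∧
      (∀ y y' : E n, ‖y‖ = ‖y'‖ → ∃ g ∈ H, matMap (g : Matrix (Fin n) (Fin n) ℝ) y = y') ∧
      ∀ g ∈ H, ∀ A ∈ F, (g : Matrix (Fin n) (Fin n) ℝ) * A *
        (g : Matrix (Fin n) (Fin n) ℝ).transpose ∈ F := by
  obtain ⟨G, hG, hinv⟩ := hF.invariant
  refine ⟨G.topologicalClosure, G.isClosed_topologicalClosure, fun y y' hyy' => ?_,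
    fun g hg A hA => ?_⟩
  · obtain ⟨g, hg, hgy⟩ := exists_matMap_eq hG hyy'
    exact ⟨g, G.le_topologicalClosure hg, hgy⟩
  · have hc : Continuous fun g : Matrix.orthogonalGroup (Fin n) ℝ =>
        (g : Matrix (Fin n) (Fin n) ℝ) * A * (g : Matrix (Fin n) (Fin n) ℝ).transpose := by
      fun_prop
    exact closure_minimal (fun g hg => hinv g hg A hA) (hF.isClosed.preimage hc) hg

/-- `M` is a random rotation with law `μ` that preserves `F`, and whose images of two vectors of
the same length have the same distribution. -/
structure IsRandomRotation (F : Set (Matrix (Fin n) (Fin n) ℝ)) {Ω : Type} [MeasurableSpace Ω]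
    (μ : Measure Ω) (M : Ω → Matrix (Fin n) (Fin n) ℝ) : Prop where
  isProb : IsProbabilityMeasure μ
  orth : ∀ ω, M ω * (M ω).transpose = 1
  mem : ∀ ω, ∀ A ∈ F, (M ω).transpose * A * M ω ∈ F
  measurable : Measurable fun q : Ω × E n => matMap (M q.1) q.2
  lintegral_eq : ∀ (f : E n → ENNReal) (y y' : E n), ‖y‖ = ‖y'‖ →
    ∫⁻ ω, f (matMap (M ω) y) ∂μ = ∫⁻ ω, f (matMap (M ω) y') ∂μ

theorem IsSTConeSubequation.exists_isRandomRotation (hF : IsSTConeSubequation F) :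
    ∃ (Ω : Type) (_ : MeasurableSpace Ω) (μ : Measure Ω) (M : Ω → Matrix (Fin n) (Fin n) ℝ),
      IsRandomRotation F μ M := by
  obtain ⟨H, hH, htrans, hinv⟩ := hF.exists_isClosed_subgroup
  have : CompactSpace H := isCompact_iff_compactSpace.1 hH.isCompact
  let _ : MeasurableSpace H := borel H
  have : BorelSpace H := ⟨rfl⟩
  obtain ⟨μ, hμ, hμinv⟩ := exists_invariant_probability H
  -- Inverses are used because Haar measure is only known to be left invariant.
  refine ⟨H, inferInstance, μ, fun g => ((g⁻¹ : H) : Matrix (Fin n) (Fin n) ℝ),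
    ⟨hμ, fun g => mul_transpose_of_mem_orthogonalGroup (g⁻¹ : H).1, fun g A hA => ?_, ?_,
      fun f y y' hyy' => ?_⟩⟩
  · have hg : ((g⁻¹ : H) : Matrix (Fin n) (Fin n) ℝ) =
        ((g : H) : Matrix (Fin n) (Fin n) ℝ).transpose := by
      simp [Matrix.star_eq_conjTranspose]
    simpa only [hg, Matrix.transpose_transpose] using hinv g.1 g.2 A hA
  · have hcoe : Continuous fun g : H => ((g⁻¹ : H) : Matrix (Fin n) (Fin n) ℝ) :=
      continuous_subtype_val.comp (continuous_subtype_val.comp continuous_inv)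
    exact (continuous_matMap_apply.comp (hcoe.prodMap continuous_id)).measurable
  · obtain ⟨h, hh, rfl⟩ := htrans y y' hyy'
    rw [← hμinv _ (⟨h, hh⟩ : H)⁻¹]
    refine lintegral_congr fun ω => ?_
    rw [← matMap_mul_apply, mul_inv_rev, inv_inv]
    rfl

/-- A measure on Euclidean space invariant under all orthogonal matrices. -/
def IsRotationInvariant (m : Measure (E n)) : Prop :=
  ∀ g : Matrix (Fin n) (Fin n) ℝ, g * g.transpose = 1 → m.map (matMap g) = m

namespace IsRandomRotation

variable {Ω : Type} [MeasurableSpace Ω] {μ : Measure Ω} {M : Ω → Matrix (Fin n) (Fin n) ℝ}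
  {m m' : Measure (E n)} {f : E n → ENNReal}

theorem lintegral_average (h : IsRandomRotation F μ M) [SFinite m]
    (hm : IsRotationInvariant m) (hf : Measurable f) :
    ∫⁻ z, f z ∂m = ∫⁻ z, ∫⁻ ω, f (matMap (M ω) z) ∂μ ∂m := by
  have := h.isProb
  have hinv : ∀ ω, ∫⁻ z, f (matMap (M ω) z) ∂m = ∫⁻ z, f z ∂m := fun ω => by
    rw [← lintegral_map hf (matMap (M ω)).continuous.measurable, hm _ (h.orth ω)]
  rw [lintegral_lintegral_swap]
  · simp only [hinv, lintegral_const, measure_univ, mul_one]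
  · exact (hf.comp (h.measurable.comp measurable_swap)).aemeasurable

theorem lintegral_eq_sphere (h : IsRandomRotation F μ M)
    [IsProbabilityMeasure m] (hm : IsRotationInvariant m) (hs : ∀ᵐ z ∂m, ‖z‖ = 1)
    (hf : Measurable f) (z : E n) :
    ∫⁻ ω, f (matMap (M ω) z) ∂μ = ∫⁻ σ, f (‖z‖ • σ) ∂m := by
  have hfz : Measurable fun σ : E n => f (‖z‖ • σ) := hf.comp (measurable_const_smul _)
  rw [h.lintegral_average hm hfz]
  have hconst : ∀ᵐ σ ∂m,
      ∫⁻ ω, f (‖z‖ • matMap (M ω) σ) ∂μ = ∫⁻ ω, f (matMap (M ω) z) ∂μ := by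
    filter_upwards [hs] with σ hσ
    rw [h.lintegral_eq f z (‖z‖ • σ) (by rw [norm_smul, norm_norm, hσ, mul_one])]
    simp only [map_smul]
  simp only [lintegral_congr_ae hconst, lintegral_const, measure_univ, mul_one]

theorem lintegral_polar (h : IsRandomRotation F μ M) [SFinite m] (hm : IsRotationInvariant m)
    [IsProbabilityMeasure m'] (hm' : IsRotationInvariant m') (hs : ∀ᵐ z ∂m', ‖z‖ = 1)
    (hf : Measurable f) : ∫⁻ z, f z ∂m = ∫⁻ z, ∫⁻ σ, f (‖z‖ • σ) ∂m' ∂m := by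
  rw [h.lintegral_average hm hf]
  exact lintegral_congr fun z => h.lintegral_eq_sphere hm' hs hf z

theorem lintegral_prod_eq (h : IsRandomRotation F μ M)
    [IsProbabilityMeasure m] (hm : IsRotationInvariant m) (hs : ∀ᵐ z ∂m, ‖z‖ ≤ 1)
    (hf : Measurable f) (y : E n) :
    ∫⁻ q : Ω × E n, f (min ‖q.2‖ 1 • matMap (M q.1) y) ∂(μ.prod m) =
      ∫⁻ z, f (‖y‖ • z) ∂m := by
  have := h.isProb
  have hfy : Measurable fun σ : E n => f (‖y‖ • σ) := hf.comp (measurable_const_smul _)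
  have hrot : Measurable fun q : Ω × E n => matMap (M q.1) y :=
    Measurable.fun_comp (g := fun q : Ω × E n => matMap (M q.1) q.2)
      (f := fun q : Ω × E n => (q.1, y)) h.measurable (measurable_fst.prodMk measurable_const)
  have hmeas : Measurable fun q : Ω × E n => f (min ‖q.2‖ 1 • matMap (M q.1) y) :=
    hf.comp (Measurable.fun_smul (measurable_snd.norm.min measurable_const) hrot)
  rw [lintegral_prod_symm _ hmeas.aemeasurable, h.lintegral_average hm hfy]
  refine lintegral_congr_ae ?_
  filter_upwards [hs] with z hz
  have hsymm := h.lintegral_eq f (‖z‖ • y) (‖y‖ • z)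
    (by rw [norm_smul, norm_smul, norm_norm, norm_norm, mul_comm])
  simpa only [min_eq_left hz, map_smul] using hsymm

end IsRandomRotation

end RotationAverage

section InvariantMeasures

variable {n : ℕ}

/-- The isometry of Euclidean space defined by an orthogonal matrix. -/
noncomputable def orthIsometry {g : Matrix (Fin n) (Fin n) ℝ} (hg : g * g.transpose = 1) :
    E n ≃ₗᵢ[ℝ] E n where
  toLinearEquiv := LinearEquiv.ofLinearMap (matMap g).toLinearMap (matMap g.transpose).toLinearMap
    (by ext1 y; simpa [hg] using (matMap_mul_apply g g.transpose y).symm)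
    (by ext1 y; simpa [mul_eq_one_comm.1 hg] using (matMap_mul_apply g.transpose g y).symm)
  norm_map' y := norm_matMap (mul_eq_one_comm.1 hg) y

theorem isRotationInvariant_volume : IsRotationInvariant (volume : Measure (E n)) := fun _ hg =>
  (orthIsometry hg).measurePreserving.map_eq

theorem IsRotationInvariant.smul {m : Measure (E n)} (hm : IsRotationInvariant m) (c : ENNReal) :
    IsRotationInvariant (c • m) := fun g hg => by
  rw [Measure.map_smul, hm g hg]

theorem IsRotationInvariant.restrict {m : Measure (E n)} (hm : IsRotationInvariant m)
    {A : Set (E n)} (hA : MeasurableSet A) (hinv : ∀ y z : E n, ‖y‖ = ‖z‖ → (y ∈ A ↔ z ∈ A)) :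
    IsRotationInvariant (m.restrict A) := by
  intro g hg
  have hpre : matMap g ⁻¹' A = A :=
    Set.ext fun z => hinv _ z (norm_matMap (mul_eq_one_comm.1 hg) z)
  conv_lhs => rw [← hpre]
  rw [← Measure.restrict_map (matMap g).continuous.measurable hA, hm g hg]

theorem isRotationInvariant_cond {A : Set (E n)} (hA : MeasurableSet A)
    (hinv : ∀ y z : E n, ‖y‖ = ‖z‖ → (y ∈ A ↔ z ∈ A)) :
    IsRotationInvariant (ProbabilityTheory.cond volume A) :=
  (isRotationInvariant_volume.restrict hA hinv).smul _

theorem isProbabilityMeasure_cond_closedBall {r : ℝ} (hr : 0 < r) :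
    IsProbabilityMeasure (ProbabilityTheory.cond volume (closedBall (0 : E n) r)) :=
  ProbabilityTheory.cond_isProbabilityMeasure_of_finite (measure_closedBall_pos volume _ hr).ne'
    measure_closedBall_lt_top.ne

theorem isRotationInvariant_cond_closedBall (r : ℝ) :
    IsRotationInvariant (ProbabilityTheory.cond volume (closedBall (0 : E n) r)) :=
  isRotationInvariant_cond isClosed_closedBall.measurableSet fun y z h => by
    rw [mem_closedBall_zero_iff, mem_closedBall_zero_iff, h]

instance isProbabilityMeasure_ballMeasure : IsProbabilityMeasure (ballMeasure n) :=
  isProbabilityMeasure_cond_closedBall one_pos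

theorem isRotationInvariant_ballMeasure : IsRotationInvariant (ballMeasure n) :=
  isRotationInvariant_cond_closedBall 1

theorem ae_norm_le_ballMeasure : ∀ᵐ z ∂(ballMeasure n), ‖z‖ ≤ 1 := by
  have h : ∀ᵐ z ∂(ballMeasure n), z ∈ closedBall (0 : E n) 1 :=
    ProbabilityTheory.ae_cond_mem isClosed_closedBall.measurableSet
  simpa only [mem_closedBall_zero_iff] using h

theorem map_smul_ballMeasure {r : ℝ} (hr : 0 < r) :
    (ballMeasure n).map (r • ·) = ProbabilityTheory.cond volume (closedBall (0 : E n) r) := by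
  have hpre : (r • · : E n → E n) ⁻¹' closedBall 0 r = closedBall 0 1 := by
    ext z
    simp [norm_smul, abs_of_pos hr, hr]
  have hvol := fun s : Set (E n) => Measure.addHaar_preimage_smul volume hr.ne' s
  ext s hs
  rw [Measure.map_apply (measurable_const_smul r) hs]
  change ProbabilityTheory.cond volume (closedBall 0 1) _ = _
  rw [ProbabilityTheory.cond_apply isClosed_closedBall.measurableSet,
    ProbabilityTheory.cond_apply isClosed_closedBall.measurableSet, ← hpre, ← Set.preimage_inter,
    hvol, hvol, mul_comm, ← div_eq_mul_inv, mul_comm (volume _)⁻¹, ← div_eq_mul_inv]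
  exact ENNReal.mul_div_mul_left _ _ (by simp [hr.ne']) ENNReal.ofReal_ne_top

theorem isProbabilityMeasure_sphereMeasure (hn : 1 ≤ n) :
    IsProbabilityMeasure (sphereMeasure n) := by
  have : Nonempty (Fin n) := ⟨⟨0, hn⟩⟩
  have h0 : NeZero (volume : Measure (E n)).toSphere := ⟨Measure.toSphere_ne_zero _⟩
  unfold sphereMeasure
  infer_instance

/-- The normalized surface measure of the unit sphere as a measure on Euclidean space. -/
noncomputable def sphereMeasureE (n : ℕ) : Measure (E n) := (sphereMeasure n).map Subtype.val

theorem isProbabilityMeasure_sphereMeasureE (hn : 1 ≤ n) :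
    IsProbabilityMeasure (sphereMeasureE n) := by
  have := isProbabilityMeasure_sphereMeasure hn
  exact Measure.isProbabilityMeasure_map measurable_subtype_coe.aemeasurable

theorem ae_norm_eq_sphereMeasureE : ∀ᵐ z ∂(sphereMeasureE n), ‖z‖ = 1 := by
  rw [sphereMeasureE, ae_map_iff measurable_subtype_coe.aemeasurable
    (measurableSet_eq_fun measurable_norm measurable_const)]
  exact Eventually.of_forall fun σ => mem_sphere_zero_iff_norm.1 σ.2

open scoped Pointwise in
theorem Ioo_smul_image_sphere (s : Set (E n)) :
    Set.Ioo (0 : ℝ) 1 • (Subtype.val '' ((Subtype.val : sphere (0 : E n) 1 → E n) ⁻¹' s)) =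
      {y : E n | ‖y‖ ∈ Set.Ioo 0 1 ∧ ‖y‖⁻¹ • y ∈ s} := by
  ext y
  simp only [Set.mem_smul, Set.mem_image, Set.mem_preimage, Subtype.exists, Set.mem_ofPred_eq]
  constructor
  · rintro ⟨a, ha, _, ⟨σ, hσ, hσs, rfl⟩, rfl⟩
    have hnorm : ‖a • σ‖ = a := by
      rw [norm_smul, mem_sphere_zero_iff_norm.1 hσ, mul_one, Real.norm_of_nonneg ha.1.le]
    rw [hnorm, inv_smul_smul₀ ha.1.ne']
    exact ⟨ha, hσs⟩
  · rintro ⟨hy, hys⟩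
    refine ⟨‖y‖, hy, ‖y‖⁻¹ • y, ⟨_, ?_, hys, rfl⟩, smul_inv_smul₀ hy.1.ne' y⟩
    rw [mem_sphere_zero_iff_norm, norm_smul, norm_inv, norm_norm, inv_mul_cancel₀ hy.1.ne']

theorem isRotationInvariant_sphereMeasureE : IsRotationInvariant (sphereMeasureE n) := by
  intro g hg
  have hgm : Measurable (matMap g) := (matMap g).continuous.measurable
  rw [sphereMeasureE, sphereMeasure, Measure.map_smul, Measure.map_smul]
  congr 1
  ext s hs
  rw [Measure.map_apply hgm hs, Measure.map_apply measurable_subtype_coe (hgm hs),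
    Measure.map_apply measurable_subtype_coe hs,
    Measure.toSphere_apply' _ (measurable_subtype_coe (hgm hs)),
    Measure.toSphere_apply' _ (measurable_subtype_coe hs), Ioo_smul_image_sphere,
    Ioo_smul_image_sphere]
  congr 1
  have hpre : {y : E n | ‖y‖ ∈ Set.Ioo 0 1 ∧ ‖y‖⁻¹ • y ∈ matMap g ⁻¹' s} =
      orthIsometry hg ⁻¹' {y : E n | ‖y‖ ∈ Set.Ioo 0 1 ∧ ‖y‖⁻¹ • y ∈ s} := by
    ext y
    simp only [Set.mem_preimage, Set.mem_ofPred_eq, LinearIsometryEquiv.norm_map, map_smul]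
    rfl
  rw [hpre]
  exact MeasurePreserving.measure_preimage_equiv
    (f := (orthIsometry hg).toHomeomorph.toMeasurableEquiv) (orthIsometry hg).measurePreserving _

end InvariantMeasures

section ExtIntegral

theorem coe_sub_coe_eq_of_add_eq {a b c d : ENNReal} (ha : a ≠ ⊤) (hc : c ≠ ⊤)
    (h : d + a = c + b) : (a : EReal) - b = c - d := by
  lift a to NNReal using ha
  lift c to NNReal using hc
  induction b with
  | top =>
    obtain rfl : d = ⊤ := by simpa using h
    rw [EReal.coe_ennreal_top, EReal.sub_top, EReal.sub_top]
  | coe b =>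
    have hd : d ≠ ⊤ := by
      rintro rfl
      exact ENNReal.coe_ne_top ((ENNReal.coe_add c b).trans h.symm)
    lift d to NNReal using hd
    have hreal : (d : ℝ) + a = c + b := by exact_mod_cast h
    have hcoe : ∀ w : NNReal, ((w : ENNReal) : EReal) = ((w : ℝ) : EReal) := fun _ => rfl
    rw [hcoe, hcoe, hcoe, hcoe, ← EReal.coe_sub, ← EReal.coe_sub]
    exact congrArg _ (by linarith)

theorem gap_add_toENNReal {C : ℝ} (hC : 0 ≤ C) {a : EReal} (ha : a ≤ C) :
    gap C a + a.toENNReal = ENNReal.ofReal C + (-a).toENNReal := by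
  induction a with
  | bot => simp
  | top => simp at ha
  | coe b =>
    have hb : b ≤ C := by exact_mod_cast ha
    rw [gap_coe, ← EReal.coe_neg, EReal.real_coe_toENNReal, EReal.real_coe_toENNReal]
    rcases le_total 0 b with h0 | h0
    · rw [ENNReal.ofReal_of_nonpos (neg_nonpos.2 h0), add_zero,
        ← ENNReal.ofReal_add (sub_nonneg.2 hb) h0, sub_add_cancel]
    · rw [ENNReal.ofReal_of_nonpos h0, add_zero, ← ENNReal.ofReal_add hC (neg_nonneg.2 h0),
        sub_eq_add_neg]

variable {α : Type*} [MeasurableSpace α] {μ : Measure α} {f g : α → EReal}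

theorem extIntegral_eq_sub [IsProbabilityMeasure μ] (hf : Measurable f) {C : ℝ} (hC : 0 ≤ C)
    (hfC : ∀ a, f a ≤ C) :
    extIntegral μ f = (C : EReal) - ((∫⁻ a, gap C (f a) ∂μ : ENNReal) : EReal) := by
  have hgap : Measurable fun a => gap C (f a) := (measurable_gap C).comp hf
  have hint : ∫⁻ a, gap C (f a) ∂μ + ∫⁻ a, (f a).toENNReal ∂μ =
      ENNReal.ofReal C + ∫⁻ a, (-f a).toENNReal ∂μ := by
    rw [← lintegral_add_left hgap,
      lintegral_congr fun a => gap_add_toENNReal hC (hfC a), lintegral_add_left measurable_const,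
      lintegral_const, measure_univ, mul_one]
  have hfin : ∫⁻ a, (f a).toENNReal ∂μ ≠ ⊤ := by
    refine ne_top_of_le_ne_top (ENNReal.ofReal_ne_top (r := C)) ?_
    calc ∫⁻ a, (f a).toENNReal ∂μ ≤ ∫⁻ _, ENNReal.ofReal C ∂μ := lintegral_mono fun a =>
          EReal.toENNReal_le_toENNReal (hfC a)
      _ = ENNReal.ofReal C := by rw [lintegral_const, measure_univ, mul_one]
  rw [extIntegral, coe_sub_coe_eq_of_add_eq hfin ENNReal.ofReal_ne_top hint,
    EReal.coe_ennreal_ofReal, max_eq_left hC]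

theorem extIntegral_congr_ae (h : f =ᵐ[μ] g) : extIntegral μ f = extIntegral μ g := by
  have hpos : ∫⁻ a, (f a).toENNReal ∂μ = ∫⁻ a, (g a).toENNReal ∂μ :=
    lintegral_congr_ae (h.mono fun a ha => congrArg EReal.toENNReal ha)
  have hneg : ∫⁻ a, (-f a).toENNReal ∂μ = ∫⁻ a, (-g a).toENNReal ∂μ :=
    lintegral_congr_ae (h.mono fun a ha => congrArg (fun b : EReal => (-b).toENNReal) ha)
  rw [extIntegral, extIntegral, hpos, hneg]

end ExtIntegral

section RadialAverage

variable {n : ℕ} {F : Set (Matrix (Fin n) (Fin n) ℝ)} {X Y : Set (E n)} {u v : E n → EReal}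
  {C p r R : ℝ} {x : E n} {m : Measure (E n)}

/-- A rotation invariant probability measure carried by the closed unit ball: the averages
considered are those over its scaled translates. -/
structure IsRadialProbability (m : Measure (E n)) : Prop extends IsProbabilityMeasure m where
  isRotationInvariant : IsRotationInvariant m
  ae_norm_le : ∀ᵐ z ∂m, ‖z‖ ≤ 1

theorem isRadialProbability_ballMeasure : IsRadialProbability (ballMeasure n) :=
  ⟨isProbabilityMeasure_ballMeasure, isRotationInvariant_ballMeasure, ae_norm_le_ballMeasure⟩

theorem isRadialProbability_sphereMeasureE (hn : 1 ≤ n) :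
    IsRadialProbability (sphereMeasureE n) :=
  ⟨isProbabilityMeasure_sphereMeasureE hn, isRotationInvariant_sphereMeasureE,
    ae_norm_eq_sphereMeasureE.mono fun _ h => h.le⟩

/-- The average of `u` over the image of the measure `m` under `z ↦ x + r z`. -/
noncomputable def radialAvg (m : Measure (E n)) (u : E n → EReal) (x : E n) (r : ℝ) : EReal :=
  extIntegral m fun z => u (x + r • z)

theorem ballAvg_eq_radialAvg : ballAvg u x r = radialAvg (ballMeasure n) u x r := rfl

theorem sphereAvg_eq_radialAvg : sphereAvg u x r = radialAvg (sphereMeasureE n) u x r := by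
  have hemb : MeasurableEmbedding (Subtype.val : sphere (0 : E n) 1 → E n) :=
    MeasurableEmbedding.subtype_coe isClosed_sphere.measurableSet
  rw [sphereAvg, radialAvg, extIntegral, extIntegral, sphereMeasureE, hemb.lintegral_map,
    hemb.lintegral_map]

theorem radialAvg_congr (hm : IsRadialProbability m) (heq : Set.EqOn u v (closedBall x R))
    (hr : r ∈ Set.Icc 0 R) : radialAvg m u x r = radialAvg m v x r := by
  refine extIntegral_congr_ae ?_
  filter_upwards [hm.ae_norm_le] with z hz
  refine heq ?_
  rw [mem_closedBall_iff_norm, add_sub_cancel_left, norm_smul, Real.norm_of_nonneg hr.1]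
  exact (mul_le_of_le_one_right hr.1 hz).trans hr.2

theorem IsSubharmonicOn.mono (hu : IsSubharmonicOn F X u) (hYX : Y ⊆ X) :
    IsSubharmonicOn F Y u :=
  ⟨hu.usc.mono hYX, fun x hx => hu.ne_top x (hYX hx), fun x hx => hu.viscosity x (hYX hx)⟩

theorem IsSubharmonicOn.congr (hu : IsSubharmonicOn F X u) (hX : IsOpen X)
    (heq : Set.EqOn u v X) : IsSubharmonicOn F X v where
  usc x hx c hc := by
    have hux : u x < c := by rwa [heq hx]
    filter_upwards [hu.usc x hx c hux, self_mem_nhdsWithin] with y hy hyX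
    exact (heq hyX).symm.trans_lt hy
  ne_top x hx := by
    rw [← heq hx]
    exact hu.ne_top x hx
  viscosity x hx φ hφ hval hle := by
    refine hu.viscosity x hx φ hφ ((heq hx).trans hval) ?_
    filter_upwards [hle, hX.mem_nhds hx] with y hy hyX
    rwa [heq hyX]

/-- A function that is `F`-subharmonic on `Y` and, everywhere, measurable and bounded above by the
constant `C ≥ 0`. -/
structure IsBoundedSubharmonicOn (F : Set (Matrix (Fin n) (Fin n) ℝ)) (Y : Set (E n)) (C : ℝ)
    (v : E n → EReal) : Prop extends IsSubharmonicOn F Y v where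
  nonneg : 0 ≤ C
  measurable : Measurable v
  le : ∀ y, v y ≤ C

open Classical in
theorem upperSemicontinuous_piecewise_bot {K : Set (E n)} (hK : IsClosed K)
    (hu : UpperSemicontinuousOn u K) : UpperSemicontinuous (K.piecewise u ⊥) := by
  intro y c hc
  by_cases hy : y ∈ K
  · rw [Set.piecewise_eq_of_mem _ _ _ hy] at hc
    filter_upwards [mem_nhdsWithin_iff_eventually.1 (hu y hy c hc)] with z hz
    by_cases hzK : z ∈ K
    · rw [Set.piecewise_eq_of_mem _ _ _ hzK]
      exact hz hzK
    · rw [Set.piecewise_eq_of_notMem _ _ _ hzK]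
      exact bot_le.trans_lt hc
  · rw [Set.piecewise_eq_of_notMem _ _ _ hy] at hc
    filter_upwards [hK.isOpen_compl.mem_nhds hy] with z hz
    rwa [Set.piecewise_eq_of_notMem _ _ _ hz]

open Classical in
theorem IsSubharmonicOn.exists_isBoundedSubharmonicOn (hu : IsSubharmonicOn F X u)
    (hX : closedBall x R ⊆ X) :
    ∃ C v, IsBoundedSubharmonicOn F (ball x R) C v ∧ Set.EqOn u v (closedBall x R) := by
  obtain ⟨C, hC0, hC⟩ := hu.exists_le_coe (isCompact_closedBall x R) hX
  have heq : Set.EqOn u ((closedBall x R).piecewise u ⊥) (closedBall x R) :=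
    (Set.piecewise_eqOn _ u ⊥).symm
  refine ⟨C, (closedBall x R).piecewise u ⊥,
    ⟨(hu.mono (ball_subset_closedBall.trans hX)).congr isOpen_ball
      (heq.mono ball_subset_closedBall), hC0,
      (upperSemicontinuous_piecewise_bot isClosed_closedBall (hu.usc.mono hX)).measurable,
      Set.piecewise_le (s := closedBall x R) (g := fun _ => (C : EReal)) hC
        fun _ _ => bot_le⟩, heq⟩

theorem sphereMax_radial (hn : 1 ≤ n) {ψ : ℝ → EReal} (hr : 0 < r) :
    sphereMax (fun y : E n => ψ ‖y‖) 0 r = ψ r := by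
  refine le_antisymm (sphereMax_le hr.le fun y hy => ?_) ?_
  · rw [mem_sphere_zero_iff_norm.1 hy]
  · have hnorm : ‖(EuclideanSpace.single ⟨0, hn⟩ r : E n)‖ = r := by simp [abs_of_pos hr]
    simpa only [hnorm] using le_sphereMax (fun y : E n => ψ ‖y‖) hr
      (mem_sphere_zero_iff_norm.2 hnorm)

namespace IsBoundedSubharmonicOn

theorem measurable_gap (hv : IsBoundedSubharmonicOn F Y C v) : Measurable fun y => gap C (v y) :=
  (RieszDensity.measurable_gap C).comp hv.measurable

theorem radialAvg_eq_sub [IsProbabilityMeasure m] (hv : IsBoundedSubharmonicOn F Y C v) :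
    radialAvg m v x r = (C : EReal) - ((∫⁻ z, gap C (v (x + r • z)) ∂m : ENNReal) : EReal) :=
  extIntegral_eq_sub (hv.measurable.comp ((measurable_const_smul r).const_add x)) hv.nonneg
    fun _ => hv.le _

theorem radialAvg_zero [IsProbabilityMeasure m] (hv : IsBoundedSubharmonicOn F Y C v) :
    radialAvg m v x 0 = v x := by
  rw [hv.radialAvg_eq_sub]
  simp [coe_sub_gap (hv.le x)]

theorem radialAvg_ne_bot_iff [IsProbabilityMeasure m] (hv : IsBoundedSubharmonicOn F Y C v) :
    radialAvg m v x r ≠ ⊥ ↔ ∫⁻ z, gap C (v (x + r • z)) ∂m ≠ ⊤ := by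
  rw [hv.radialAvg_eq_sub, not_iff_not]
  refine ⟨fun h => ?_, fun h => by simp [h]⟩
  rw [← gap_coe_sub C (∫⁻ z, gap C (v (x + r • z)) ∂m), h, gap_bot]

theorem comp_rotation (hF : IsSTConeSubequation F) (hv : IsBoundedSubharmonicOn F Y C v)
    (hY : ball x R ⊆ Y) {g : Matrix (Fin n) (Fin n) ℝ} (hg : g * g.transpose = 1)
    (hinv : ∀ A ∈ F, g.transpose * A * g ∈ F) {a : ℝ} (ha : a ∈ Set.Icc 0 1) :
    IsSubharmonicOn F (ball 0 R) fun y => v (x + a • matMap g y) := by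
  rcases ha.1.eq_or_lt with rfl | ha0
  · simpa using isSubharmonicOn_const hF (ne_top_of_le_ne_top (EReal.coe_ne_top C) (hv.le x))
  · refine (hv.toIsSubharmonicOn.comp_similarity hF hg hinv ha0 x).mono fun y hy => hY ?_
    rw [mem_ball_iff_norm, add_sub_cancel_left, norm_smul, Real.norm_of_nonneg ha.1,
      norm_matMap (mul_eq_one_comm.1 hg)]
    exact (mul_le_of_le_one_left (norm_nonneg y) ha.2).trans_lt (mem_ball_zero_iff.1 hy)

theorem isSubharmonicOn_radialAvg (hF : IsSTConeSubequation F) (hconv : Convex ℝ F)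
    (hv : IsBoundedSubharmonicOn F Y C v) (hY : ball x R ⊆ Y) (hm : IsRadialProbability m) :
    IsSubharmonicOn F (ball 0 R) fun y => radialAvg m v x ‖y‖ := by
  obtain ⟨Ω, _, μ, M, h⟩ := hF.exists_isRandomRotation
  have := h.isProb
  have := hm.toIsProbabilityMeasure
  have hsub : ∀ q : Ω × E n, IsSubharmonicOn F (ball 0 R) fun y =>
      v (x + min ‖q.2‖ 1 • matMap (M q.1) y) := fun q =>
    hv.comp_rotation hF hY (h.orth q.1) (h.mem q.1)
      ⟨le_min (norm_nonneg _) zero_le_one, min_le_right _ _⟩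
  have hrot : Measurable fun q : (Ω × E n) × E n => matMap (M q.1.1) q.2 :=
    Measurable.fun_comp (g := fun q : Ω × E n => matMap (M q.1) q.2)
      (f := fun q : (Ω × E n) × E n => (q.1.1, q.2)) h.measurable
      (measurable_fst.fst.prodMk measurable_snd)
  have hmeas : Measurable fun q : (Ω × E n) × E n =>
      v (x + min ‖q.1.2‖ 1 • matMap (M q.1.1) q.2) :=
    hv.measurable.comp (measurable_const.add
      (Measurable.fun_smul (measurable_fst.snd.norm.min measurable_const) hrot))
  have hgap : Measurable fun z => gap C (v (x + z)) :=
    hv.measurable_gap.comp (measurable_const_add x)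
  refine (isSubharmonicOn_average hF hconv isOpen_ball (μ.prod m) hsub
    (fun _ _ _ => hv.le _) hmeas).congr isOpen_ball fun y _ => ?_
  rw [hv.radialAvg_eq_sub, ← h.lintegral_prod_eq hm.isRotationInvariant hm.ae_norm_le hgap y]

theorem le_radialAvg (hF : IsSTConeSubequation F) (hconv : Convex ℝ F)
    (hK : ExcludesRieszKernel F p) (hn : 1 ≤ n) (hv : IsBoundedSubharmonicOn F Y C v)
    (hY : ball x R ⊆ Y) (hm : IsRadialProbability m) (hr : r ∈ Set.Ioo 0 R) :
    v x ≤ radialAvg m v x r := by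
  have := hm.toIsProbabilityMeasure
  calc v x = radialAvg m v x ‖(0 : E n)‖ := by rw [norm_zero, hv.radialAvg_zero]
    _ ≤ sphereMax (fun y => radialAvg m v x ‖y‖) 0 r :=
      (hv.isSubharmonicOn_radialAvg hF hconv hY hm).le_sphereMax_of_mem_closedBall hK
        (closedBall_subset_ball hr.2) hr.1 (mem_closedBall_self hr.1.le)
    _ = radialAvg m v x r := sphereMax_radial hn hr.1

theorem isFiniteKernelConvex_radialAvg (hF : IsSTConeSubequation F) (hconv : Convex ℝ F)
    (hK : ExcludesRieszKernel F p) (hn : 1 ≤ n) (hv : IsBoundedSubharmonicOn F Y C v)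
    (hY : ball x R ⊆ Y) (hm : IsRadialProbability m)
    (hne : ∃ r ∈ Set.Ico 0 R, radialAvg m v x r ≠ ⊥) :
    IsFiniteKernelConvex p R (radialAvg m v x) := by
  obtain ⟨r, hr, hrbot⟩ := hne
  refine IsFiniteKernelConvex.of_forall_lt hr.2 fun R' hrR' hR' => ?_
  have hnorm : ‖(EuclideanSpace.single ⟨0, hn⟩ r : E n)‖ = r := by simp [abs_of_nonneg hr.1]
  exact ((hv.isSubharmonicOn_radialAvg hF hconv hY hm).isFiniteKernelConvex_sphereMax hK
    (closedBall_subset_ball hR') ⟨EuclideanSpace.single ⟨0, hn⟩ r,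
      by rwa [mem_ball_zero_iff, hnorm], by rwa [hnorm]⟩).congr
        fun ρ hρ => sphereMax_radial hn hρ.1

end IsBoundedSubharmonicOn

end RadialAverage

section VolumeAverage

variable {n : ℕ} {A : Set (E n)} {w : E n → ENNReal} {r ρ : ℝ} {x : E n}

theorem lintegral_cond (f : E n → ENNReal) :
    ∫⁻ z, f z ∂(ProbabilityTheory.cond volume A) = (volume A)⁻¹ * ∫⁻ z in A, f z := by
  rw [ProbabilityTheory.cond, lintegral_smul_measure, smul_eq_mul]

theorem setLIntegral_add_left (hA : MeasurableSet A) (x : E n) :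
    ∫⁻ z in A, w (x + z) = ∫⁻ y in {y | y - x ∈ A}, w y := by
  have hAx : MeasurableSet {y | y - x ∈ A} := hA.preimage (measurable_sub_const x)
  rw [← lintegral_indicator hA, ← lintegral_indicator hAx,
    ← lintegral_add_left_eq_self ({y | y - x ∈ A}.indicator w) x]
  refine lintegral_congr fun z => ?_
  by_cases hz : z ∈ A <;> simp [hz]

theorem continuousAt_setLIntegral_add_left (hw : Measurable w) (hA : MeasurableSet A)
    (hfrontier : volume (frontier A) = 0) (hAr : A ⊆ closedBall 0 r) (hρ : r < ρ)
    (hfin : ∫⁻ y in closedBall x ρ, w y ≠ ⊤) :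
    ContinuousAt (fun x' => ∫⁻ z in A, w (x' + z)) x := by
  have hAx : ∀ x', MeasurableSet {y | y - x' ∈ A} := fun x' =>
    hA.preimage (measurable_sub_const x')
  simp only [setLIntegral_add_left hA, ← lintegral_indicator (hAx _)]
  refine tendsto_lintegral_filter_of_dominated_convergence ((closedBall x ρ).indicator w)
    (Eventually.of_forall fun x' => hw.indicator (hAx x')) ?_ ?_ ?_
  · filter_upwards [ball_mem_nhds x (sub_pos.2 hρ)] with x' hx'
    refine Eventually.of_forall (Set.indicator_le_indicator_of_subset (fun y hy => ?_)
      fun _ => zero_le)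
    have hyx' : dist y x' ≤ r := by simpa [dist_eq_norm] using hAr hy
    exact mem_closedBall.2 (by linarith [dist_triangle y x' x, mem_ball.1 hx'])
  · rwa [lintegral_indicator isClosed_closedBall.measurableSet]
  · have hae : ∀ᵐ y, y - x ∉ frontier A :=
      (measurePreserving_sub_right volume x).quasiMeasurePreserving.ae
        (measure_eq_zero_iff_ae_notMem.1 hfrontier)
    filter_upwards [hae] with y hy
    have hcont : ContinuousAt (fun x' => y - x') x := by fun_prop
    refine tendsto_nhds_of_eventually_eq ?_
    rw [← Set.mem_compl_iff, compl_frontier_eq_union_interior] at hy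
    rcases hy with hy | hy
    · have hyA : y ∈ {y | y - x ∈ A} := interior_subset (s := A) hy
      filter_upwards [hcont.eventually (isOpen_interior.mem_nhds hy)] with x' hx'
      have hyA' : y ∈ {y | y - x' ∈ A} := interior_subset (s := A) hx'
      rw [Set.indicator_of_mem hyA, Set.indicator_of_mem hyA']
    · have hyA : y ∉ {y | y - x ∈ A} := interior_subset (s := Aᶜ) hy
      filter_upwards [hcont.eventually (isOpen_interior.mem_nhds hy)] with x' hx'
      have hyA' : y ∉ {y | y - x' ∈ A} := interior_subset (s := Aᶜ) hx'
      rw [Set.indicator_of_notMem hyA, Set.indicator_of_notMem hyA']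

end VolumeAverage

section Integrability

variable {n : ℕ} {F : Set (Matrix (Fin n) (Fin n) ℝ)} {A X Y : Set (E n)} {u v : E n → EReal}
  {C p r R : ℝ} {x : E n} {m : Measure (E n)}

namespace IsBoundedSubharmonicOn

theorem continuousAt_radialAvg_cond (hv : IsBoundedSubharmonicOn F Y C v) (hA : MeasurableSet A)
    (hA0 : volume A ≠ 0) (hfrontier : volume (frontier A) = 0) (hAr : A ⊆ closedBall 0 r)
    (hrR : r < R) (hfin : ∫⁻ y in closedBall x R, gap C (v y) ≠ ⊤) :
    ContinuousAt (fun y => radialAvg (ProbabilityTheory.cond volume A) v y 1) x := by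
  have := ProbabilityTheory.cond_isProbabilityMeasure_of_finite hA0
    (measure_ne_top_of_subset hAr measure_closedBall_lt_top.ne)
  simp only [hv.radialAvg_eq_sub, one_smul, lintegral_cond]
  exact (continuous_coe_sub C).continuousAt.comp <| ENNReal.Tendsto.const_mul
    (continuousAt_setLIntegral_add_left hv.measurable_gap hA hfrontier hAr hrR hfin)
    (Or.inr (ENNReal.inv_ne_top.2 hA0))

theorem radialAvg_ballMeasure (hv : IsBoundedSubharmonicOn F Y C v) (hr : 0 < r) (x : E n) :
    radialAvg (ballMeasure n) v x r =
      radialAvg (ProbabilityTheory.cond volume (closedBall 0 r)) v x 1 := by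
  have := isProbabilityMeasure_cond_closedBall (n := n) hr
  have hgap : Measurable fun z => gap C (v (x + z)) :=
    hv.measurable_gap.comp (measurable_const_add x)
  simp only [hv.radialAvg_eq_sub, one_smul]
  rw [← map_smul_ballMeasure hr, lintegral_map hgap (measurable_const_smul r)]

theorem continuousAt_radialAvg_ballMeasure (hv : IsBoundedSubharmonicOn F Y C v) (hr : 0 < r)
    (hrR : r < R) (hfin : ∫⁻ y in closedBall x R, gap C (v y) ≠ ⊤) :
    ContinuousAt (fun y => radialAvg (ballMeasure n) v y r) x := by
  simp only [hv.radialAvg_ballMeasure hr]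
  exact hv.continuousAt_radialAvg_cond isClosed_closedBall.measurableSet
    (measure_closedBall_pos volume _ hr).ne' ((convex_closedBall 0 r).addHaar_frontier volume)
    subset_rfl hrR hfin

theorem radialAvg_ballMeasure_ne_bot_iff (hv : IsBoundedSubharmonicOn F Y C v) (hr : 0 < r) :
    radialAvg (ballMeasure n) v x r ≠ ⊥ ↔ ∫⁻ y in closedBall x r, gap C (v y) ≠ ⊤ := by
  have := isProbabilityMeasure_cond_closedBall (n := n) hr
  have hball : {y | y - x ∈ closedBall 0 r} = closedBall x r := by
    ext y
    rw [Set.mem_ofPred_eq, mem_closedBall_zero_iff, mem_closedBall_iff_norm]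
  have hvol0 : volume (closedBall (0 : E n) r) ≠ 0 := (measure_closedBall_pos volume _ hr).ne'
  have hvol : volume (closedBall (0 : E n) r) ≠ ⊤ := measure_closedBall_lt_top.ne
  rw [hv.radialAvg_ballMeasure hr, hv.radialAvg_ne_bot_iff, not_iff_not]
  simp only [one_smul]
  rw [lintegral_cond,
    setLIntegral_add_left (w := fun y => gap C (v y)) isClosed_closedBall.measurableSet, hball,
    ENNReal.mul_eq_top]
  simp [hvol0, hvol]

theorem setLIntegral_gap_ne_top (hF : IsSTConeSubequation F) (hconv : Convex ℝ F)
    (hK : ExcludesRieszKernel F p) (hn : 1 ≤ n) (hv : IsBoundedSubharmonicOn F Y C v)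
    (hY : ball x R ⊆ Y) (hne : ∃ y ∈ ball x (R / 4), v y ≠ ⊥) (hr : r ∈ Set.Ioo 0 R) :
    ∫⁻ y in closedBall x r, gap C (v y) ≠ ⊤ := by
  obtain ⟨y, hyx, hy⟩ := hne
  have hR : 0 < R := hr.1.trans hr.2
  have hyx' : dist y x < R / 4 := hyx
  have hyY : ball y (3 * R / 4) ⊆ Y := (ball_subset_ball' (by linarith)).trans hY
  have hy_int : ∫⁻ z in closedBall y (R / 2), gap C (v z) ≠ ⊤ :=
    (hv.radialAvg_ballMeasure_ne_bot_iff (half_pos hR)).1 <| ne_bot_of_le_ne_bot hy <|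
      hv.le_radialAvg hF hconv hK hn hyY isRadialProbability_ballMeasure
        ⟨by linarith, by linarith⟩
  have hx_int : ∫⁻ z in closedBall x (R / 4), gap C (v z) ≠ ⊤ :=
    ne_top_of_le_ne_top hy_int <| lintegral_mono_set <|
      closedBall_subset_closedBall' (by rw [dist_comm]; linarith)
  exact (hv.radialAvg_ballMeasure_ne_bot_iff hr.1).1 <|
    (hv.isFiniteKernelConvex_radialAvg hF hconv hK hn hY isRadialProbability_ballMeasure
      ⟨R / 4, ⟨by linarith, by linarith⟩,
        (hv.radialAvg_ballMeasure_ne_bot_iff (by linarith)).2 hx_int⟩).ne_bot r hr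

theorem radialAvg_one_eq_sub (hF : IsSTConeSubequation F) (hn : 1 ≤ n)
    (hv : IsBoundedSubharmonicOn F Y C v) [IsProbabilityMeasure m] (hm : IsRotationInvariant m) :
    radialAvg m v x 1 = (C : EReal) -
      ((∫⁻ z, gap C (radialAvg (sphereMeasureE n) v x ‖z‖) ∂m : ENNReal) : EReal) := by
  obtain ⟨Ω, _, μ, M, h⟩ := hF.exists_isRandomRotation
  have := isProbabilityMeasure_sphereMeasureE hn
  have hgap : Measurable fun z => gap C (v (x + z)) :=
    hv.measurable_gap.comp (measurable_const_add x)
  simp only [hv.radialAvg_eq_sub, one_smul, gap_coe_sub]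
  rw [h.lintegral_polar hm isRotationInvariant_sphereMeasureE ae_norm_eq_sphereMeasureE hgap]

theorem radialAvg_one_mem_Icc (hF : IsSTConeSubequation F) (hn : 1 ≤ n)
    (hv : IsBoundedSubharmonicOn F Y C v) [IsProbabilityMeasure m] (hm : IsRotationInvariant m)
    {a b : EReal} (hab : ∀ᵐ z ∂m, radialAvg (sphereMeasureE n) v x ‖z‖ ∈ Set.Icc a b) :
    radialAvg m v x 1 ∈ Set.Icc a b := by
  have := isProbabilityMeasure_sphereMeasureE hn
  have hle : ∀ s, radialAvg (sphereMeasureE n) v x s ≤ C := fun s => by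
    rw [hv.radialAvg_eq_sub]
    exact coe_sub_le C _
  have hconst : ∀ c : ENNReal, ∫⁻ _, c ∂m = c := fun c => by simp
  obtain ⟨z, hz⟩ := hab.exists
  rw [hv.radialAvg_one_eq_sub hF hn hm]
  constructor
  · rw [← coe_sub_gap (hz.1.trans (hle _)), ← hconst (gap C a)]
    exact coe_sub_antitone C (lintegral_mono_ae (hab.mono fun z hz => gap_antitone C hz.1))
  · rcases le_total (C : EReal) b with hCb | hbC
    · exact (coe_sub_le C _).trans hCb
    · rw [← coe_sub_gap hbC, ← hconst (gap C b)]
      exact coe_sub_antitone C (lintegral_mono_ae (hab.mono fun z hz => gap_antitone C hz.2))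

theorem exists_radialAvg_sphereMeasureE_ne_bot (hF : IsSTConeSubequation F) (hn : 1 ≤ n)
    (hv : IsBoundedSubharmonicOn F Y C v) (hr : 0 < r)
    (hfin : ∫⁻ y in closedBall x r, gap C (v y) ≠ ⊤) :
    ∃ s ∈ Set.Icc 0 r, radialAvg (sphereMeasureE n) v x s ≠ ⊥ := by
  by_contra! hbot
  have := isProbabilityMeasure_cond_closedBall (n := n) hr
  refine (hv.radialAvg_ballMeasure_ne_bot_iff hr).2 hfin ?_
  rw [hv.radialAvg_ballMeasure hr]
  refine le_bot_iff.1 (hv.radialAvg_one_mem_Icc hF hn (a := ⊥)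
    (isRotationInvariant_cond_closedBall r) ?_).2
  filter_upwards [ProbabilityTheory.ae_cond_mem isClosed_closedBall.measurableSet] with z hz
  rw [hbot ‖z‖ ⟨norm_nonneg z, mem_closedBall_zero_iff.1 hz⟩]
  exact Set.left_mem_Icc.2 le_rfl

end IsBoundedSubharmonicOn

end Integrability

section Densities

variable {n : ℕ} {F : Set (Matrix (Fin n) (Fin n) ℝ)} {X : Set (E n)} {u : E n → EReal}
  {p r s t R : ℝ} {x : E n}

theorem eventually_closedBall_subset (hr : r < R) :
    ∀ᶠ y in 𝓝 x, ∃ R', r < R' ∧ closedBall y R' ⊆ closedBall x R := by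
  filter_upwards [ball_mem_nhds x (sub_pos.2 hr)] with y hy
  obtain ⟨R', hrR', hR'⟩ := exists_between (lt_sub_comm.1 (mem_ball.1 hy))
  exact ⟨R', hrR', closedBall_subset_closedBall' (by linarith)⟩

/-- The half-open annulus `{s < ‖z‖ ≤ t}`. -/
def annulus (n : ℕ) (s t : ℝ) : Set (E n) := closedBall 0 t \ closedBall 0 s

theorem mem_annulus {z : E n} : z ∈ annulus n s t ↔ ‖z‖ ∈ Set.Ioc s t := by
  rw [annulus, Set.mem_sdiff, mem_closedBall_zero_iff, mem_closedBall_zero_iff, not_le, and_comm,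
    Set.mem_Ioc]

theorem measurableSet_annulus : MeasurableSet (annulus n s t) :=
  isClosed_closedBall.measurableSet.diff isClosed_closedBall.measurableSet

theorem volume_annulus_ne_zero (hn : 1 ≤ n) (hs : 0 ≤ s) (hst : s < t) :
    volume (annulus n s t) ≠ 0 := by
  obtain ⟨ρ, hsρ, hρt⟩ := exists_between hst
  have hnorm : ‖(EuclideanSpace.single ⟨0, hn⟩ ρ : E n)‖ = ρ := by
    simp [abs_of_pos (hs.trans_lt hsρ)]
  have hopen : IsOpen (ball (0 : E n) t \ closedBall 0 s) := isOpen_ball.sdiff isClosed_closedBall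
  have hne : (ball (0 : E n) t \ closedBall 0 s).Nonempty :=
    ⟨EuclideanSpace.single ⟨0, hn⟩ ρ, by rwa [mem_ball_zero_iff, hnorm],
      by rwa [mem_closedBall_zero_iff, hnorm, not_le]⟩
  exact fun h => hopen.measure_ne_zero volume hne
    (measure_mono_null (Set.sdiff_subset_sdiff_left ball_subset_closedBall) h)

theorem volume_frontier_annulus : volume (frontier (annulus n s t)) = 0 := by
  rw [annulus, Set.sdiff_eq]
  refine null_frontier_inter ((convex_closedBall 0 t).addHaar_frontier volume) ?_
  rw [frontier_compl]
  exact (convex_closedBall 0 s).addHaar_frontier volume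

namespace IsSubharmonicOn

theorem exists_isBoundedSubharmonicOn_lintegral_ne_top (hF : IsSTConeSubequation F)
    (hconv : Convex ℝ F) (hK : ExcludesRieszKernel F p) (hn : 1 ≤ n) (hu : IsSubharmonicOn F X u)
    (hXo : IsOpen X) (hfin : ∀ x ∈ X, ∃ y ∈ connectedComponentIn X x, u y ≠ ⊥)
    (hR : 0 < R) (hX : closedBall x R ⊆ X) :
    ∃ C v, IsBoundedSubharmonicOn F (ball x R) C v ∧ Set.EqOn u v (closedBall x R) ∧
      ∀ r ∈ Set.Ioo 0 R, ∫⁻ y in closedBall x r, gap C (v y) ≠ ⊤ := by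
  obtain ⟨C, v, hv, heq⟩ := hu.exists_isBoundedSubharmonicOn hX
  obtain ⟨y, hyx, hy⟩ := hu.exists_ne_bot hK hXo hfin (hX (mem_closedBall_self hR.le))
    (show 0 < R / 4 by linarith)
  have hyR : y ∈ closedBall x R := ball_subset_closedBall (ball_subset_ball (by linarith) hyx)
  exact ⟨C, v, hv, heq, fun r hr => hv.setLIntegral_gap_ne_top hF hconv hK hn subset_rfl
    ⟨y, hyx, heq hyR ▸ hy⟩ hr⟩

theorem isFiniteKernelConvex_ballAvg (hF : IsSTConeSubequation F)
    (hconv : Convex ℝ F) (hK : ExcludesRieszKernel F p) (hn : 1 ≤ n) (hu : IsSubharmonicOn F X u)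
    (hXo : IsOpen X) (hfin : ∀ x ∈ X, ∃ y ∈ connectedComponentIn X x, u y ≠ ⊥)
    (hR : 0 < R) (hX : closedBall x R ⊆ X) : IsFiniteKernelConvex p R (ballAvg u x) := by
  obtain ⟨C, v, hv, heq, hint⟩ :=
    hu.exists_isBoundedSubharmonicOn_lintegral_ne_top hF hconv hK hn hXo hfin hR hX
  have hne : ∃ r ∈ Set.Ico 0 R, radialAvg (ballMeasure n) v x r ≠ ⊥ :=
    ⟨R / 2, ⟨(half_pos hR).le, half_lt_self hR⟩, (hv.radialAvg_ballMeasure_ne_bot_iff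
      (half_pos hR)).2 (hint _ ⟨half_pos hR, half_lt_self hR⟩)⟩
  refine (hv.isFiniteKernelConvex_radialAvg hF hconv hK hn subset_rfl
    isRadialProbability_ballMeasure hne).congr fun r hr => ?_
  rw [ballAvg_eq_radialAvg, radialAvg_congr isRadialProbability_ballMeasure heq
    (Set.Ioo_subset_Icc_self hr)]

theorem isFiniteKernelConvex_sphereAvg (hF : IsSTConeSubequation F)
    (hconv : Convex ℝ F) (hK : ExcludesRieszKernel F p) (hn : 1 ≤ n) (hu : IsSubharmonicOn F X u)
    (hXo : IsOpen X) (hfin : ∀ x ∈ X, ∃ y ∈ connectedComponentIn X x, u y ≠ ⊥)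
    (hR : 0 < R) (hX : closedBall x R ⊆ X) : IsFiniteKernelConvex p R (sphereAvg u x) := by
  obtain ⟨C, v, hv, heq, hint⟩ :=
    hu.exists_isBoundedSubharmonicOn_lintegral_ne_top hF hconv hK hn hXo hfin hR hX
  obtain ⟨s, hs, hne⟩ := hv.exists_radialAvg_sphereMeasureE_ne_bot hF hn (half_pos hR)
    (hint _ ⟨half_pos hR, half_lt_self hR⟩)
  refine (hv.isFiniteKernelConvex_radialAvg hF hconv hK hn subset_rfl
    (isRadialProbability_sphereMeasureE hn)
    ⟨s, ⟨hs.1, hs.2.trans_lt (half_lt_self hR)⟩, hne⟩).congr fun r hr => ?_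
  rw [sphereAvg_eq_radialAvg, radialAvg_congr (isRadialProbability_sphereMeasureE hn) heq
    (Set.Ioo_subset_Icc_self hr)]

theorem upperSemicontinuousDensity_ballAvg (hF : IsSTConeSubequation F)
    (hconv : Convex ℝ F) (hK : ExcludesRieszKernel F p) (hn : 1 ≤ n) (hu : IsSubharmonicOn F X u)
    (hXo : IsOpen X) (hfin : ∀ x ∈ X, ∃ y ∈ connectedComponentIn X x, u y ≠ ⊥) :
    UpperSemicontinuousDensity p X (ballAvg u) := by
  have hconvex := fun x R (hR : 0 < R) (hX : closedBall x R ⊆ X) =>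
    hu.isFiniteKernelConvex_ballAvg hF hconv hK hn hXo hfin hR hX
  refine upperSemicontinuousDensity_of_forall_sandwich hXo hconvex
    fun x R hX s t hs hst htR => ?_
  obtain ⟨C, v, hv, heq, hint⟩ := hu.exists_isBoundedSubharmonicOn_lintegral_ne_top hF hconv hK hn
    hXo hfin (hs.trans (hst.trans htR)) hX
  refine ⟨fun y => radialAvg (ballMeasure n) v y s, hv.continuousAt_radialAvg_ballMeasure hs hst
    (hint t ⟨hs.trans hst, htR⟩), ?_⟩
  filter_upwards [eventually_closedBall_subset htR] with y ⟨R', htR', hyR'⟩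
  have hsR' := hst.trans htR'
  rw [← radialAvg_congr isRadialProbability_ballMeasure (heq.mono hyR') ⟨hs.le, hsR'.le⟩,
    ← ballAvg_eq_radialAvg]
  exact ⟨le_rfl, (hconvex y R' (hs.trans hsR') (hyR'.trans hX)).monotoneOn ⟨hs, hsR'⟩
    ⟨hs.trans hst, htR'⟩ hst.le⟩

theorem upperSemicontinuousDensity_sphereAvg (hF : IsSTConeSubequation F)
    (hconv : Convex ℝ F) (hK : ExcludesRieszKernel F p) (hn : 1 ≤ n) (hu : IsSubharmonicOn F X u)
    (hXo : IsOpen X) (hfin : ∀ x ∈ X, ∃ y ∈ connectedComponentIn X x, u y ≠ ⊥) :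
    UpperSemicontinuousDensity p X (sphereAvg u) := by
  have hconvex := fun x R (hR : 0 < R) (hX : closedBall x R ⊆ X) =>
    hu.isFiniteKernelConvex_sphereAvg hF hconv hK hn hXo hfin hR hX
  refine upperSemicontinuousDensity_of_forall_sandwich hXo hconvex
    fun x R hX s t hs hst htR => ?_
  have ht := hs.trans hst
  obtain ⟨C, v, hv, heq, hint⟩ :=
    hu.exists_isBoundedSubharmonicOn_lintegral_ne_top hF hconv hK hn hXo hfin (ht.trans htR) hX
  obtain ⟨ρ, htρ, hρR⟩ := exists_between htR
  have hA0 := volume_annulus_ne_zero hn hs.le hst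
  have hAt : annulus n s t ⊆ closedBall 0 t := Set.sdiff_subset
  have := ProbabilityTheory.cond_isProbabilityMeasure_of_finite hA0
    (measure_ne_top_of_subset hAt measure_closedBall_lt_top.ne)
  refine ⟨fun y => radialAvg (ProbabilityTheory.cond volume (annulus n s t)) v y 1,
    hv.continuousAt_radialAvg_cond measurableSet_annulus hA0 volume_frontier_annulus hAt htρ
      (hint ρ ⟨ht.trans htρ, hρR⟩), ?_⟩
  filter_upwards [eventually_closedBall_subset htR] with y ⟨R', htR', hyR'⟩
  have hmono := (hconvex y R' (ht.trans htR') (hyR'.trans hX)).monotoneOn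
  refine hv.radialAvg_one_mem_Icc hF hn (isRotationInvariant_cond measurableSet_annulus
    fun z z' h => by rw [mem_annulus, mem_annulus, h]) ?_
  filter_upwards [ProbabilityTheory.ae_cond_mem measurableSet_annulus] with z hz
  have hz' := mem_annulus.1 hz
  have hzR' : ‖z‖ ∈ Set.Ioo 0 R' := ⟨hs.trans hz'.1, hz'.2.trans_lt htR'⟩
  rw [← radialAvg_congr (isRadialProbability_sphereMeasureE hn) (heq.mono hyR')
    (Set.Ioo_subset_Icc_self hzR'), ← sphereAvg_eq_radialAvg]
  exact ⟨hmono ⟨hs, hst.trans htR'⟩ hzR' hz'.1.le, hmono hzR' ⟨ht, htR'⟩ hz'.2⟩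

end IsSubharmonicOn

end Densities
end RieszDensity

theorem theorem7p4 (n : ℕ) (hn : 1 ≤ n)
    (F : Set (Matrix (Fin n) (Fin n) ℝ)) (hF : RieszDensity.IsSTConeSubequation F)
    (p : ℝ) (hp : RieszDensity.rieszChar F = (p : EReal))
    (X : Set (RieszDensity.E n)) (hX : IsOpen X)
    (u : RieszDensity.E n → EReal) (hu : RieszDensity.IsSubharmonicOn F X u)
    (hfin : ∀ x ∈ X, ∃ y ∈ connectedComponentIn X x, u y ≠ ⊥) :
    RieszDensity.UpperSemicontinuousDensity p X (RieszDensity.sphereMax u) ∧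
      (Convex ℝ F →
        RieszDensity.UpperSemicontinuousDensity p X (RieszDensity.sphereAvg u) ∧
          RieszDensity.UpperSemicontinuousDensity p X (RieszDensity.ballAvg u)) := by
  have hK := hF.excludesRieszKernel hp hn
  exact ⟨hu.upperSemicontinuousDensity_sphereMax hK hX hfin, fun hconv =>
    ⟨hu.upperSemicontinuousDensity_sphereAvg hF hconv hK hn hX hfin,
      hu.upperSemicontinuousDensity_ballAvg hF hconv hK hn hX hfin⟩⟩
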